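/- Let $R$ be a commutative Artinian ring and $A\neq 0$ a basic Artin algebra over $R$ (finitely generated as an $R$-module), with a complete set $e_1,\dots,e_n$ of primitive orthogonal idempotents, ordered by their indices; modules are finitely generated left $A$-modules. Let $D=\mathrm{Hom}_R(-,J)$ with $J$ an injective envelope of $R/\mathrm{rad}\,R$. Let $P(i)=Ae_i$, let $E(i)$ be its simple top, and let $I(i)=D(e_iA)$ be the injective envelope of $E(i)$. Let $\Delta(i)$ be the maximal factor module of $P(i)$ without composition factors $E(j)$, $j>i$, and $\overline\Delta(i)$ the maximal factor module of $\Delta(i)$ with $[\overline\Delta(i):E(i)]=1$. Dually, let $\nabla(i)$ be the maximal submodule of $I(i)$ without composition factors $E(j)$, $j>i$, and $\overline\nabla(i)$ the maximal submodule of $\nabla(i)$ with $[\overline\nabla(i):E(i)]=1$. For a family $\Theta$ of modules, $\mathcal F(\Theta)$ denotes the class of modules with a finite filtration whose factors are isomorphic to members of $\Theta$, and $\mathrm{add}\,T$ denotes the class of direct summands of finite direct sums of copies of $T$. For a module $X$ let $\overline\nabla\text{-gfd}(X)$, respectively $T\text{-codim}(X)$, be the smallest $d\ge 0$ for which there is an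 exact sequence $0\to X\to M_0\to\cdots\to M_d\to 0$ with all $M_i$ in $\mathcal F(\overline\nabla)$, respectively in $\mathrm{add}\,T$. Let $\overline\Delta\text{-gfd}(X)$, respectively $S\text{-dim}(X)$, be the smallest $d\ge0$ for which there is an exact sequence $0\to M_d\to\cdots\to M_0\to X\to 0$ with all $M_i$ in $\mathcal F(\overline\Delta)$, respectively in $\mathrm{add}\,S$. (Each of these is $\infty$ if there is no such sequence.) Let $\overline\nabla\text{-gfd}(A)$ and $\overline\Delta\text{-gfd}(A)$, for the algebra $A$, be the suprema of $\overline\nabla\text{-gfd}(X)$ and $\overline\Delta\text{-gfd}(X)$ over all finitely generated $A$-modules $X$. Suppose that $A$ is properly stratified, that is, ${}_AA\in\mathcal F(\Delta)$ and ${}_AA\in\mathcal F(\overline\Delta)$. Let $T$ and $S$ be a characteristic tilting and a characteristic cotilting module, that is, finitely generated modules with $$\mathrm{add}\,T=\mathcal F(\Delta)\cap\mathcal F(\overline\nabla),\qquad \mathrm{add}\,S=\mathcal F(\nabla)\cap\mathcal F(\overline\Delta).$$ Then $$\overline\nabla\text{-gfd}(A)=\mathrm{proj.dim}(T)=T\text{-codim}({}_AA)=\overline\nabla\text{-gfd}({}_AA),$$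 $$\overline\Delta\text{-gfd}(A)=\mathrm{inj.dim}(S)=S\text{-dim}(D(A_A))=\overline\Delta\text{-gfd}(D(A_A)),$$ and all these numbers are finite. -/

import Mathlib

universe u v w

namespace GoodFilt

noncomputable section

/-! ### Composition multiplicities -/

/-- The composition multiplicity `[M : E]` equals `k`: there is a composition series
`0 = M_0 ⋖ M_1 ⋖ ⋯ ⋖ M_l = M` with exactly `k` factors isomorphic to `E`
(by Jordan-Hölder, every composition series then has this property). -/
def MultEq (A : Type u) [Ring A] (M : Type v) [AddCommGroup M] [Module A M]
    (E : Type w) [AddCommGroup E] [Module A E] (k : ℕ) : Prop :=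
  ∃ s : CompositionSeries (Submodule A M), s.head = ⊥ ∧ s.last = ⊤ ∧
    Nat.card {l : Fin s.length //
      Nonempty ((↥(s l.succ) ⧸ (s l.castSucc).submoduleOf (s l.succ)) ≃ₗ[A] E)} = k

/-! ### Filtrations, `add`, and (co)resolutions -/

/-- `M` lies in `F(Θ)`: there is a finite filtration `0 = M_t ⊆ ⋯ ⊆ M_1 ⊆ M_0 = M` by submodules
each of whose factors `M_l / M_{l+1}` is isomorphic to some `Θ i`. -/
def Filt {A : Type u} [Ring A] {ι : Type} (Θ : ι → ModuleCat.{u} A) (M : ModuleCat.{u} A) :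
    Prop :=
  ∃ (t : ℕ) (N : Fin (t + 1) → Submodule A M), N 0 = ⊤ ∧ N (Fin.last t) = ⊥ ∧
    ∀ l : Fin t, N l.succ ≤ N l.castSucc ∧
      ∃ i : ι, Nonempty ((↥(N l.castSucc) ⧸ (N l.succ).submoduleOf (N l.castSucc)) ≃ₗ[A] Θ i)

/-- `X` lies in `add T`: it is a direct summand of a finite direct sum of copies of `T`. -/
def InAdd {A : Type u} [Ring A] (T X : ModuleCat.{u} A) : Prop :=
  ∃ (m : ℕ) (i : X →ₗ[A] (Fin m → T)) (p : (Fin m → T) →ₗ[A] X), p ∘ₗ i = LinearMap.id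

/-- There is an exact sequence `0 → X → M_0 → ⋯ → M_d → 0` with all `M_i` in the class `C`.
(The sequence is continued by `M_i = 0` for `i > d`.) -/
def HasCores {A : Type u} [Ring A] (C : ModuleCat.{u} A → Prop) (X : ModuleCat.{u} A) (d : ℕ) :
    Prop :=
  ∃ (M : ℕ → ModuleCat.{u} A) (ε : X →ₗ[A] M 0) (f : ∀ i : ℕ, M i →ₗ[A] M (i + 1)),
    (∀ i ≤ d, C (M i)) ∧ (∀ i > d, Subsingleton (M i)) ∧
    Function.Injective ε ∧ Function.Exact ε (f 0) ∧ ∀ i, Function.Exact (f i) (f (i + 1))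

/-- There is an exact sequence `0 → M_d → ⋯ → M_0 → X → 0` with all `M_i` in the class `C`.
(The sequence is continued by `M_i = 0` for `i > d`.) -/
def HasRes {A : Type u} [Ring A] (C : ModuleCat.{u} A → Prop) (X : ModuleCat.{u} A) (d : ℕ) :
    Prop :=
  ∃ (M : ℕ → ModuleCat.{u} A) (π : M 0 →ₗ[A] X) (f : ∀ i : ℕ, M (i + 1) →ₗ[A] M i),
    (∀ i ≤ d, C (M i)) ∧ (∀ i > d, Subsingleton (M i)) ∧
    Function.Surjective π ∧ Function.Exact (f 0) π ∧ ∀ i, Function.Exact (f (i + 1)) (f i)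

/-- The smallest `d` such that `X` has a `C`-coresolution of length `d` (`⊤` if there is none). -/
def coresDim {A : Type u} [Ring A] (C : ModuleCat.{u} A → Prop) (X : ModuleCat.{u} A) : ℕ∞ :=
  ⨅ (d : ℕ) (_ : HasCores C X d), (d : ℕ∞)

/-- The smallest `d` such that `X` has a `C`-resolution of length `d` (`⊤` if there is none). -/
def resDim {A : Type u} [Ring A] (C : ModuleCat.{u} A → Prop) (X : ModuleCat.{u} A) : ℕ∞ :=
  ⨅ (d : ℕ) (_ : HasRes C X d), (d : ℕ∞)

/-- `T-codim(X)`. -/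
def addCodim {A : Type u} [Ring A] (T X : ModuleCat.{u} A) : ℕ∞ := coresDim (InAdd T) X

/-- `S-dim(X)`. -/
def addDim {A : Type u} [Ring A] (S X : ModuleCat.{u} A) : ℕ∞ := resDim (InAdd S) X

/-! ### The duality `D` on the regular module -/

/-- `J` is an injective envelope of the `R`-module `M`: it is injective and `M` embeds into it
with essential image. -/
def IsInjEnvelope (R : Type u) [Ring R] (M J : Type u) [AddCommGroup M] [Module R M]
    [AddCommGroup J] [Module R J] : Prop :=
  Module.Injective R J ∧ ∃ ι : M →ₗ[R] J, Function.Injective ι ∧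
    ∀ U : Submodule R J, U ⊓ LinearMap.range ι = ⊥ → U = ⊥

/-- `D(A_A) = Hom_R(A, J)`. -/
def DReg (R A J : Type u) [CommRing R] [Ring A] [Algebra R A] [AddCommGroup J] [Module R J] :
    Type u := A →ₗ[R] J

instance (R A J : Type u) [CommRing R] [Ring A] [Algebra R A] [AddCommGroup J] [Module R J] :
    AddCommGroup (DReg R A J) := inferInstanceAs (AddCommGroup (A →ₗ[R] J))

/-- The left `A`-action on `D(A_A)` induced by the right action on `A`: `(a • f) x = f (x * a)`. -/
instance (R A J : Type u) [CommRing R] [Ring A] [Algebra R A] [AddCommGroup J] [Module R J] :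
    Module A (DReg R A J) where
  smul a f := LinearMap.comp (show A →ₗ[R] J from f) (LinearMap.mulRight R a)
  one_smul f := LinearMap.ext fun x => congrArg (show A →ₗ[R] J from f) (mul_one x)
  mul_smul a b f := LinearMap.ext fun x =>
    congrArg (show A →ₗ[R] J from f) (mul_assoc x a b).symm
  smul_zero _ := LinearMap.ext fun _ => rfl
  smul_add _ _ _ := LinearMap.ext fun _ => rfl
  add_smul a b f := LinearMap.ext fun x =>
    (congrArg (show A →ₗ[R] J from f) (mul_add x a b)).trans
      (map_add (show A →ₗ[R] J from f) _ _)
  zero_smul f := LinearMap.ext fun x =>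
    (congrArg (show A →ₗ[R] J from f) (mul_zero x)).trans (map_zero (show A →ₗ[R] J from f))

/-! ### Idempotents, projective, injective and simple modules -/

/-- `e` is a primitive idempotent: a nonzero idempotent that is not the sum of two nonzero
orthogonal idempotents. -/
def IsPrimitiveIdem {A : Type u} [Ring A] (e : A) : Prop :=
  IsIdempotentElem e ∧ e ≠ 0 ∧
    ∀ f g : A, IsIdempotentElem f → IsIdempotentElem g → f * g = 0 → g * f = 0 → e = f + g →
      f = 0 ∨ g = 0

section Modules

variable {A : Type u} [Ring A] {n : ℕ} (e : Fin n → A)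

/-- `P(i) = A e_i`. -/
abbrev P (i : Fin n) : Submodule A A := Submodule.span A {e i}

/-- `e_1, …, e_n` is a complete set of primitive orthogonal idempotents of the basic ring `A`
(basic: the modules `A e_i` are pairwise non-isomorphic). -/
structure IsBasicIdempotents : Prop where
  complete : CompleteOrthogonalIdempotents e
  primitive : ∀ i, IsPrimitiveIdem (e i)
  basic : ∀ i j, Nonempty (P e i ≃ₗ[A] P e j) → i = j

/-- `E(i)`, the top of `P(i)`. -/
abbrev E (i : Fin n) : Type u := P e i ⧸ Module.jacobson A (P e i)

/-- The kernel of `P(i) → Δ(i)`: the smallest submodule of `P(i)` whose factor module has no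
composition factor `E(j)` with `j > i`. -/
def stdKer (i : Fin n) : Submodule A (P e i) :=
  sInf {U | ∀ j, i < j → MultEq A (P e i ⧸ U) (E e j) 0}

/-- The standard module `Δ(i)`. -/
abbrev Std (i : Fin n) : ModuleCat.{u} A := ModuleCat.of A (P e i ⧸ stdKer e i)

/-- The kernel of `Δ(i) → Δ̄(i)`: the smallest submodule of `Δ(i)` in whose factor module `E(i)`
has multiplicity one. -/
def pstdKer (i : Fin n) : Submodule A (Std e i) :=
  sInf {U | MultEq A (Std e i ⧸ U) (E e i) 1}

/-- The proper standard module `Δ̄(i)`. -/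
abbrev PStd (i : Fin n) : ModuleCat.{u} A := ModuleCat.of A (Std e i ⧸ pstdKer e i)

variable (R J : Type u) [CommRing R] [Algebra R A] [AddCommGroup J] [Module R J]

/-- `I(i) = D(e_i A)`, the injective envelope of `E(i)`, as the submodule of `D(A_A)` of all `f`
that factor through the projection `A → e_i A`, `x ↦ e_i x`. -/
def I (i : Fin n) : Submodule A (DReg R A J) where
  carrier := {f | ∀ x : A, (show A →ₗ[R] J from f) (e i * x) = (show A →ₗ[R] J from f) x}
  zero_mem' _ := rfl
  add_mem' hf hg x := congrArg₂ (· + ·) (hf x) (hg x)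
  smul_mem' a f hf x :=
    (congrArg (show A →ₗ[R] J from f) (mul_assoc (e i) x a)).trans (hf (x * a))

/-- The costandard module `∇(i)`, the largest submodule of `I(i)` that has no composition factor
`E(j)` with `j > i`. -/
def costdSub (i : Fin n) : Submodule A (I e R J i) :=
  sSup {U | ∀ j, i < j → MultEq A U (E e j) 0}

/-- The costandard module `∇(i)`. -/
abbrev Costd (i : Fin n) : ModuleCat.{u} A := ModuleCat.of A (costdSub e R J i)

/-- The largest submodule of `∇(i)` in which `E(i)` has multiplicity one. -/
def pcostdSub (i : Fin n) : Submodule A (Costd e R J i) :=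
  sSup {U | MultEq A U (E e i) 1}

/-- The proper costandard module `∇̄(i)`. -/
abbrev PCostd (i : Fin n) : ModuleCat.{u} A := ModuleCat.of A (pcostdSub e R J i)

/-- `(A, ≤)` is properly stratified: `_A A` lies in `F(Δ)` and in `F(Δ̄)`. -/
def IsProperlyStratified : Prop :=
  Filt (Std e) (ModuleCat.of A A) ∧ Filt (PStd e) (ModuleCat.of A A)

/-- `∇̄-gfd(X)` for a module `X`. -/
def nablaGfd (X : ModuleCat.{u} A) : ℕ∞ := coresDim (Filt (PCostd e R J)) X

/-- `∇̄-gfd(A)` for the algebra: the supremum over all finitely generated modules. -/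
def nablaGfdAlg : ℕ∞ := ⨆ (X : ModuleCat.{u} A) (_ : Module.Finite A X), nablaGfd e R J X

/-- `Δ̄-gfd(X)` for a module `X`. -/
def deltaGfd (X : ModuleCat.{u} A) : ℕ∞ := resDim (Filt (PStd e)) X

/-- `Δ̄-gfd(A)` for the algebra: the supremum over all finitely generated modules. -/
def deltaGfdAlg : ℕ∞ := ⨆ (X : ModuleCat.{u} A) (_ : Module.Finite A X), deltaGfd e X

end Modules

end

end GoodFilt

/-! Both chains of equalities come from one argument about a pair of families `(Θ, Θ')`: `(Δ, ∇̄)`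
on the tilting side and `(Δ̄, ∇)` on the cotilting side. `OrthPair` collects what the two pairs
share, and each pair needs only its own half of the stratification, `A ∈ F(Θ)`.

Orthogonality. Comparing indices gives `Ext¹(Θ i, Θ' j) = 0`. Because `A ∈ F(Θ)`, the kernel of a
surjection `A → Θ i` is again `Ext¹`-orthogonal to `Θ'` (`OrthPair.ext_one_ker`), so `Ext²(Θ i, Θ'
j) = 0`. With `Ext²` gone, a finitely generated module that is `Ext¹`-orthogonal to one family is
filtered by the other (`OrthPair.filtM_right`, `OrthPair.filtM_left`). In particular the first
syzygies of the `Θ i` lie in `F(Θ)`, and all positive Ext groups from `Θ` to `Θ'` vanish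
(`OrthPair.ext_all`).

Approximation. Universal extensions by the `Δ(i)`, taken from the largest index downwards, embed
every finitely generated `X` into some `Y ∈ F(∇̄)` with `Y/X ∈ F(Δ)` (`exists_embedding`). Dually,
`X` is covered by a module of `F(Δ̄)` with kernel in `F(∇)` (`exists_covering`).

Dimensions. Let `d` be the largest projective dimension of a `Δ(i)`; it is finite since the kernel
of `P(i) → Δ(i)` is filtered by `Δ(j)` with `j > i`. Dimension shifting along approximations gives a
coresolution of length `d` of any `X` by `F(∇̄)`. None shorter exists for `X = A`: in the top degree
`Ext^d(Δ(i), -)` is right exact, so it cannot vanish on `A` for all `i`. Starting from `A ∈ F(Δ)`,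
the approximations remain in `F(Δ) ∩ F(∇̄) = add T`, so the same `d` is the `T`-codimension. Finally
`T ∈ F(Δ)` bounds its projective dimension by `d`, and each `Δ(i)` embeds into a module of `add T`
with cokernel in `F(Δ)`, which gives the reverse bound.

The cotilting side is the same argument with arrows reversed, carried out inside left modules:
`D(A)` replaces `A`, as an injective cogenerator lying in `F(∇)`. About duality only length
inequalities are needed; they already show that `D(A)` is finitely generated and that `I(i)` has
`E(i)` as essential socle. -/

namespace GoodFilt
open CategoryTheory Abelian

/-! ### Vanishing of `Ext` groups for unbundled modules -/

/-- The group `Ext^k(X, Y)` vanishes. -/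
def ExtVanish (A : Type u) [Ring A] (k : ℕ) (X Y : Type u) [AddCommGroup X] [Module A X]
    [AddCommGroup Y] [Module A Y] : Prop :=
  Subsingleton (Ext (ModuleCat.of A X) (ModuleCat.of A Y) k)

/-- `0 → X → Y → Z → 0` is exact. -/
structure Ses {A : Type u} [Ring A] {X Y Z : Type u} [AddCommGroup X] [Module A X]
    [AddCommGroup Y] [Module A Y] [AddCommGroup Z] [Module A Z]
    (f : X →ₗ[A] Y) (g : Y →ₗ[A] Z) : Prop where
  inj : Function.Injective f
  exact : Function.Exact f g
  surj : Function.Surjective g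

section

variable {A : Type u} [Ring A]
variable {X Y Z W : Type u} [AddCommGroup X] [Module A X] [AddCommGroup Y] [Module A Y]
  [AddCommGroup Z] [Module A Z] [AddCommGroup W] [Module A W]
variable {f : X →ₗ[A] Y} {g : Y →ₗ[A] Z} {k : ℕ}

theorem Ses.of_submodule (N : Submodule A Y) : Ses N.subtype N.mkQ :=
  ⟨N.injective_subtype, by
    rw [LinearMap.exact_iff, Submodule.ker_mkQ, Submodule.range_subtype], N.mkQ_surjective⟩

theorem Ses.of_ker (g : Y →ₗ[A] Z) (hg : Function.Surjective g) : Ses (LinearMap.ker g).subtype g :=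
  ⟨Submodule.injective_subtype _, by rw [LinearMap.exact_iff, Submodule.range_subtype], hg⟩

theorem Ses.of_range (f : X →ₗ[A] Y) (hf : Function.Injective f) :
    Ses f (LinearMap.range f).mkQ :=
  ⟨hf, by rw [LinearMap.exact_iff, Submodule.ker_mkQ], Submodule.mkQ_surjective _⟩

theorem Ses.zero (h : Ses f g) (x : X) : g (f x) = 0 := h.exact.apply_apply_eq_zero x

/-- The short complex of modules given by a short exact sequence. -/
noncomputable abbrev Ses.complex (h : Ses f g) : ShortComplex (ModuleCat.{u} A) :=
  ShortComplex.mk (ModuleCat.ofHom f) (ModuleCat.ofHom g) (by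
    ext x
    exact h.zero x)

theorem Ses.shortExact (h : Ses f g) : h.complex.ShortExact where
  exact := by
    rw [ShortComplex.ShortExact.moduleCat_exact_iff_function_exact]
    exact h.exact
  mono_f := (ModuleCat.mono_iff_injective _).2 h.inj
  epi_g := (ModuleCat.epi_iff_surjective _).2 h.surj

theorem ExtVanish.iff_forall : ExtVanish A k X Y ↔
    ∀ x : Ext (ModuleCat.of A X) (ModuleCat.of A Y) k, x = 0 :=
  ⟨fun h _ => @Subsingleton.elim _ h _ _, fun h => ⟨fun a b => (h a).trans (h b).symm⟩⟩

/-- This and the next five lemmas are pieces of the two long exact Ext sequences. `sub`, `mid`,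
`quot` name the term of the short exact sequence whose Ext group is shown to vanish, and `left`,
`right` the argument in which the sequence stands. -/
theorem ExtVanish.mid_left (h : Ses f g) (h1 : ExtVanish A k X W) (h3 : ExtVanish A k Z W) :
    ExtVanish A k Y W := by
  rw [ExtVanish.iff_forall] at *
  intro x
  obtain ⟨y, rfl⟩ := Ext.contravariant_sequence_exact₂ h.shortExact _ x (h1 _)
  have := h3 y
  subst this
  exact Ext.comp_zero ..

theorem ExtVanish.sub_left (h : Ses f g) (h2 : ExtVanish A k Y W) (h3 : ExtVanish A (k + 1) Z W) :
    ExtVanish A k X W := by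
  rw [ExtVanish.iff_forall] at *
  intro x
  obtain ⟨y, rfl⟩ := Ext.contravariant_sequence_exact₁ h.shortExact _ x (add_comm 1 k) (h3 _)
  have := h2 y
  subst this
  exact Ext.comp_zero ..

theorem ExtVanish.quot_left (h : Ses f g) (h1 : ExtVanish A k X W)
    (h2 : ExtVanish A (k + 1) Y W) : ExtVanish A (k + 1) Z W := by
  rw [ExtVanish.iff_forall] at *
  intro x
  obtain ⟨y, rfl⟩ := Ext.contravariant_sequence_exact₃ h.shortExact _ x (h2 _) (add_comm 1 k)
  have := h1 y
  subst this
  exact Ext.comp_zero ..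

theorem ExtVanish.mid_right (h : Ses f g) (h1 : ExtVanish A k W X) (h3 : ExtVanish A k W Z) :
    ExtVanish A k W Y := by
  rw [ExtVanish.iff_forall] at *
  intro x
  obtain ⟨y, rfl⟩ := Ext.covariant_sequence_exact₂ _ h.shortExact x (h3 _)
  have := h1 y
  subst this
  exact Ext.zero_comp ..

theorem ExtVanish.quot_right (h : Ses f g) (h2 : ExtVanish A k W Y)
    (h1 : ExtVanish A (k + 1) W X) : ExtVanish A k W Z := by
  rw [ExtVanish.iff_forall] at *
  intro x
  obtain ⟨y, rfl⟩ := Ext.covariant_sequence_exact₃ _ h.shortExact x rfl (h1 _)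
  have := h2 y
  subst this
  exact Ext.zero_comp ..

theorem ExtVanish.sub_right (h : Ses f g) (h3 : ExtVanish A k W Z)
    (h2 : ExtVanish A (k + 1) W Y) : ExtVanish A (k + 1) W X := by
  rw [ExtVanish.iff_forall] at *
  intro x
  obtain ⟨y, rfl⟩ := Ext.covariant_sequence_exact₁ _ h.shortExact x (h2 _) rfl
  have := h3 y
  subst this
  exact Ext.zero_comp ..

theorem ExtVanish.zero_iff : ExtVanish A 0 X Y ↔ ∀ φ : X →ₗ[A] Y, φ = 0 := by
  rw [ExtVanish.iff_forall]
  constructor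
  · intro h φ
    have := h (Ext.mk₀ (ModuleCat.ofHom φ))
    have h2 := (Ext.mk₀_eq_zero_iff _).1 this
    ext x
    exact congrArg (fun t => t.hom x) h2
  · intro h x
    obtain ⟨φ, rfl⟩ := Ext.homEquiv₀.symm.surjective x
    have : φ = 0 := by
      ext x
      exact LinearMap.congr_fun (h φ.hom) x
    subst this
    exact Ext.mk₀_zero _ _

/-- The obstruction to extending `φ` is its image under the connecting map, which lies in `Ext¹(Z,
W)`. -/
theorem ExtVanish.exists_extend (h : Ses f g) (h1 : ExtVanish A 1 Z W) (φ : X →ₗ[A] W) :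
    ∃ ψ : Y →ₗ[A] W, ψ ∘ₗ f = φ := by
  rw [ExtVanish.iff_forall] at h1
  obtain ⟨y, hy⟩ := Ext.contravariant_sequence_exact₁ h.shortExact _
    (Ext.mk₀ (ModuleCat.ofHom φ)) (add_comm 1 0) (h1 _)
  obtain ⟨ψ, rfl⟩ := Ext.homEquiv₀.symm.surjective y
  refine ⟨ψ.hom, ?_⟩
  have h2 : Ext.mk₀ (h.complex.f ≫ ψ) = Ext.mk₀ (ModuleCat.ofHom φ) := by
    rw [← Ext.mk₀_comp_mk₀]; exact hy
  have h3 := Ext.homEquiv₀.symm.injective h2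
  ext x
  exact congrArg (fun t => t.hom x) h3

theorem ExtVanish.exists_lift (h : Ses f g) (h1 : ExtVanish A 1 W X) (φ : W →ₗ[A] Z) :
    ∃ ψ : W →ₗ[A] Y, g ∘ₗ ψ = φ := by
  rw [ExtVanish.iff_forall] at h1
  obtain ⟨y, hy⟩ := Ext.covariant_sequence_exact₃ _ h.shortExact
    (Ext.mk₀ (ModuleCat.ofHom φ)) rfl (h1 _)
  obtain ⟨ψ, rfl⟩ := Ext.homEquiv₀.symm.surjective y
  refine ⟨ψ.hom, ?_⟩
  have h2 : Ext.mk₀ (ψ ≫ h.complex.g) = Ext.mk₀ (ModuleCat.ofHom φ) := by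
    rw [← Ext.mk₀_comp_mk₀]; exact hy
  have h3 := Ext.homEquiv₀.symm.injective h2
  ext x
  exact congrArg (fun t => t.hom x) h3

/-- As `p ∘ i` is the identity, every class on `X` is the pullback along `i` of its pullback along
`p`, and the latter lives in a zero group. -/
theorem ExtVanish.retract_left (i : X →ₗ[A] Y) (p : Y →ₗ[A] X) (hip : p ∘ₗ i = LinearMap.id)
    (h : ExtVanish A k Y W) : ExtVanish A k X W := by
  rw [ExtVanish.iff_forall] at *
  intro x
  have h2 : Ext.mk₀ (ModuleCat.ofHom i ≫ ModuleCat.ofHom p) = Ext.mk₀ (𝟙 (ModuleCat.of A X)) := by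
    congr 1
    ext x
    exact LinearMap.congr_fun hip x
  have h3 := h ((Ext.mk₀ (ModuleCat.ofHom p)).comp x (zero_add k))
  rw [← Ext.mk₀_id_comp x, ← h2, ← Ext.mk₀_comp_mk₀_assoc, h3, Ext.comp_zero]

theorem ExtVanish.retract_right (i : X →ₗ[A] Y) (p : Y →ₗ[A] X) (hip : p ∘ₗ i = LinearMap.id)
    (h : ExtVanish A k W Y) : ExtVanish A k W X := by
  rw [ExtVanish.iff_forall] at *
  intro x
  have h2 : Ext.mk₀ (ModuleCat.ofHom i ≫ ModuleCat.ofHom p) = Ext.mk₀ (𝟙 (ModuleCat.of A X)) := by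
    congr 1
    ext x
    exact LinearMap.congr_fun hip x
  have h3 := h (x.comp (Ext.mk₀ (ModuleCat.ofHom i)) (add_zero k))
  rw [← Ext.comp_mk₀_id x, ← h2, ← Ext.mk₀_comp_mk₀, ← Ext.comp_assoc_of_third_deg_zero, h3,
    Ext.zero_comp]

theorem ExtVanish.congr_left (e : X ≃ₗ[A] Y) (h : ExtVanish A k Y W) : ExtVanish A k X W :=
  h.retract_left e.toLinearMap e.symm.toLinearMap (by ext; simp)

theorem ExtVanish.congr_right (e : X ≃ₗ[A] Y) (h : ExtVanish A k W Y) : ExtVanish A k W X :=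
  h.retract_right e.toLinearMap e.symm.toLinearMap (by ext; simp)

theorem ExtVanish.of_projective [Module.Projective A X] : ExtVanish A (k + 1) X Y := by
  rw [ExtVanish.iff_forall]
  intro x
  have : Projective (ModuleCat.of A X) := (IsProjective.iff_projective X).1 inferInstance
  exact Ext.eq_zero_of_projective x

theorem ExtVanish.of_injective [Module.Injective A Y] : ExtVanish A (k + 1) X Y := by
  rw [ExtVanish.iff_forall]
  intro x
  have : Injective (ModuleCat.of A Y) :=
    (Module.injective_iff_injective_object A Y).1 inferInstance
  exact Ext.eq_zero_of_injective x

theorem ExtVanish.of_subsingleton_left [Subsingleton X] : ExtVanish A k X Y := by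
  rw [ExtVanish.iff_forall]
  intro x
  have h2 : Ext.mk₀ (𝟙 (ModuleCat.of A X)) = 0 := by
    rw [Ext.mk₀_eq_zero_iff]
    ext x
    exact Subsingleton.elim (α := X) _ _
  rw [← Ext.mk₀_id_comp x, h2, Ext.zero_comp]

theorem ExtVanish.of_subsingleton_right [Subsingleton Y] : ExtVanish A k X Y := by
  rw [ExtVanish.iff_forall]
  intro x
  have h2 : Ext.mk₀ (𝟙 (ModuleCat.of A Y)) = 0 := by
    rw [Ext.mk₀_eq_zero_iff]
    ext x
    exact Subsingleton.elim (α := Y) _ _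
  rw [← Ext.comp_mk₀_id x, h2, Ext.comp_zero]

theorem ExtVanish.zero_of_surjective (h : ExtVanish A 0 Y W) (hg : Function.Surjective g) :
    ExtVanish A 0 Z W := by
  rw [ExtVanish.zero_iff] at *
  intro φ
  have := h (φ ∘ₗ g)
  ext z
  obtain ⟨y, rfl⟩ := hg z
  exact LinearMap.congr_fun this y

theorem ExtVanish.subsingleton_of_zero (h : ExtVanish A 0 X X) : Subsingleton X := by
  rw [ExtVanish.zero_iff] at h
  exact subsingleton_of_forall_eq 0 fun x => LinearMap.congr_fun (h LinearMap.id) x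

/-- A finite power of a module is obtained from the module by iterated extensions. -/
theorem Ses.fin_succ (m : ℕ) :
    Ses (LinearMap.single A (fun _ : Fin (m + 1) => X) 0) (LinearMap.funLeft A X Fin.succ) :=
  ⟨Pi.single_injective (M := fun _ : Fin (m + 1) => X) 0, by
    intro v
    constructor
    · intro hv
      refine ⟨v 0, funext fun j => ?_⟩
      refine Fin.cases ?_ (fun j => ?_) j
      · simp
      · simpa using (congrFun hv j).symm
    · rintro ⟨x, rfl⟩
      ext j
      simp [LinearMap.funLeft_apply], fun v => ⟨Fin.cons 0 v, by ext; simp [LinearMap.funLeft_apply]⟩⟩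

theorem ExtVanish.pi_left (h : ExtVanish A k X W) (m : ℕ) : ExtVanish A k (Fin m → X) W := by
  induction m with
  | zero => exact .of_subsingleton_left
  | succ m ih => exact .mid_left (Ses.fin_succ m) h ih

theorem ExtVanish.pi_right (h : ExtVanish A k W X) (m : ℕ) : ExtVanish A k W (Fin m → X) := by
  induction m with
  | zero => exact .of_subsingleton_right
  | succ m ih => exact .mid_right (Ses.fin_succ m) h ih

end

end GoodFilt

namespace GoodFilt
open CategoryTheory Abelian

/-! ### Filtered modules -/

section

variable {A : Type u} [Ring A] {ι ι' : Type} {Θ : ι → ModuleCat.{u} A}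
variable {X Y Z W : Type u} [AddCommGroup X] [Module A X] [AddCommGroup Y] [Module A Y]
  [AddCommGroup Z] [Module A Z] [AddCommGroup W] [Module A W]
variable {f : X →ₗ[A] Y} {g : Y →ₗ[A] Z}

/-- `M` lies in `F(Θ)`, for an unbundled module `M`. -/
abbrev FiltM (Θ : ι → ModuleCat.{u} A) (M : Type u) [AddCommGroup M] [Module A M] : Prop :=
  Filt Θ (ModuleCat.of A M)

theorem FiltM.zero (M : Type u) [AddCommGroup M] [Module A M] [Subsingleton M] : FiltM Θ M :=
  ⟨0, fun _ => ⊤, rfl, Subsingleton.elim (α := Submodule A M) _ _, fun l => l.elim0⟩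

/-- The subquotient of a preimage under an injective map. -/
theorem nonempty_subquotient_map_equiv (f : X →ₗ[A] Y) (hf : Function.Injective f)
    (N N' : Submodule A X) :
    Nonempty ((↥(N.map f) ⧸ (N'.map f).submoduleOf (N.map f)) ≃ₗ[A]
      (↥N ⧸ N'.submoduleOf N)) := by
  refine ⟨(Submodule.Quotient.equiv _ _ (Submodule.equivMapOfInjective f hf N) ?_).symm⟩
  ext x
  obtain ⟨y, rfl⟩ := (Submodule.equivMapOfInjective f hf N).surjective x
  simp only [Submodule.mem_map, Submodule.submoduleOf, Submodule.mem_comap, Submodule.subtype_apply]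
  constructor
  · rintro ⟨z, hz, hzy⟩
    exact ⟨z, hz, by
      have := congrArg Subtype.val hzy
      simpa using this⟩
  · rintro ⟨z, hz, hzy⟩
    refine ⟨y, ?_, rfl⟩
    have : z = y := hf (by simpa using hzy)
    exact this ▸ hz

/-- Filtrations descend from `⊤`, so the new factor comes first: put `⊤` in front of the image of
the filtration of `X`. -/
theorem FiltM.cons (h : Ses f g) {i : ι} (e : Z ≃ₗ[A] Θ i) (hX : FiltM Θ X) : FiltM Θ Y := by
  obtain ⟨t, N, h0, hlast, hN⟩ := hX
  refine ⟨t + 1, Fin.cons ⊤ fun l => (N l).map f, rfl, ?_, fun l => ?_⟩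
  · rw [← Fin.succ_last, Fin.cons_succ, hlast]
    exact Submodule.map_bot f
  · refine Fin.cases ?_ (fun l => ?_) l
    · refine ⟨le_top, i, ?_⟩
      have h1 : (Fin.cons ⊤ (fun l => (N l).map f) : Fin (t + 2) → Submodule A Y)
          (Fin.succ 0) = LinearMap.ker g := by
        rw [Fin.cons_succ, h0, LinearMap.exact_iff.1 h.exact]
        exact Submodule.map_top f
      have h2 : (Fin.cons ⊤ (fun l => (N l).map f) : Fin (t + 2) → Submodule A Y)
          (Fin.castSucc 0) = ⊤ := rfl
      have h3 : Nonempty ((↥(⊤ : Submodule A Y) ⧸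
          (LinearMap.ker g).submoduleOf ⊤) ≃ₗ[A] Θ i) := by
        refine ⟨(Submodule.Quotient.equiv _ (LinearMap.ker g) Submodule.topEquiv ?_).trans
          ((g.quotKerEquivOfSurjective h.surj).trans e)⟩
        ext x
        simp [Submodule.submoduleOf]
      rw [← h1, ← h2] at h3
      exact h3
    · obtain ⟨h1, j, ⟨e'⟩⟩ := hN l
      refine ⟨?_, j, ?_⟩
      · rw [Fin.cons_succ, ← Fin.succ_castSucc, Fin.cons_succ]
        exact Submodule.map_mono h1
      · obtain ⟨e''⟩ := nonempty_subquotient_map_equiv f h.inj (N l.castSucc) (N l.succ)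
        exact ⟨e''.trans e'⟩

/-- Peeling off the top factor of a filtration turns membership in `F(Θ)` into a structural
induction; later arguments on filtered modules use this instead of chains indexed by `Fin`. -/
theorem FiltM.induction
    {motive : ∀ (M : Type u) [AddCommGroup M] [Module A M], Prop}
    (zero : ∀ (M : Type u) [AddCommGroup M] [Module A M] [Subsingleton M], motive M)
    (step : ∀ (X Y : Type u) [AddCommGroup X] [Module A X] [AddCommGroup Y] [Module A Y] (i : ι)
      (f : X →ₗ[A] Y) (g : Y →ₗ[A] Θ i), Ses f g → FiltM Θ X → motive X → motive Y)
    (M : Type u) [AddCommGroup M] [Module A M] (h : FiltM Θ M) : motive M := by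
  obtain ⟨t, N, h0, hlast, hN⟩ := h
  induction t generalizing M with
  | zero =>
    have : Subsingleton M := by
      have h1 : (⊤ : Submodule A M) = ⊥ := h0.symm.trans hlast
      exact (Submodule.subsingleton_iff A).1 (subsingleton_of_bot_eq_top h1.symm)
    exact zero M
  | succ t ih =>
    obtain ⟨h1, i, ⟨e⟩⟩ := hN 0
    have hle : ∀ l : Fin (t + 1), N l.succ ≤ N (Fin.succ 0) := by
      intro l
      induction l using Fin.induction with
      | zero => exact le_rfl
      | succ l ih => exact ((hN l.succ).1).trans (by rw [← Fin.succ_castSucc]; exact ih)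
    -- The remaining terms all lie inside the first proper one, so restricting them to it loses
    -- nothing and subquotients can be compared in either module.
    have h2 : ∀ l : Fin (t + 1),
        ((N l.succ).comap (N (Fin.succ 0)).subtype).map (N (Fin.succ 0)).subtype = N l.succ := by
      intro l
      rw [Submodule.map_comap_subtype]
      exact inf_eq_right.2 (hle l)
    have key : ∀ l : Fin t, (N l.succ.succ).comap (N (Fin.succ 0)).subtype ≤
        (N l.castSucc.succ).comap (N (Fin.succ 0)).subtype ∧
        ∃ i : ι, Nonempty ((↥((N l.castSucc.succ).comap (N (Fin.succ 0)).subtype) ⧸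
        ((N l.succ.succ).comap (N (Fin.succ 0)).subtype).submoduleOf
        ((N l.castSucc.succ).comap (N (Fin.succ 0)).subtype)) ≃ₗ[A] Θ i) := by
      intro l
      obtain ⟨h3, j, e'⟩ := hN l.succ
      rw [← Fin.succ_castSucc] at h3 e'
      refine ⟨Submodule.comap_mono h3, j, ?_⟩
      obtain ⟨e''⟩ := nonempty_subquotient_map_equiv (N (Fin.succ 0)).subtype
        (Submodule.injective_subtype _) ((N l.castSucc.succ).comap (N (Fin.succ 0)).subtype)
        ((N l.succ.succ).comap (N (Fin.succ 0)).subtype)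
      rw [h2, h2] at e''
      exact ⟨e''.symm.trans e'.some⟩
    have hF0 : (fun l : Fin (t + 1) => (N l.succ).comap (N (Fin.succ 0)).subtype) 0 = ⊤ :=
      Submodule.comap_subtype_self _
    have hFl : (fun l : Fin (t + 1) => (N l.succ).comap (N (Fin.succ 0)).subtype)
        (Fin.last t) = ⊥ := by
      change Submodule.comap _ (N (Fin.last t).succ) = ⊥
      rw [Fin.succ_last, hlast]
      exact Submodule.ker_subtype _
    have e0 : Nonempty ((M ⧸ N (Fin.succ 0)) ≃ₗ[A] Θ i) := by
      rw [show N (Fin.castSucc 0) = ⊤ from h0] at e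
      refine ⟨(Submodule.Quotient.equiv _ _ Submodule.topEquiv ?_).symm.trans e⟩
      ext x
      simp [Submodule.submoduleOf]
    obtain ⟨e0⟩ := e0
    refine step (↥(N (Fin.succ 0))) M i (N (Fin.succ 0)).subtype
      (e0.toLinearMap ∘ₗ (N (Fin.succ 0)).mkQ) ?_ ⟨t,
      (fun l : Fin (t + 1) => (N l.succ).comap (N (Fin.succ 0)).subtype), hF0, hFl, key⟩ (ih _
      (fun l : Fin (t + 1) => (N l.succ).comap (N (Fin.succ 0)).subtype) hF0 hFl key)
    refine ⟨Submodule.injective_subtype _, ?_, e0.surjective.comp (Submodule.mkQ_surjective _)⟩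
    rw [LinearMap.exact_iff, LinearEquiv.ker_comp, Submodule.ker_mkQ, Submodule.range_subtype]

theorem FiltM.congr (e : X ≃ₗ[A] Y) (h : FiltM Θ X) : FiltM Θ Y := by
  obtain ⟨t, N, h0, hlast, hN⟩ := h
  refine ⟨t, fun l => (N l).map e.toLinearMap, ?_, ?_, fun l => ?_⟩
  · exact (congrArg _ h0).trans ((Submodule.map_top _).trans e.range)
  · exact (congrArg _ hlast).trans (Submodule.map_bot _)
  · obtain ⟨h1, j, ⟨e'⟩⟩ := hN l
    obtain ⟨e''⟩ := nonempty_subquotient_map_equiv e.toLinearMap e.injective (N l.castSucc)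
      (N l.succ)
    exact ⟨Submodule.map_mono h1, j, ⟨e''.trans e'⟩⟩

/-- Pullback of a short exact sequence along a monomorphism, with the middle term realised as a
submodule of `Y`. -/
theorem Ses.comap_range (h : Ses f g) (p : W →ₗ[A] Z) (hp : Function.Injective p) :
    ∃ (f' : X →ₗ[A] ↥((LinearMap.range p).comap g)) (g' : ↥((LinearMap.range p).comap g) →ₗ[A] W),
      Ses f' g' ∧ (∀ x, (f' x : Y) = f x) ∧ ∀ y, p (g' y) = g y := by
  let e := LinearEquiv.ofInjective p hp
  let f' : X →ₗ[A] ↥((LinearMap.range p).comap g) :=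
    f.codRestrict _ fun x => by
      rw [Submodule.mem_comap, h.zero]
      exact zero_mem _
  let g₀ : ↥((LinearMap.range p).comap g) →ₗ[A] ↥(LinearMap.range p) :=
    g.restrict fun y hy => hy
  have hg' : ∀ y, p ((e.symm.toLinearMap ∘ₗ g₀) y) = g y := by
    intro y
    have : (e ((e.symm.toLinearMap ∘ₗ g₀) y) : Z) = g y := by
      simp [g₀]
    exact this
  refine ⟨f', e.symm.toLinearMap ∘ₗ g₀, ⟨?_, ?_, ?_⟩, fun x => rfl, hg'⟩
  · intro x y hxy
    exact h.inj (congrArg Subtype.val hxy)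
  · intro y
    constructor
    · intro hy
      have : g y = 0 := by rw [← hg', hy, map_zero]
      obtain ⟨x, hx⟩ := (h.exact _).1 this
      exact ⟨x, Subtype.ext hx⟩
    · rintro ⟨x, rfl⟩
      apply hp
      rw [hg', map_zero]
      exact h.zero x
  · intro w
    obtain ⟨y, hy⟩ := h.surj (p w)
    refine ⟨⟨y, w, hy.symm⟩, hp ?_⟩
    rw [hg']
    exact hy

/-- Induction on the filtration of `Z`: the preimage in `Y` of a submodule `Z'` is an extension of
`Z'` by `X`, and the top factor of `Z` becomes the top factor of `Y`. -/
theorem FiltM.ext (h : Ses f g) (hX : FiltM Θ X) (hZ : FiltM Θ Z) : FiltM Θ Y := by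
  revert X Y
  refine FiltM.induction (motive := fun Z _ _ => ∀ {X Y : Type u} [AddCommGroup X] [Module A X]
    [AddCommGroup Y] [Module A Y] {f : X →ₗ[A] Y} {g : Y →ₗ[A] Z}, Ses f g → FiltM Θ X → FiltM Θ Y)
    ?_ ?_ Z hZ
  · intro Z _ _ _ X Y _ _ _ _ f g h hX
    have : Function.Surjective f := fun y => (h.exact y).1 (Subsingleton.elim _ _)
    exact hX.congr (LinearEquiv.ofBijective f ⟨h.inj, this⟩)
  · intro Z' Z _ _ _ _ i p q hpq _ ih X Y _ _ _ _ f g h hX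
    obtain ⟨f', g', h', -, -⟩ := h.comap_range p hpq.inj
    have hY' := ih h' hX
    refine FiltM.cons (f := ((LinearMap.range p).comap g).subtype) (g := q ∘ₗ g) (i := i)
      ⟨Submodule.injective_subtype _, ?_, hpq.surj.comp h.surj⟩ (LinearEquiv.refl _ _) hY'
    rw [LinearMap.exact_iff, Submodule.range_subtype, LinearMap.ker_comp,
      LinearMap.exact_iff.1 hpq.exact]

theorem FiltM.single (i : ι) : FiltM Θ (Θ i) :=
  FiltM.cons (X := PUnit) (f := 0) (g := LinearMap.id)
    ⟨Function.injective_of_subsingleton _, by rw [LinearMap.exact_iff]; simp,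
      Function.surjective_id⟩ (LinearEquiv.refl A _) (FiltM.zero _)

theorem FiltM.pi (hX : FiltM Θ X) (m : ℕ) : FiltM Θ (Fin m → X) := by
  induction m with
  | zero => exact .zero _
  | succ m ih => exact .ext (Ses.fin_succ m) hX ih

theorem FiltM.reindex {Θ' : ι' → ModuleCat.{u} A} (hΘ : ∀ i, ∃ j, Θ i = Θ' j) (h : FiltM Θ X) :
    FiltM Θ' X := by
  obtain ⟨t, N, h0, hlast, hN⟩ := h
  refine ⟨t, N, h0, hlast, fun l => ⟨(hN l).1, ?_⟩⟩
  obtain ⟨-, i, e⟩ := hN l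
  obtain ⟨j, hj⟩ := hΘ i
  exact ⟨j, hj ▸ e⟩

theorem Ses.finite (h : Ses f g) [Module.Finite A X] [Module.Finite A Z] : Module.Finite A Y := by
  refine ⟨Submodule.fg_of_fg_map_of_fg_inf_ker g ?_ ?_⟩
  · rw [Submodule.map_top, LinearMap.range_eq_top.2 h.surj]
    exact Module.Finite.fg_top
  · rw [top_inf_eq, LinearMap.exact_iff.1 h.exact, ← Submodule.map_top]
    exact Module.Finite.fg_top.map _

theorem FiltM.extVanish_left {k : ℕ} (hΘ : ∀ i, ExtVanish A k (Θ i) W) (hX : FiltM Θ X) :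
    ExtVanish A k X W :=
  FiltM.induction (motive := fun X _ _ => ExtVanish A k X W)
    (fun _ => .of_subsingleton_left)
    (fun _ _ _ _ _ _ i _ _ h _ ih => .mid_left h ih (hΘ i)) X hX

theorem FiltM.extVanish_right {k : ℕ} (hΘ : ∀ i, ExtVanish A k W (Θ i)) (hX : FiltM Θ X) :
    ExtVanish A k W X :=
  FiltM.induction (motive := fun X _ _ => ExtVanish A k W X)
    (fun _ => .of_subsingleton_right)
    (fun _ _ _ _ _ _ i _ _ h _ ih => .mid_right h ih (hΘ i)) X hX

end

end GoodFilt

namespace GoodFilt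
open CategoryTheory Abelian

/-! ### Primitive idempotents of an Artinian ring -/

section

variable {A : Type u} [Ring A] {n : ℕ} {e : Fin n → A}
variable {M : Type v} [AddCommGroup M] [Module A M]

/-- The generator `e_i` of `P(i)`. -/
def gen (e : Fin n → A) (i : Fin n) : P e i := ⟨e i, Submodule.mem_span_singleton_self _⟩

theorem IsBasicIdempotents.idem (he : IsBasicIdempotents e) (i : Fin n) : e i * e i = e i :=
  he.complete.idem i

theorem IsBasicIdempotents.smul_smul_self (he : IsBasicIdempotents e) (i : Fin n) (x : M) :
    e i • e i • x = e i • x := by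
  rw [smul_smul, he.idem]

theorem IsBasicIdempotents.mul_eq (he : IsBasicIdempotents e) {i : Fin n} (x : P e i) :
    (x : A) * e i = x := by
  obtain ⟨a, ha⟩ := Submodule.mem_span_singleton.1 x.2
  rw [← ha, smul_eq_mul, mul_assoc, he.idem]

theorem IsBasicIdempotents.smul_gen (he : IsBasicIdempotents e) {i : Fin n} (x : P e i) :
    (x : A) • gen e i = x :=
  Subtype.ext (he.mul_eq x)

theorem IsBasicIdempotents.idem_smul_gen (he : IsBasicIdempotents e) (i : Fin n) :
    e i • gen e i = gen e i :=
  he.smul_gen (gen e i)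

/-- The map `P(i) → M` sending `e_i` to `e_i x`. -/
def liftP (e : Fin n → A) (i : Fin n) (x : M) : P e i →ₗ[A] M :=
  LinearMap.toSpanSingleton A M x ∘ₗ (P e i).subtype

theorem IsBasicIdempotents.map_eq (he : IsBasicIdempotents e) {i : Fin n} (f : P e i →ₗ[A] M)
    (y : P e i) : f y = (y : A) • f (gen e i) := by
  rw [← map_smul, he.smul_gen]

theorem IsBasicIdempotents.projective (he : IsBasicIdempotents e) (i : Fin n) :
    Module.Projective A (P e i) :=
  Module.Projective.of_split (P e i).subtype (LinearMap.toSpanSingleton A _ (gen e i))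
    (LinearMap.ext fun x => he.smul_gen x)

theorem IsBasicIdempotents.finite (i : Fin n) : Module.Finite A (P e i) :=
  Module.Finite.span_singleton A (e i)

theorem IsBasicIdempotents.gen_ne_zero (he : IsBasicIdempotents e) (i : Fin n) : gen e i ≠ 0 :=
  fun h => (he.primitive i).2.1 (congrArg Subtype.val h)

theorem IsBasicIdempotents.eq_top_of_gen_mem (he : IsBasicIdempotents e) {i : Fin n}
    {N : Submodule A (P e i)} (h : gen e i ∈ N) : N = ⊤ := by
  rw [eq_top_iff]
  intro x _
  rw [← he.smul_gen x]
  exact N.smul_mem _ h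

/-- The two components of `e_i` in a decomposition of `A e_i` are orthogonal idempotents with sum
`e_i`, and primitivity kills one of them. -/
theorem IsBasicIdempotents.eq_bot_or_eq_bot (he : IsBasicIdempotents e) {i : Fin n}
    {N N' : Submodule A (P e i)} (h : IsCompl N N') : N = ⊥ ∨ N' = ⊥ := by
  obtain ⟨x, hx, y, hy, hxy⟩ := Submodule.mem_sup.1
    (show gen e i ∈ N ⊔ N' by rw [h.sup_eq_top]; trivial)
  have hz : ∀ z ∈ N, ∀ w ∈ N', z + w = 0 → z = 0 ∧ w = 0 := by
    intro z hz w hw hzw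
    have h1 : z ∈ N ⊓ N' := ⟨hz, by rw [eq_neg_of_add_eq_zero_left hzw]; exact N'.neg_mem hw⟩
    rw [h.inf_eq_bot] at h1
    have h2 : z = 0 := h1
    exact ⟨h2, by simpa [h2] using hzw⟩
  have hxy' : (x : A) + y = e i := congrArg Subtype.val hxy
  -- Taking `z = x` and `z = y` and comparing components yields the four relations `xx = x`, `xy =
  -- 0`, `yx = 0`, `yy = y`.
  have key : ∀ z : P e i, (z : A) • x + (z : A) • y = z := by
    intro z
    rw [← smul_add, hxy, he.smul_gen]
  have kx := hz ((x : A) • x - x) (N.sub_mem (N.smul_mem _ hx) hx) ((x : A) • y)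
    (N'.smul_mem _ hy) (by rw [sub_add_eq_add_sub, key, sub_self])
  have ky := hz ((y : A) • x) (N.smul_mem _ hx) ((y : A) • y - y)
    (N'.sub_mem (N'.smul_mem _ hy) hy) (by rw [← add_sub_assoc, key, sub_self])
  have h1 : (x : A) * x = x := congrArg Subtype.val (sub_eq_zero.1 kx.1)
  have h2 : (x : A) * y = 0 := congrArg Subtype.val kx.2
  have h3 : (y : A) * x = 0 := congrArg Subtype.val ky.1
  have h4 : (y : A) * y = y := congrArg Subtype.val (sub_eq_zero.1 ky.2)
  rcases (he.primitive i).2.2 x y h1 h4 h2 h3 hxy'.symm with h5 | h5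
  · left
    have : gen e i ∈ N' := by
      rw [← hxy, show x = 0 from Subtype.ext h5, zero_add]; exact hy
    have := he.eq_top_of_gen_mem this
    subst this
    simpa using h.inf_eq_bot
  · right
    have : gen e i ∈ N := by
      rw [← hxy, show y = 0 from Subtype.ext h5, add_zero]; exact hx
    have := he.eq_top_of_gen_mem this
    subst this
    simpa using h.inf_eq_bot

variable [IsArtinianRing A]

/-- Fitting's lemma: for large `m` the module is the direct sum of the kernel and the range of `φ ^
m`, so one of the two is zero. A zero kernel would make `φ` injective, hence surjective. -/
theorem IsBasicIdempotents.isNilpotent_of_range_ne_top (he : IsBasicIdempotents e) {i : Fin n}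
    (φ : Module.End A (P e i)) (h : LinearMap.range φ ≠ ⊤) : IsNilpotent φ := by
  have := IsBasicIdempotents.finite (e := e) i
  -- The exponent must be positive for the kernel of `φ` to lie in the kernel of `φ ^ m`.
  obtain ⟨m, hm1, hm2⟩ := ((LinearMap.eventually_isCompl_ker_pow_range_pow φ).and
    (Filter.eventually_ge_atTop 1)).exists
  rcases he.eq_bot_or_eq_bot hm1 with h1 | h1
  · exfalso
    apply h
    have h2 : LinearMap.ker φ = ⊥ := by
      rw [eq_bot_iff, ← h1]
      intro x hx
      obtain ⟨k, rfl⟩ : ∃ k, m = k + 1 := ⟨m - 1, by omega⟩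
      rw [LinearMap.mem_ker] at hx ⊢
      rw [pow_succ, Module.End.mul_apply, hx, map_zero]
    exact LinearMap.range_eq_top.2
      (IsArtinian.surjective_of_injective_endomorphism φ (LinearMap.ker_eq_bot.1 h2))
  · exact ⟨m, LinearMap.range_eq_bot.1 h1⟩

/-- `P(i)` is local. If `e_i = x + y` with `x`, `y` in proper submodules, right multiplications by
`x` and by `y` are nilpotent endomorphisms with sum `1`; but `1` minus a nilpotent is a unit. -/
theorem IsBasicIdempotents.eq_top_or_eq_top (he : IsBasicIdempotents e) {i : Fin n}
    {N N' : Submodule A (P e i)} (h : N ⊔ N' = ⊤) : N = ⊤ ∨ N' = ⊤ := by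
  by_contra! hN
  obtain ⟨x, hx, y, hy, hxy⟩ := Submodule.mem_sup.1 (show gen e i ∈ N ⊔ N' by rw [h]; trivial)
  let φ : Module.End A (P e i) := liftP e i x
  let ψ : Module.End A (P e i) := liftP e i y
  have h1 : φ + ψ = 1 := by
    ext1 z
    change (z : A) • x + (z : A) • y = z
    rw [← smul_add, hxy, he.smul_gen]
  have h2 : LinearMap.range φ ≠ ⊤ := by
    intro h2
    apply hN.1
    rw [eq_top_iff, ← h2]
    rintro _ ⟨z, rfl⟩
    exact N.smul_mem _ hx
  have h3 : LinearMap.range ψ ≠ ⊤ := by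
    intro h2
    apply hN.2
    rw [eq_top_iff, ← h2]
    rintro _ ⟨z, rfl⟩
    exact N'.smul_mem _ hy
  have h4 : IsNilpotent φ := he.isNilpotent_of_range_ne_top φ h2
  have h5 : IsNilpotent ψ := he.isNilpotent_of_range_ne_top ψ h3
  have h6 : ψ = 1 - φ := by rw [← h1]; abel
  have h7 : IsUnit ψ := by rw [h6]; exact h4.isUnit_one_sub
  obtain ⟨m, hm⟩ := h5
  have h8 : IsUnit (ψ ^ m) := h7.pow m
  rw [hm, isUnit_zero_iff] at h8
  exact he.gen_ne_zero i (by simpa using (LinearMap.congr_fun h8 (gen e i)).symm)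

theorem IsBasicIdempotents.isCoatom_jacobson (he : IsBasicIdempotents e) (i : Fin n) :
    IsCoatom (Module.jacobson A (P e i)) ∧
      ∀ N : Submodule A (P e i), IsCoatom N → N = Module.jacobson A (P e i) := by
  have := IsBasicIdempotents.finite (e := e) i
  have : Nontrivial (P e i) := ⟨gen e i, 0, he.gen_ne_zero i⟩
  obtain ⟨N, hN⟩ := IsCoatomic.exists_coatom (Submodule A (P e i))
  have h1 : ∀ N', IsCoatom N' → N' = N := by
    intro N' hN'
    by_contra hne
    rcases he.eq_top_or_eq_top (hN'.sup_eq_top_of_ne hN hne) with h | h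
    · exact hN'.1 h
    · exact hN.1 h
  have h2 : Module.jacobson A (P e i) = N := by
    unfold Module.jacobson
    rw [show {m : Submodule A (P e i) | IsCoatom m} = {N} from
      Set.ext fun m => ⟨h1 m, fun h => by rw [Set.mem_singleton_iff.1 h]; exact hN⟩]
    exact sInf_singleton
  rw [h2]
  exact ⟨hN, h1⟩

theorem IsBasicIdempotents.isSimpleModule_E (he : IsBasicIdempotents e) (i : Fin n) :
    IsSimpleModule A (E e i) :=
  isSimpleModule_iff_isCoatom.2 (he.isCoatom_jacobson i).1

theorem IsBasicIdempotents.le_jacobson (he : IsBasicIdempotents e) {i : Fin n}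
    {N : Submodule A (P e i)} (hN : N ≠ ⊤) : N ≤ Module.jacobson A (P e i) := by
  by_contra h
  rcases he.eq_top_or_eq_top ((he.isCoatom_jacobson i).1.2 _ (right_lt_sup.2 h)) with h1 | h1
  · exact hN h1
  · exact (he.isCoatom_jacobson i).1.1 h1

theorem IsBasicIdempotents.smul_E_ne_zero (he : IsBasicIdempotents e) (i : Fin n) :
    ∃ x : E e i, e i • x ≠ 0 := by
  refine ⟨Submodule.Quotient.mk (gen e i), ?_⟩
  rw [← Submodule.Quotient.mk_smul, he.idem_smul_gen, Ne, Submodule.Quotient.mk_eq_zero]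
  exact fun h => (he.isCoatom_jacobson i).1.1 (he.eq_top_of_gen_mem h)

theorem IsBasicIdempotents.ker_liftP (he : IsBasicIdempotents e) [IsSimpleModule A M] {i : Fin n}
    {x : M} (hx : e i • x ≠ 0) : Function.Surjective (liftP e i x) ∧
      LinearMap.ker (liftP e i x) = Module.jacobson A (P e i) := by
  have h1 : liftP e i x ≠ 0 := fun h => hx (LinearMap.congr_fun h (gen e i))
  have h2 := LinearMap.surjective_of_ne_zero h1
  refine ⟨h2, (he.isCoatom_jacobson i).2 _ ?_⟩
  rw [← isSimpleModule_iff_isCoatom]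
  exact IsSimpleModule.congr ((liftP e i x).quotKerEquivOfSurjective h2)

theorem IsBasicIdempotents.nonempty_equiv_E (he : IsBasicIdempotents e) [IsSimpleModule A M]
    {i : Fin n} {x : M} (hx : e i • x ≠ 0) : Nonempty (E e i ≃ₗ[A] M) := by
  obtain ⟨h1, h2⟩ := he.ker_liftP hx
  exact ⟨(Submodule.quotEquivOfEq _ _ h2.symm).trans ((liftP e i x).quotKerEquivOfSurjective h1)⟩

/-- Lift the isomorphism of tops along the projection of `P(j)`. The lift is onto because a proper
image would lie in the radical. -/
theorem IsBasicIdempotents.exists_surjective (he : IsBasicIdempotents e) {i j : Fin n}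
    (φ : E e i ≃ₗ[A] E e j) : ∃ f : P e i →ₗ[A] P e j, Function.Surjective f := by
  have := he.projective i
  obtain ⟨f, hf⟩ := Module.projective_lifting_property (Module.jacobson A (P e j)).mkQ
    (φ.toLinearMap ∘ₗ (Module.jacobson A (P e i)).mkQ) (Submodule.mkQ_surjective _)
  refine ⟨f, LinearMap.range_eq_top.1 ?_⟩
  by_contra h
  obtain ⟨x, hx⟩ := he.smul_E_ne_zero j
  obtain ⟨z, rfl⟩ := (φ.surjective.comp (Submodule.mkQ_surjective _)) x
  apply hx
  have h1 : φ ((Module.jacobson A (P e i)).mkQ z) = (Module.jacobson A (P e j)).mkQ (f z) :=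
    (LinearMap.congr_fun hf z).symm
  have h2 : (Module.jacobson A (P e j)).mkQ (f z) = 0 := by
    rw [Submodule.mkQ_apply, Submodule.Quotient.mk_eq_zero]
    exact he.le_jacobson h ⟨z, rfl⟩
  rw [Function.comp_apply, h1, h2, smul_zero]

/-- A nonzero `e_j E(i)` makes the tops isomorphic, hence yields surjections between `P(i)` and
`P(j)` in both directions. By Noetherianity these are isomorphisms, and basicness identifies the
indices. -/
theorem IsBasicIdempotents.eq_of_smul_E_ne_zero (he : IsBasicIdempotents e) {i j : Fin n}
    {x : E e i} (hx : e j • x ≠ 0) : j = i := by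
  have := he.isSimpleModule_E i
  obtain ⟨φ⟩ := he.nonempty_equiv_E hx
  obtain ⟨f, hf⟩ := he.exists_surjective φ
  obtain ⟨g, hg⟩ := he.exists_surjective φ.symm
  have := IsBasicIdempotents.finite (e := e) j
  have h1 := IsNoetherian.injective_of_surjective_endomorphism (g ∘ₗ f) (hg.comp hf)
  exact he.basic j i ⟨LinearEquiv.ofBijective f ⟨Function.Injective.of_comp h1, hf⟩⟩

omit [IsArtinianRing A] in
theorem IsBasicIdempotents.exists_smul_ne_zero (he : IsBasicIdempotents e) {x : M} (hx : x ≠ 0) :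
    ∃ i, e i • x ≠ 0 := by
  by_contra! h
  apply hx
  rw [← one_smul A x, ← he.complete.complete, Finset.sum_smul]
  exact Finset.sum_eq_zero fun i _ => h i

theorem IsBasicIdempotents.exists_equiv_E (he : IsBasicIdempotents e) [IsSimpleModule A M] :
    ∃ i, Nonempty (E e i ≃ₗ[A] M) := by
  have := IsSimpleModule.nontrivial A M
  obtain ⟨x, hx⟩ := exists_ne (0 : M)
  obtain ⟨i, hi⟩ := he.exists_smul_ne_zero hx
  exact ⟨i, he.nonempty_equiv_E hi⟩

/-! ### Modules without composition factors of large index -/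

/-- No composition factor of `M` has an index that is at least `h`. -/
def Below (e : Fin n → A) (h : ℕ) (M : Type v) [AddCommGroup M] [Module A M] : Prop :=
  ∀ j : Fin n, h ≤ (j : ℕ) → ∀ x : M, e j • x = 0

section

omit [IsArtinianRing A]
variable {N : Type w} [AddCommGroup N] [Module A N] {h h' : ℕ}

theorem Below.mono (hM : Below e h M) (hh : h ≤ h') : Below e h' M :=
  fun j hj x => hM j (hh.trans hj) x

theorem Below.of_injective (hM : Below e h M) (f : N →ₗ[A] M) (hf : Function.Injective f) :
    Below e h N :=
  fun j hj x => hf (by rw [map_smul, hM j hj, map_zero])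

theorem Below.of_surjective (hM : Below e h M) (f : M →ₗ[A] N) (hf : Function.Surjective f) :
    Below e h N := by
  intro j hj x
  obtain ⟨y, rfl⟩ := hf x
  rw [← map_smul, hM j hj, map_zero]

theorem Below.submodule (hM : Below e h M) (N : Submodule A M) : Below e h N :=
  hM.of_injective N.subtype N.injective_subtype

theorem Below.quotient (hM : Below e h M) (N : Submodule A M) : Below e h (M ⧸ N) :=
  hM.of_surjective N.mkQ N.mkQ_surjective

theorem Below.of_ses (he : IsBasicIdempotents e) {X Y Z : Type u} [AddCommGroup X] [Module A X]
    [AddCommGroup Y] [Module A Y] [AddCommGroup Z] [Module A Z] {f : X →ₗ[A] Y} {g : Y →ₗ[A] Z}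
    (hs : Ses f g) (hX : Below e h X) (hZ : Below e h Z) : Below e h Y := by
  intro j hj y
  obtain ⟨x, hx⟩ := (hs.exact (e j • y)).1 (by rw [map_smul, hZ j hj])
  rw [← he.smul_smul_self, ← hx, ← map_smul, hX j hj, map_zero]

theorem Below.top (e : Fin n → A) : Below e n M := fun j hj => absurd j.2 (not_lt.2 hj)

theorem Below.subsingleton (he : IsBasicIdempotents e) (hM : Below e 0 M) : Subsingleton M := by
  refine subsingleton_of_forall_eq 0 fun x => ?_
  by_contra hx
  obtain ⟨i, hi⟩ := he.exists_smul_ne_zero hx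
  exact hi (hM i (Nat.zero_le _) x)

end

theorem IsBasicIdempotents.below_E (he : IsBasicIdempotents e) {h : ℕ} {i : Fin n} (hi : i < h) :
    Below e h (E e i) := by
  intro j hj x
  by_contra hx
  rw [he.eq_of_smul_E_ne_zero hx] at hj
  omega

theorem IsBasicIdempotents.lt_of_below_E (he : IsBasicIdempotents e) {h : ℕ} {i : Fin n}
    (hi : Below e h (E e i)) : i < h := by
  by_contra hh
  obtain ⟨x, hx⟩ := he.smul_E_ne_zero i
  exact hx (hi i (not_lt.1 hh) x)

end

end GoodFilt

namespace GoodFilt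
open CategoryTheory Abelian

/-! ### Pairs of families of modules with vanishing extensions -/

section

variable {A : Type u} [Ring A]
variable {X Y Z : Type u} [AddCommGroup X] [Module A X] [AddCommGroup Y] [Module A Y]
  [AddCommGroup Z] [Module A Z] {f : X →ₗ[A] Y} {g : Y →ₗ[A] Z}

theorem Ses.quotient (h : Ses f g) (T : Submodule A X) :
    Ses (T.mapQ (T.map f) f (Submodule.le_comap_map f T))
      ((T.map f).liftQ g (by
        rw [Submodule.map_le_iff_le_comap]
        intro x _
        exact h.zero x)) := by
  refine ⟨?_, ?_, ?_⟩
  · rw [← LinearMap.ker_eq_bot, eq_bot_iff]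
    intro x hx
    obtain ⟨x, rfl⟩ := T.mkQ_surjective x
    rw [LinearMap.mem_ker, Submodule.mkQ_apply, Submodule.mapQ_apply,
      Submodule.Quotient.mk_eq_zero] at hx
    obtain ⟨y, hy, hyx⟩ := hx
    rw [← h.inj hyx]
    exact (Submodule.Quotient.mk_eq_zero _).2 hy
  · intro y
    obtain ⟨y, rfl⟩ := (T.map f).mkQ_surjective y
    rw [Submodule.mkQ_apply, Submodule.liftQ_apply]
    constructor
    · intro hy
      obtain ⟨x, rfl⟩ := (h.exact _).1 hy
      exact ⟨Submodule.Quotient.mk x, rfl⟩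
    · rintro ⟨x, hx⟩
      obtain ⟨x, rfl⟩ := T.mkQ_surjective x
      rw [Submodule.mkQ_apply, Submodule.mapQ_apply] at hx
      have := congrArg ((T.map f).liftQ g (by
        rw [Submodule.map_le_iff_le_comap]
        intro x _
        exact h.zero x)) hx
      rw [Submodule.liftQ_apply, Submodule.liftQ_apply, h.zero] at this
      exact this.symm
  · intro z
    obtain ⟨y, rfl⟩ := h.surj z
    exact ⟨Submodule.Quotient.mk y, rfl⟩

/-- The kernel of `r` meets `X` in `T`, and it still maps onto `Z` because any `y` can be corrected
by an element of `X` with the same value under `r`. -/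
theorem Ses.ker_of_retract (h : Ses f g) (T : Submodule A X) (r : Y →ₗ[A] (X ⧸ T))
    (hr : r ∘ₗ f = T.mkQ) :
    ∃ f' : T →ₗ[A] LinearMap.ker r, Ses f' (g ∘ₗ (LinearMap.ker r).subtype) := by
  have hr' : ∀ x, r (f x) = T.mkQ x := fun x => LinearMap.congr_fun hr x
  refine ⟨(f ∘ₗ T.subtype).codRestrict _ fun x => ?_, ?_, ?_, ?_⟩
  · rw [LinearMap.mem_ker, LinearMap.comp_apply, hr', Submodule.mkQ_apply,
      Submodule.Quotient.mk_eq_zero]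
    exact x.2
  · intro x y hxy
    exact Subtype.ext (h.inj (congrArg Subtype.val hxy))
  · intro y
    constructor
    · intro hy
      obtain ⟨x, hx⟩ := (h.exact _).1 hy
      have h1 : r (f x) = 0 := by rw [hx]; exact y.2
      rw [hr', Submodule.mkQ_apply, Submodule.Quotient.mk_eq_zero] at h1
      exact ⟨⟨x, h1⟩, Subtype.ext hx⟩
    · rintro ⟨x, rfl⟩
      exact h.zero _
  · intro z
    obtain ⟨y, rfl⟩ := h.surj z
    obtain ⟨x, hx⟩ := T.mkQ_surjective (r y)
    refine ⟨⟨y - f x, ?_⟩, ?_⟩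
    · rw [LinearMap.mem_ker, map_sub, hr', hx, sub_self]
    · change g (y - f x) = g y
      rw [map_sub, h.zero, sub_zero]

theorem Ses.ker_liftQ (φ : Y →ₗ[A] Z) (N : Submodule A Y) (hN : N ≤ LinearMap.ker φ) :
    ∃ (p : N →ₗ[A] LinearMap.ker φ) (q : LinearMap.ker φ →ₗ[A] LinearMap.ker (N.liftQ φ hN)),
      Ses p q := by
  refine ⟨Submodule.inclusion hN, N.mkQ.restrict fun y hy => ?_, ?_, ?_, ?_⟩
  · rw [LinearMap.mem_ker, Submodule.mkQ_apply, Submodule.liftQ_apply]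
    exact hy
  · exact Submodule.inclusion_injective hN
  · intro y
    constructor
    · intro hy
      have h1 : N.mkQ (y : Y) = 0 := congrArg Subtype.val hy
      rw [Submodule.mkQ_apply, Submodule.Quotient.mk_eq_zero] at h1
      exact ⟨⟨y, h1⟩, rfl⟩
    · rintro ⟨x, rfl⟩
      exact Subtype.ext ((Submodule.Quotient.mk_eq_zero _).2 x.2)
  · rintro ⟨z, hz⟩
    obtain ⟨y, rfl⟩ := N.mkQ_surjective z
    exact ⟨⟨y, hz⟩, rfl⟩

/-- If `φ` is already onto on the submodule, elements of `Y` can be moved into the kernel of `φ`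
without changing their image in `Z`. -/
theorem Ses.ker_comp {W : Type u} [AddCommGroup W] [Module A W] (h : Ses f g) (φ : Y →ₗ[A] W)
    (hφ : Function.Surjective (φ ∘ₗ f)) :
    ∃ p : LinearMap.ker (φ ∘ₗ f) →ₗ[A] LinearMap.ker φ,
      Ses p (g ∘ₗ (LinearMap.ker φ).subtype) := by
  refine ⟨f.restrict fun y hy => hy, ?_, ?_, ?_⟩
  · intro x y hxy
    exact Subtype.ext (h.inj (congrArg (fun z : LinearMap.ker φ => (z : Y)) hxy))
  · intro y
    constructor
    · intro hy
      obtain ⟨x, hx⟩ := (h.exact _).1 hy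
      refine ⟨⟨x, ?_⟩, Subtype.ext hx⟩
      rw [LinearMap.mem_ker, LinearMap.comp_apply, hx]
      exact y.2
    · rintro ⟨x, rfl⟩
      exact h.zero _
  · intro z
    obtain ⟨y, rfl⟩ := h.surj z
    obtain ⟨x, hx⟩ := hφ (φ y)
    refine ⟨⟨y - f x, ?_⟩, ?_⟩
    · rw [LinearMap.mem_ker, map_sub, sub_eq_zero]
      exact hx.symm
    · change g (y - f x) = g y
      rw [map_sub, h.zero, sub_zero]

theorem Ses.length (h : Ses f g) : Module.length A Y = Module.length A X + Module.length A Z :=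
  Module.length_eq_add_of_exact f g h.inj h.surj h.exact

theorem Ses.length_quot_le (h : Ses f g) [Nontrivial X] {N : ℕ}
    (hN : Module.length A Y ≤ (N + 1 : ℕ)) : Module.length A Z ≤ N := by
  have h1 : 1 ≤ Module.length A X := Order.one_le_iff_pos.2 Module.length_pos
  have h2 : 1 + Module.length A Z ≤ 1 + (N : ℕ∞) := by
    rw [h.length] at hN
    refine (add_le_add_left h1 _).trans (hN.trans ?_)
    rw [add_comm]
    push_cast
    rfl
  exact (ENat.add_le_add_iff_left (by simp)).1 h2

theorem Ses.length_sub_le (h : Ses f g) [Nontrivial Z] {N : ℕ}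
    (hN : Module.length A Y ≤ (N + 1 : ℕ)) : Module.length A X ≤ N := by
  have h1 : 1 ≤ Module.length A Z := Order.one_le_iff_pos.2 Module.length_pos
  have h2 : Module.length A X + 1 ≤ (N : ℕ∞) + 1 := by
    rw [h.length] at hN
    refine (add_le_add_right h1 _).trans (hN.trans ?_)
    push_cast
    rfl
  exact (ENat.add_le_add_iff_right (by simp)).1 h2

end

/-- `M` has a filtration whose factors are members of `Θ` with indices satisfying `p`. -/
abbrev FiltP {A : Type u} [Ring A] {ι : Type} (p : ι → Prop) (Θ : ι → ModuleCat.{u} A)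
    (M : Type u) [AddCommGroup M] [Module A M] : Prop :=
  FiltM (fun j : {j : ι // p j} => Θ j.1) M

theorem FiltP.filtM {A : Type u} [Ring A] {ι : Type} {p : ι → Prop} {Θ : ι → ModuleCat.{u} A}
    {M : Type u} [AddCommGroup M] [Module A M] (h : FiltP p Θ M) : FiltM Θ M :=
  FiltM.reindex (Θ := fun j : {j : ι // p j} => Θ j.1) (fun i => ⟨i.1, rfl⟩) h

/-- A pair of families `(Θ, Θ')` of modules, with `Θ i` an extension of the simple module `E(i)`
by modules with smaller composition factors, and dually for `Θ' i`, that are orthogonal for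
`Ext¹`. The pairs `(Δ, ∇̄)` and `(Δ̄, ∇)` are examples. -/
structure OrthPair {A : Type u} [Ring A] {n : ℕ} (e : Fin n → A)
    (Θ Θ' : Fin n → ModuleCat.{u} A) where
  finite : ∀ i, Module.Finite A (Θ i)
  finite' : ∀ i, Module.Finite A (Θ' i)
  below : ∀ i : Fin n, Below e (i + 1) (Θ i)
  below' : ∀ i : Fin n, Below e (i + 1) (Θ' i)
  hom : ∀ (i : Fin n) (M : Type u) [AddCommGroup M] [Module A M], Below e i M →
    ExtVanish A 0 (Θ i) M
  ext : ∀ (i : Fin n) (M : Type u) [AddCommGroup M] [Module A M], Below e i M →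
    ExtVanish A 1 (Θ i) M
  ext' : ∀ (i : Fin n) (M : Type u) [AddCommGroup M] [Module A M], Below e i M →
    ExtVanish A 1 M (Θ' i)
  ext_self : ∀ i, ExtVanish A 1 (Θ i) (Θ' i)
  π : ∀ i, Θ i →ₗ[A] E e i
  π_surj : ∀ i, Function.Surjective (π i)
  π_sup : ∀ i (N : Submodule A (Θ i)), N.map (π i) = ⊤ → N = ⊤
  σ : ∀ i, E e i →ₗ[A] Θ' i
  σ_inj : ∀ i, Function.Injective (σ i)
  σ_ess : ∀ i (N : Submodule A (Θ' i)), N.comap (σ i) = ⊥ → N = ⊥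
  -- This lets `Ext¹` vanishing pass from `Θ j` to its simple top `E(j)`, for each `E(j)` occurring
  -- above the socle of `Θ' i`. It covers both pairs: for `(Δ, ∇̄)` one has `j < i`; for `(Δ̄, ∇)`
  -- only `j ≤ i`, but the radical of `Δ̄(j)` omits `E(j)`.
  compat : ∀ i j : Fin n, ∀ x : Θ' i ⧸ LinearMap.range (σ i), e j • x ≠ 0 →
    Below e i (LinearMap.ker (π j))
  compat' : ∀ i j : Fin n, ∀ x : LinearMap.ker (π i), e j • x ≠ 0 →
    Below e i (Θ' j ⧸ LinearMap.range (σ j))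
  -- The case of a single index, where the two pairs need different arguments: `Δ(i)` has no
  -- self-extensions, whereas `Δ̄(i)` may have some.
  layer : ∀ (i : Fin n) (X : Type u) [AddCommGroup X] [Module A X] (q : X →ₗ[A] Θ i),
    Function.Surjective q → FiltM (fun _ : Unit => Θ i) X →
      ∀ j, ExtVanish A 1 (LinearMap.ker q) (Θ' j)

/-! ### Ext groups between the two families, up to degree two -/

namespace OrthPair

variable {A : Type u} [Ring A] {n : ℕ} {e : Fin n → A} {Θ Θ' : Fin n → ModuleCat.{u} A}

theorem ext_one (P : OrthPair e Θ Θ') (i j : Fin n) : ExtVanish A 1 (Θ i) (Θ' j) := by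
  rcases lt_trichotomy i j with h | h | h
  · exact P.ext' j _ ((P.below i).mono (Nat.succ_le_of_lt h))
  · exact h ▸ P.ext_self i
  · exact P.ext i _ ((P.below' j).mono (Nat.succ_le_of_lt h))

theorem below_of_filtP (he : IsBasicIdempotents e) {p : Fin n → Prop} {h : ℕ}
    (hΘ : ∀ i, p i → Below e h (Θ i)) {X : Type u} [AddCommGroup X] [Module A X]
    (hX : FiltP p Θ X) : Below e h X :=
  FiltM.induction (motive := fun X _ _ => Below e h X)
    (fun _ => fun _ _ _ => Subsingleton.elim _ _)
    (fun _ _ _ _ _ _ i _ _ hs _ ih => Below.of_ses he hs ih (hΘ i.1 i.2)) X hX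

/-- A filtered module has a submodule that collects the factors of large index. -/
theorem exists_trace (P : OrthPair e Θ Θ') (he : IsBasicIdempotents e) (p : Fin n → Prop) (h : ℕ)
    (X : Type u) [AddCommGroup X] [Module A X] (hX : FiltP p Θ X) :
    ∃ T : Submodule A X, FiltP (fun i => p i ∧ h ≤ i) Θ T ∧
      FiltP (fun i => p i ∧ (i : ℕ) < h) Θ (X ⧸ T) := by
  refine FiltM.induction (motive := fun X _ _ => ∃ T : Submodule A X,
    FiltP (fun i => p i ∧ h ≤ i) Θ T ∧ FiltP (fun i => p i ∧ (i : ℕ) < h) Θ (X ⧸ T)) ?_ ?_ X hX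
  · intro X _ _ _
    exact ⟨⊥, FiltM.zero _, FiltM.zero _⟩
  · rintro X Y _ _ _ _ ⟨i, hi⟩ f g hs - ⟨T, hT, hXT⟩
    by_cases hih : (i : ℕ) < h
    · refine ⟨T.map f, hT.congr (Submodule.equivMapOfInjective f hs.inj T), ?_⟩
      exact FiltM.cons (i := (⟨i, hi, hih⟩ : {i : Fin n // p i ∧ (i : ℕ) < h})) (hs.quotient T)
        (LinearEquiv.refl _ _) hXT
    -- Here `X/T` has only indices below `h ≤ i`, so `Ext¹(Θ i, X/T) = 0` and the projection `X →
    -- X/T` extends to `Y`. The kernel of the extension is `T` enlarged by the new factor.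
    · have h1 : Below e i (X ⧸ T) := below_of_filtP he (fun j hj =>
        (P.below j).mono (by omega)) hXT
      obtain ⟨r, hr⟩ := ExtVanish.exists_extend hs (P.ext i _ h1) T.mkQ
      obtain ⟨f', hf'⟩ := hs.ker_of_retract T r hr
      refine ⟨LinearMap.ker r, ?_, ?_⟩
      · exact FiltM.cons (i := (⟨i, hi, not_lt.1 hih⟩ : {i : Fin n // p i ∧ h ≤ i})) hf'
          (LinearEquiv.refl _ _) hT
      · have hsurj : Function.Surjective r := by
          intro x
          obtain ⟨x, rfl⟩ := T.mkQ_surjective x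
          exact ⟨f x, LinearMap.congr_fun hr x⟩
        exact hXT.congr (r.quotKerEquivOfSurjective hsurj).symm

/-- Sort the factors of `X` by index: `X/T` has indices below `i`, `T/T'` only `i`, and `T'` those
above `i`. The map `q` is onto already on `T` and kills `T'`, so its kernel is built from `T'`, the
kernel of the induced map `T/T' → Θ i`, and `X/T`. The middle piece is handled by `layer`. -/
theorem ext_one_ker (P : OrthPair e Θ Θ') (he : IsBasicIdempotents e) {X : Type u}
    [AddCommGroup X] [Module A X] (hX : FiltM Θ X) {i : Fin n} (q : X →ₗ[A] Θ i)
    (hq : Function.Surjective q) (j : Fin n) : ExtVanish A 1 (LinearMap.ker q) (Θ' j) := by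
  have hX' : FiltP (fun _ => True) Θ X := hX.reindex fun i => ⟨⟨i, trivial⟩, rfl⟩
  obtain ⟨T, hT, hXT⟩ := P.exists_trace he _ i X hX'
  obtain ⟨T', hT', hTT⟩ := P.exists_trace he _ (i + 1) T hT
  -- The cokernel is a quotient of `X/T`, hence has only factors of index below `i`, and `Θ i` has
  -- no nonzero map to such a module.
  have hsurj : Function.Surjective (q ∘ₗ T.subtype) := by
    have h1 : Below e i (X ⧸ T) := below_of_filtP he (fun j hj => (P.below j).mono hj.2) hXT
    have h2 : Below e i (Θ i ⧸ LinearMap.range (q ∘ₗ T.subtype)) := by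
      refine h1.of_surjective (T.mapQ _ q ?_) ?_
      · intro x hx
        exact ⟨⟨x, hx⟩, rfl⟩
      · intro z
        obtain ⟨z, rfl⟩ := Submodule.mkQ_surjective _ z
        obtain ⟨x, rfl⟩ := hq z
        exact ⟨T.mkQ x, rfl⟩
    have h3 := ExtVanish.zero_iff.1 (P.hom i _ h2) (Submodule.mkQ _)
    rw [← LinearMap.range_eq_top, ← Submodule.ker_mkQ (LinearMap.range (q ∘ₗ T.subtype)), h3,
      LinearMap.ker_zero]
  have hzero : T' ≤ LinearMap.ker (q ∘ₗ T.subtype) := by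
    have h1 : ExtVanish A 0 T' (Θ i) := hT'.extVanish_left fun l =>
      P.hom l.1 _ ((P.below i).mono l.2.2)
    have h2 := ExtVanish.zero_iff.1 h1 ((q ∘ₗ T.subtype) ∘ₗ T'.subtype)
    intro x hx
    exact LinearMap.congr_fun h2 ⟨x, hx⟩
  have hlayer : ExtVanish A 1 (LinearMap.ker (T'.liftQ (q ∘ₗ T.subtype) hzero)) (Θ' j) := by
    refine P.layer i _ _ ?_ (hTT.reindex fun l => ⟨(), ?_⟩) j
    · intro z
      obtain ⟨x, rfl⟩ := hsurj z
      exact ⟨T'.mkQ x, rfl⟩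
    · have : l.1 = i := Fin.ext (by have := l.2.1.2; have := l.2.2; omega)
      rw [this]
  obtain ⟨p₁, p₂, hp⟩ := Ses.ker_liftQ (q ∘ₗ T.subtype) T' hzero
  obtain ⟨p₃, hp₃⟩ := (Ses.of_submodule T).ker_comp q hsurj
  exact .mid_left hp₃ (.mid_left hp (hT'.extVanish_left fun l => P.ext_one l.1 j) hlayer)
    (hXT.extVanish_left fun l => P.ext_one l.1 j)

section

variable [IsArtinianRing A]

/-- `Θ i` is generated by any lift of a nonzero element of its simple top. -/
theorem exists_surjective (P : OrthPair e Θ Θ') (he : IsBasicIdempotents e) (i : Fin n) :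
    ∃ q : A →ₗ[A] Θ i, Function.Surjective q := by
  obtain ⟨y, hy⟩ := he.smul_E_ne_zero i
  obtain ⟨x, rfl⟩ := P.π_surj i y
  have := he.isSimpleModule_E i
  refine ⟨LinearMap.toSpanSingleton A (Θ i) x, LinearMap.range_eq_top.1 (P.π_sup i _ ?_)⟩
  rw [← LinearMap.range_comp]
  refine (eq_bot_or_eq_top _).resolve_left fun h => hy ?_
  rw [LinearMap.range_eq_bot] at h
  have h1 : P.π i ((1 : A) • x) = 0 := LinearMap.congr_fun h 1
  rw [← one_smul A x, h1, smul_zero]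

theorem ext_two (P : OrthPair e Θ Θ') (he : IsBasicIdempotents e) (hA : FiltM Θ A) (i j : Fin n) :
    ExtVanish A 2 (Θ i) (Θ' j) := by
  obtain ⟨q, hq⟩ := P.exists_surjective he i
  exact .quot_left (Ses.of_ker q hq) (P.ext_one_ker he hA q hq j) .of_projective

end

end OrthPair

/-! ### Dévissage of Ext along composition series -/

section

variable {A : Type u} [Ring A] [IsArtinianRing A] {n : ℕ} {e : Fin n → A}

theorem isFiniteLength_of_finite (M : Type v) [AddCommGroup M] [Module A M] [Module.Finite A M] :
    IsFiniteLength A M :=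
  isFiniteLength_iff_isNoetherian_isArtinian.2 ⟨inferInstance, inferInstance⟩

/-- Only the simple modules that occur in `M` are tested; occurrence of `E(j)` is expressed by `e_j
M ≠ 0`, which passes from submodules and quotients to `M`. -/
theorem ExtVanish.of_simple_left (he : IsBasicIdempotents e) {k : ℕ} {Y : Type u} [AddCommGroup Y]
    [Module A Y] (M : Type u) [AddCommGroup M] [Module A M] [Module.Finite A M]
    (hM : ∀ j, ∀ x : M, e j • x ≠ 0 → ExtVanish A k (E e j) Y) : ExtVanish A k M Y := by
  have := isFiniteLength_of_finite (A := A) M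
  clear ‹Module.Finite A M›
  induction this with
  | of_subsingleton => exact .of_subsingleton_left
  | @of_simple_quotient M _ _ N _ _ ih =>
    refine .mid_left (Ses.of_submodule N) (ih fun j x hx => hM j x fun h => hx (Subtype.ext h)) ?_
    obtain ⟨j, ⟨φ⟩⟩ := he.exists_equiv_E (M := M ⧸ N)
    obtain ⟨x, hx⟩ := he.smul_E_ne_zero j
    obtain ⟨y, hy⟩ := N.mkQ_surjective (φ x)
    refine (hM j y fun h => hx (φ.injective ?_)).congr_left φ.symm
    rw [map_smul, ← hy, ← map_smul, h, map_zero, map_zero]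

theorem ExtVanish.of_simple_right (he : IsBasicIdempotents e) {k : ℕ} {X : Type u} [AddCommGroup X]
    [Module A X] (M : Type u) [AddCommGroup M] [Module A M] [Module.Finite A M]
    (hM : ∀ j, ∀ x : M, e j • x ≠ 0 → ExtVanish A k X (E e j)) : ExtVanish A k X M := by
  have := isFiniteLength_of_finite (A := A) M
  clear ‹Module.Finite A M›
  induction this with
  | of_subsingleton => exact .of_subsingleton_right
  | @of_simple_quotient M _ _ N _ _ ih =>
    refine .mid_right (Ses.of_submodule N) (ih fun j x hx => hM j x fun h => hx (Subtype.ext h)) ?_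
    obtain ⟨j, ⟨φ⟩⟩ := he.exists_equiv_E (M := M ⧸ N)
    obtain ⟨x, hx⟩ := he.smul_E_ne_zero j
    obtain ⟨y, hy⟩ := N.mkQ_surjective (φ x)
    refine (hM j y fun h => hx (φ.injective ?_)).congr_right φ.symm
    rw [map_smul, ← hy, ← map_smul, h, map_zero, map_zero]

end

end GoodFilt

namespace GoodFilt
open CategoryTheory Abelian

/-! ### Filtered modules as `Ext¹`-orthogonal classes -/

namespace OrthPair

variable {A : Type u} [Ring A] [IsArtinianRing A] {n : ℕ} {e : Fin n → A}
  {Θ Θ' : Fin n → ModuleCat.{u} A}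

/-- A module that is `Ext¹`-orthogonal to all `Θ i` is filtered by the `Θ' i`. -/
theorem filtP_right_of_length_le (P : OrthPair e Θ Θ') (he : IsBasicIdempotents e)
    (h2 : ∀ i j, ExtVanish A 2 (Θ i) (Θ' j)) (N : ℕ) (Y : Type u) [AddCommGroup Y] [Module A Y]
    [Module.Finite A Y] (hN : Module.length A Y ≤ N) (hY : ∀ l, ExtVanish A 1 (Θ l) Y) (h : ℕ)
    (hh : ∀ (M : Type u) [AddCommGroup M] [Module A M], Below e h M → ExtVanish A 0 M Y) :
    FiltP (fun i : Fin n => h ≤ i) Θ' Y := by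
  induction N generalizing Y with
  | zero =>
    have : Subsingleton Y := Module.length_eq_zero_iff.1 (nonpos_iff_eq_zero.1 hN)
    exact .zero _
  | succ N ih =>
    rcases subsingleton_or_nontrivial Y with hs | hs
    · exact .zero _
    classical
    -- The least such `k` has the form `i + 1`: some module with factors of index at most `i` maps
    -- nontrivially to `Y`, but none with all indices below `i` does. Hence `E(i)` is a submodule of
    -- `Y`.
    have hQ : ∃ k, ¬ ∀ (M : Type u) [AddCommGroup M] [Module A M], Below e k M →
        ExtVanish A 0 M Y :=
      ⟨n, fun H => not_subsingleton Y (H Y (Below.top e)).subsingleton_of_zero⟩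
    obtain ⟨i, hi, hlt, hP⟩ : ∃ i : Fin n, (¬ ∀ (M : Type u) [AddCommGroup M] [Module A M],
        Below e (i + 1) M → ExtVanish A 0 M Y) ∧ h ≤ i ∧
        ∀ (M : Type u) [AddCommGroup M] [Module A M], Below e i M → ExtVanish A 0 M Y := by
      have h1 := Nat.find_spec hQ
      have h3 : Nat.find hQ ≠ 0 := fun h0 => h1 fun M _ _ hM => by
        rw [h0] at hM
        have := hM.subsingleton he
        exact .of_subsingleton_left
      obtain ⟨k, hk⟩ := Nat.exists_eq_succ_of_ne_zero h3
      have h4 : Nat.find hQ ≤ n := Nat.find_min' hQ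
        fun H => not_subsingleton Y (H Y (Below.top e)).subsingleton_of_zero
      rw [hk] at h1 h4
      refine ⟨⟨k, h4⟩, h1, ?_, not_not.1 (Nat.find_min hQ (hk ▸ Nat.lt_succ_self k))⟩
      by_contra hkh
      exact h1 fun M _ _ hM => hh M (hM.mono (by simp at hkh; omega))
    obtain ⟨s, hs⟩ : ∃ s : E e i →ₗ[A] Y, Function.Injective s := by
      push Not at hi
      obtain ⟨M, _, _, hM, hMY⟩ := hi
      rw [ExtVanish.zero_iff] at hMY
      push Not at hMY
      obtain ⟨φ, hφ⟩ := hMY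
      obtain ⟨S, hS, hSφ⟩ := (IsAtomic.eq_bot_or_exists_atom_le (LinearMap.range φ)).resolve_left
        fun h0 => hφ (LinearMap.range_eq_bot.1 h0)
      have : IsSimpleModule A S := isSimpleModule_iff_isAtom.2 hS
      have hb : Below e (i + 1) S := (hM.of_surjective φ.rangeRestrict
        φ.surjective_rangeRestrict).of_injective (Submodule.inclusion hSφ)
        (Submodule.inclusion_injective hSφ)
      obtain ⟨j, ⟨ψ⟩⟩ := he.exists_equiv_E (M := S)
      have h1 : (j : ℕ) < i + 1 := he.lt_of_below_E (hb.of_injective ψ.toLinearMap ψ.injective)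
      have h3 : ¬ (j : ℕ) < i := by
        intro hji
        have h4 := hP S ((he.below_E hji).of_surjective ψ.toLinearMap ψ.surjective)
        have h5 := ExtVanish.zero_iff.1 h4 S.subtype
        have h6 : S = ⊥ := by rw [← Submodule.range_subtype S, h5, LinearMap.range_zero]
        exact hS.1 h6
      have h4 : j = i := Fin.ext (by omega)
      subst h4
      exact ⟨S.subtype ∘ₗ ψ.toLinearMap, S.injective_subtype.comp ψ.injective⟩
    have := P.finite' i
    have := he.isSimpleModule_E i
    have := IsSimpleModule.nontrivial A (E e i)
    have : Nontrivial (Θ' i) := (P.σ_inj i).nontrivial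
    -- For a factor `E(j)` of this quotient, the kernel of `Θ j → E(j)` has indices below `i` and so
    -- no map to `Y`; thus `Ext¹(E(j), Y)` inherits vanishing from `Ext¹(Θ j, Y)`. The embedding of
    -- `E(i)` therefore extends to `Θ' i`, and stays injective since the socle is essential.
    have h3 : ExtVanish A 1 (Θ' i ⧸ LinearMap.range (P.σ i)) Y :=
      .of_simple_left he _ fun j x hx =>
        .quot_left (Ses.of_ker (P.π j) (P.π_surj j)) (hP _ (P.compat i j x hx)) (hY j)
    obtain ⟨g, hg⟩ := h3.exists_extend (Ses.of_range (P.σ i) (P.σ_inj i)) s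
    have hginj : Function.Injective g := by
      rw [← LinearMap.ker_eq_bot]
      apply P.σ_ess i
      rw [← LinearMap.ker_comp, hg, LinearMap.ker_eq_bot]
      exact hs
    have hses := Ses.of_range g hginj
    -- `Ext²(Θ, Θ') = 0` keeps the quotient orthogonal to `Θ`. The absence of maps from modules with
    -- indices below `h` also passes to the quotient, because `h ≤ i`.
    refine FiltM.ext hses (FiltM.single (Θ := fun i : {i : Fin n // h ≤ i} => Θ' i.1) ⟨i, hlt⟩)
      (ih _ (hses.length_quot_le hN) (fun l => .quot_right hses (hY l) (h2 l i))
        fun M _ _ hM => .quot_right hses (hh M hM) (P.ext' i M (hM.mono hlt)))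

theorem filtP_right (P : OrthPair e Θ Θ') (he : IsBasicIdempotents e)
    (h2 : ∀ i j, ExtVanish A 2 (Θ i) (Θ' j)) (Y : Type u) [AddCommGroup Y] [Module A Y]
    [Module.Finite A Y] (hY : ∀ l, ExtVanish A 1 (Θ l) Y) (h : ℕ)
    (hh : ∀ (M : Type u) [AddCommGroup M] [Module A M], Below e h M → ExtVanish A 0 M Y) :
    FiltP (fun i : Fin n => h ≤ i) Θ' Y := by
  obtain ⟨N, hN⟩ := ENat.ne_top_iff_exists.1 (Module.length_ne_top (R := A) (M := Y))
  exact P.filtP_right_of_length_le he h2 N Y hN.ge hY h hh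

theorem filtM_right (P : OrthPair e Θ Θ') (he : IsBasicIdempotents e)
    (h2 : ∀ i j, ExtVanish A 2 (Θ i) (Θ' j)) (Y : Type u) [AddCommGroup Y] [Module A Y]
    [Module.Finite A Y] (hY : ∀ l, ExtVanish A 1 (Θ l) Y) : FiltM Θ' Y :=
  (P.filtP_right he h2 Y hY 0 fun M _ _ hM => by
    have := hM.subsingleton he
    exact .of_subsingleton_left).filtM

/-- A module that is `Ext¹`-orthogonal to all `Θ' i` is filtered by the `Θ i`. -/
theorem filtP_left_of_length_le (P : OrthPair e Θ Θ') (he : IsBasicIdempotents e)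
    (h2 : ∀ i j, ExtVanish A 2 (Θ i) (Θ' j)) (N : ℕ) (X : Type u) [AddCommGroup X] [Module A X]
    [Module.Finite A X] (hN : Module.length A X ≤ N) (hX : ∀ l, ExtVanish A 1 X (Θ' l)) (h : ℕ)
    (hh : ∀ (M : Type u) [AddCommGroup M] [Module A M], Below e h M → ExtVanish A 0 X M) :
    FiltP (fun i : Fin n => h ≤ i) Θ X := by
  induction N generalizing X with
  | zero =>
    have : Subsingleton X := Module.length_eq_zero_iff.1 (nonpos_iff_eq_zero.1 hN)
    exact .zero _
  | succ N ih =>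
    rcases subsingleton_or_nontrivial X with hs | hs
    · exact .zero _
    classical
    have hQ : ∃ k, ¬ ∀ (M : Type u) [AddCommGroup M] [Module A M], Below e k M →
        ExtVanish A 0 X M :=
      ⟨n, fun H => not_subsingleton X (H X (Below.top e)).subsingleton_of_zero⟩
    obtain ⟨i, hi, hlt, hP⟩ : ∃ i : Fin n, (¬ ∀ (M : Type u) [AddCommGroup M] [Module A M],
        Below e (i + 1) M → ExtVanish A 0 X M) ∧ h ≤ i ∧
        ∀ (M : Type u) [AddCommGroup M] [Module A M], Below e i M → ExtVanish A 0 X M := by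
      have h1 := Nat.find_spec hQ
      have h3 : Nat.find hQ ≠ 0 := fun h0 => h1 fun M _ _ hM => by
        rw [h0] at hM
        have := hM.subsingleton he
        exact .of_subsingleton_right
      obtain ⟨k, hk⟩ := Nat.exists_eq_succ_of_ne_zero h3
      have h4 : Nat.find hQ ≤ n := Nat.find_min' hQ
        fun H => not_subsingleton X (H X (Below.top e)).subsingleton_of_zero
      rw [hk] at h1 h4
      refine ⟨⟨k, h4⟩, h1, ?_, not_not.1 (Nat.find_min hQ (hk ▸ Nat.lt_succ_self k))⟩
      by_contra hkh
      exact h1 fun M _ _ hM => hh M (hM.mono (by simp at hkh; omega))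
    obtain ⟨p, hp⟩ : ∃ p : X →ₗ[A] E e i, Function.Surjective p := by
      push Not at hi
      obtain ⟨M, _, _, hM, hMX⟩ := hi
      rw [ExtVanish.zero_iff] at hMX
      push Not at hMX
      obtain ⟨φ, hφ⟩ := hMX
      have : Nontrivial (LinearMap.range φ) := by
        rw [Submodule.nontrivial_iff_ne_bot]
        exact fun h0 => hφ (LinearMap.range_eq_bot.1 h0)
      obtain ⟨S, hS⟩ := IsCoatomic.exists_coatom (Submodule A (LinearMap.range φ))
      have : IsSimpleModule A (LinearMap.range φ ⧸ S) := isSimpleModule_iff_isCoatom.2 hS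
      have hsurj : Function.Surjective (S.mkQ ∘ₗ φ.rangeRestrict) :=
        S.mkQ_surjective.comp φ.surjective_rangeRestrict
      have hb : Below e (i + 1) (LinearMap.range φ ⧸ S) := (hM.submodule _).quotient _
      obtain ⟨j, ⟨ψ⟩⟩ := he.exists_equiv_E (M := LinearMap.range φ ⧸ S)
      have h1 : (j : ℕ) < i + 1 := he.lt_of_below_E (hb.of_injective ψ.toLinearMap ψ.injective)
      have h3 : ¬ (j : ℕ) < i := by
        intro hji
        have h4 := hP _ ((he.below_E hji).of_surjective ψ.toLinearMap ψ.surjective)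
        have h5 := ExtVanish.zero_iff.1 h4 (S.mkQ ∘ₗ φ.rangeRestrict)
        rw [← LinearMap.range_eq_top, h5, LinearMap.range_zero] at hsurj
        have := IsSimpleModule.nontrivial A (LinearMap.range φ ⧸ S)
        exact bot_ne_top hsurj
      have h4 : j = i := Fin.ext (by omega)
      subst h4
      exact ⟨ψ.symm.toLinearMap ∘ₗ (S.mkQ ∘ₗ φ.rangeRestrict), ψ.symm.surjective.comp hsurj⟩
    have := P.finite i
    have := he.isSimpleModule_E i
    have := IsSimpleModule.nontrivial A (E e i)
    have : Nontrivial (Θ i) := (P.π_surj i).nontrivial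
    -- With `E(i)` the quotient of `X` of least index, this lets `X → E(i)` lift to `Θ i`; the lift
    -- is onto because it is onto modulo the radical.
    have h3 : ExtVanish A 1 X (LinearMap.ker (P.π i)) :=
      .of_simple_right he _ fun j x hx =>
        .sub_right (Ses.of_range (P.σ j) (P.σ_inj j)) (hP _ (P.compat' i j x hx)) (hX j)
    obtain ⟨g, hg⟩ := h3.exists_lift (Ses.of_ker (P.π i) (P.π_surj i)) p
    have hgsurj : Function.Surjective g := by
      rw [← LinearMap.range_eq_top]
      apply P.π_sup i
      rw [← LinearMap.range_comp, hg, LinearMap.range_eq_top]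
      exact hp
    have hses := Ses.of_ker g hgsurj
    refine FiltM.ext hses (ih _ (hses.length_sub_le hN)
      (fun l => .sub_left hses (hX l) (h2 i l))
        fun M _ _ hM => .sub_left hses (hh M hM) (P.ext i M (hM.mono hlt)))
        (FiltM.single (Θ := fun i : {i : Fin n // h ≤ i} => Θ i.1) ⟨i, hlt⟩)

theorem filtP_left (P : OrthPair e Θ Θ') (he : IsBasicIdempotents e)
    (h2 : ∀ i j, ExtVanish A 2 (Θ i) (Θ' j)) (X : Type u) [AddCommGroup X] [Module A X]
    [Module.Finite A X] (hX : ∀ l, ExtVanish A 1 X (Θ' l)) (h : ℕ)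
    (hh : ∀ (M : Type u) [AddCommGroup M] [Module A M], Below e h M → ExtVanish A 0 X M) :
    FiltP (fun i : Fin n => h ≤ i) Θ X := by
  obtain ⟨N, hN⟩ := ENat.ne_top_iff_exists.1 (Module.length_ne_top (R := A) (M := X))
  exact P.filtP_left_of_length_le he h2 N X hN.ge hX h hh

theorem filtM_left (P : OrthPair e Θ Θ') (he : IsBasicIdempotents e)
    (h2 : ∀ i j, ExtVanish A 2 (Θ i) (Θ' j)) (X : Type u) [AddCommGroup X] [Module A X]
    [Module.Finite A X] (hX : ∀ l, ExtVanish A 1 X (Θ' l)) : FiltM Θ X :=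
  (P.filtP_left he h2 X hX 0 fun M _ _ hM => by
    have := hM.subsingleton he
    exact .of_subsingleton_right).filtM

/-- The kernel of `A → Θ i` is orthogonal to `Θ'`, hence lies in `F(Θ)` itself, so dimension
shifting can be repeated. -/
theorem ext_all (P : OrthPair e Θ Θ') (he : IsBasicIdempotents e) (hA : FiltM Θ A) (k : ℕ)
    (i j : Fin n) : ExtVanish A (k + 1) (Θ i) (Θ' j) := by
  induction k generalizing i with
  | zero => exact P.ext_one i j
  | succ k ih =>
    obtain ⟨q, hq⟩ := P.exists_surjective he i
    have h1 : FiltM Θ (LinearMap.ker q) :=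
      P.filtM_left he (P.ext_two he hA) _ (P.ext_one_ker he hA q hq)
    exact .quot_left (Ses.of_ker q hq) (h1.extVanish_left ih) .of_projective

end OrthPair

end GoodFilt

namespace GoodFilt
open CategoryTheory Abelian

/-! ### Composition multiplicities as lengths -/

section

variable (R : Type u) {A : Type u} [CommRing R] [Ring A] [Algebra R A] {n : ℕ} (e : Fin n → A)

/-- The length over `R` of `e_j M`. -/
noncomputable def idemLength (j : Fin n) (M : Type v) [AddCommGroup M] [Module A M] [Module R M]
    [IsScalarTower R A M] : ℕ∞ :=
  Module.length R (LinearMap.range (Algebra.lsmul R R M (e j)))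

variable {e}
variable {X Y Z : Type u} [AddCommGroup X] [Module A X] [Module R X] [IsScalarTower R A X]
  [AddCommGroup Y] [Module A Y] [Module R Y] [IsScalarTower R A Y]
  [AddCommGroup Z] [Module A Z] [Module R Z] [IsScalarTower R A Z]
  {f : X →ₗ[A] Y} {g : Y →ₗ[A] Z}

theorem idemLength_eq_zero_iff (j : Fin n) :
    idemLength R e j X = 0 ↔ ∀ x : X, e j • x = 0 := by
  unfold idemLength
  rw [Module.length_eq_zero_iff, Submodule.subsingleton_iff_eq_bot, LinearMap.range_eq_bot]
  exact ⟨fun h x => LinearMap.congr_fun h x, fun h => LinearMap.ext h⟩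

/-- `M ↦ e_j M` is exact; idempotency gives exactness in the middle. -/
theorem Ses.idemLength (h : Ses f g) (he : IsBasicIdempotents e) (j : Fin n) :
    idemLength R e j Y = idemLength R e j X + idemLength R e j Z := by
  let F : LinearMap.range (Algebra.lsmul R R X (e j)) →ₗ[R]
      LinearMap.range (Algebra.lsmul R R Y (e j)) :=
    (f.restrictScalars R).restrict (by
      rintro _ ⟨x, rfl⟩
      exact ⟨f x, (map_smul f (e j) x).symm⟩)
  let G : LinearMap.range (Algebra.lsmul R R Y (e j)) →ₗ[R]
      LinearMap.range (Algebra.lsmul R R Z (e j)) :=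
    (g.restrictScalars R).restrict (by
      rintro _ ⟨x, rfl⟩
      exact ⟨g x, (map_smul g (e j) x).symm⟩)
  refine Module.length_eq_add_of_exact F G ?_ ?_ ?_
  · intro x y hxy
    exact Subtype.ext (h.inj (congrArg Subtype.val hxy))
  · rintro ⟨_, z, rfl⟩
    obtain ⟨y, rfl⟩ := h.surj z
    exact ⟨⟨_, y, rfl⟩, Subtype.ext (map_smul g (e j) y)⟩
  · rintro ⟨_, y, rfl⟩
    constructor
    · intro hy
      obtain ⟨x, hx⟩ := (h.exact _).1 (congrArg Subtype.val hy)
      refine ⟨⟨_, x, rfl⟩, Subtype.ext ?_⟩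
      change f (e j • x) = e j • y
      rw [map_smul, hx]
      exact he.smul_smul_self j y
    · rintro ⟨x, hx⟩
      rw [← hx]
      exact Subtype.ext (h.zero _)

omit [IsScalarTower R A X] in
theorem LinearEquiv.idemLength_eq [IsScalarTower R A X] (φ : X ≃ₗ[A] Y) (j : Fin n) :
    idemLength R e j X = idemLength R e j Y := by
  unfold idemLength
  refine LinearEquiv.length_eq (LinearEquiv.ofLinearMap
    ((φ.toLinearMap.restrictScalars R).restrict ?_)
    ((φ.symm.toLinearMap.restrictScalars R).restrict ?_) ?_ ?_)
  · rintro _ ⟨x, rfl⟩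
    exact ⟨φ x, (map_smul φ (e j) x).symm⟩
  · rintro _ ⟨x, rfl⟩
    exact ⟨φ.symm x, (map_smul φ.symm (e j) x).symm⟩
  · ext x
    exact φ.apply_symm_apply x
  · ext x
    exact φ.symm_apply_apply x

theorem idemLength_ne_top [IsArtinianRing R] [Module.Finite R A] [Module.Finite A X] (j : Fin n) :
    idemLength R e j X ≠ ⊤ := by
  have : Module.Finite R X := Module.Finite.trans A X
  exact Module.length_ne_top

theorem eq_sum_of_succ_eq_add {M : Type*} [AddCommMonoid M] (t : ℕ) (L : Fin (t + 1) → M)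
    (F : Fin t → M) (h0 : L 0 = 0) (hs : ∀ l, L l.succ = L l.castSucc + F l) :
    L (Fin.last t) = ∑ l, F l := by
  induction t with
  | zero => simpa using h0
  | succ t ih =>
    rw [Fin.sum_univ_castSucc, ← Fin.succ_last, hs, ih (fun l => L l.castSucc)
      (fun l => F l.castSucc) h0 fun l => by rw [← hs]; rfl]

/-- The inclusion `N → N'` and the projection onto `N' / N`. -/
theorem Ses.of_le {N N' : Submodule A X} (h : N ≤ N') :
    Ses (Submodule.inclusion h) (N.submoduleOf N').mkQ := by
  refine ⟨Submodule.inclusion_injective h, ?_, Submodule.mkQ_surjective _⟩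
  rw [LinearMap.exact_iff, Submodule.ker_mkQ, Submodule.range_inclusion]
  rfl

variable [IsArtinianRing R] [Module.Finite R A]

theorem MultEq.idemLength_eq (he : IsBasicIdempotents e) {j : Fin n} {k : ℕ}
    (h : MultEq A X (E e j) k) :
    GoodFilt.idemLength R e j X = k * GoodFilt.idemLength R e j (E e j) := by
  classical
  have : IsArtinianRing A := IsArtinianRing.of_finite R A
  obtain ⟨s, h0, h1, hk⟩ := h
  have h2 := eq_sum_of_succ_eq_add s.length (fun l => GoodFilt.idemLength R e j ↥(s l))
    (fun l => if Nonempty ((↥(s l.succ) ⧸ (s l.castSucc).submoduleOf (s l.succ)) ≃ₗ[A] E e j)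
      then GoodFilt.idemLength R e j (E e j) else 0) ?_ ?_
  · rw [Finset.sum_ite, Finset.sum_const, Finset.sum_const_zero, add_zero, nsmul_eq_mul,
      ← Fintype.card_subtype, ← Nat.card_eq_fintype_card, hk] at h2
    rw [← h2]
    have h3 : s (Fin.last s.length) = ⊤ := h1
    rw [h3]
    exact LinearEquiv.idemLength_eq R Submodule.topEquiv.symm j
  · rw [idemLength_eq_zero_iff]
    rintro ⟨x, hx⟩
    have h3 : s 0 = ⊥ := h0
    have h4 : x = 0 := (Submodule.mem_bot A).1 (h3 ▸ hx)
    exact Subtype.ext (show e j • x = 0 by rw [h4, smul_zero])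
  · intro l
    have hcov : s l.castSucc ⋖ s l.succ := s.step l
    rw [(Ses.of_le hcov.le).idemLength R he j]
    congr 1
    have : IsSimpleModule A (↥(s l.succ) ⧸ (s l.castSucc).submoduleOf (s l.succ)) :=
      (covBy_iff_quot_is_simple hcov.le).1 hcov
    split_ifs with hif
    · exact LinearEquiv.idemLength_eq R hif.some j
    · rw [idemLength_eq_zero_iff]
      intro x
      by_contra hx
      obtain ⟨ψ⟩ := he.nonempty_equiv_E hx
      exact hif ⟨ψ.symm⟩

/-- Only factors isomorphic to `E(j)` contribute to the length of `e_j X`. For the converse, the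
length of `e_j E(j)` is nonzero and finite, so it can be cancelled. Multiplicities thus become an
additive invariant that needs no choice of composition series. -/
theorem multEq_iff (he : IsBasicIdempotents e) [Module.Finite A X] {j : Fin n} {k : ℕ} :
    MultEq A X (E e j) k ↔ idemLength R e j X = k * idemLength R e j (E e j) := by
  have : IsArtinianRing A := IsArtinianRing.of_finite R A
  refine ⟨fun h => h.idemLength_eq R he, fun h => ?_⟩
  obtain ⟨s, h0, h1⟩ := (isFiniteLength_iff_exists_compositionSeries (R := A) (M := X)).1
    (isFiniteLength_of_finite X)
  have h2 : MultEq A X (E e j) _ := ⟨s, h0, h1, rfl⟩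
  have h3 := h2.idemLength_eq R he
  rw [h] at h3
  have h4 : idemLength R e j (E e j) ≠ 0 := by
    rw [Ne, idemLength_eq_zero_iff]
    push Not
    exact he.smul_E_ne_zero j
  have := IsBasicIdempotents.finite (e := e) j
  have h5 : idemLength R e j (E e j) ≠ ⊤ := idemLength_ne_top R j
  obtain ⟨c, hc⟩ := ENat.ne_top_iff_exists.1 h5
  rw [← hc] at h3 h4
  have h6 := Nat.eq_of_mul_eq_mul_right (Nat.pos_of_ne_zero (by exact_mod_cast h4))
    (by exact_mod_cast h3)
  rw [h6]
  exact h2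

end

theorem multEq_zero_iff (R : Type u) {A : Type u} [CommRing R] [IsArtinianRing R] [Ring A]
    [Algebra R A] [Module.Finite R A] {n : ℕ} {e : Fin n → A} (he : IsBasicIdempotents e)
    {X : Type u} [AddCommGroup X] [Module A X] [Module.Finite A X] {j : Fin n} :
    MultEq A X (E e j) 0 ↔ ∀ x : X, e j • x = 0 := by
  let _ : Module R X := Module.compHom X (algebraMap R A)
  have : IsScalarTower R A X := ⟨fun r a x => by
    rw [Algebra.smul_def, mul_smul]
    rfl⟩
  rw [multEq_iff R he, ← idemLength_eq_zero_iff R]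
  simp

end GoodFilt

namespace GoodFilt
open CategoryTheory Abelian

/-! ### Matlis duality for a commutative Artinian ring -/

section

variable {R J : Type u} [CommRing R] [IsArtinianRing R] [AddCommGroup J] [Module R J]

omit [IsArtinianRing R] in
theorem smul_quotient_eq_zero {m : Ideal R} {r : R} (hr : r ∈ m) (x : R ⧸ m) : r • x = 0 := by
  obtain ⟨s, rfl⟩ := Ideal.Quotient.mk_surjective x
  rw [Algebra.smul_def, Ideal.Quotient.algebraMap_eq, ← map_mul, Ideal.Quotient.eq_zero_iff_mem]
  exact m.mul_mem_right _ hr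

omit [IsArtinianRing R] in
/-- The `m`-torsion of an essential extension of `M` lies in `M`. -/
theorem mem_range_of_essential {M : Type u} [AddCommGroup M] [Module R M] {ι : M →ₗ[R] J}
    (hess : ∀ U : Submodule R J, U ⊓ LinearMap.range ι = ⊥ → U = ⊥) {m : Ideal R}
    (hm : m.IsMaximal) {x : J} (hx : ∀ r ∈ m, r • x = 0) : x ∈ LinearMap.range ι := by
  rcases eq_or_ne x 0 with rfl | hx0
  · exact zero_mem _
  have h1 : Submodule.span R {x} ⊓ LinearMap.range ι ≠ ⊥ := fun h => by
    have := hess _ h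
    rw [Submodule.span_singleton_eq_bot] at this
    exact hx0 this
  obtain ⟨z, ⟨hz1, hz2⟩, hz0⟩ := Submodule.exists_mem_ne_zero_of_ne_bot h1
  obtain ⟨r, rfl⟩ := Submodule.mem_span_singleton.1 hz1
  have hr : r ∉ m := fun h => hz0 (hx r h)
  obtain ⟨s, hs⟩ := hm.exists_inv hr
  obtain ⟨t, ht, hst⟩ := hs
  have h2 : x = s • r • x := by
    conv_lhs => rw [← one_smul R x, ← hst, add_smul, hx t ht, add_zero, mul_smul]
  rw [h2]
  exact Submodule.smul_mem _ _ hz2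

/-- A map from `R/m` is determined by an `m`-torsion element of `J`. By essentiality this element
lies in `R/rad R`, and its residue in `R/m` still determines it. -/
theorem length_hom_quotient_le (hJ : IsInjEnvelope R (R ⧸ Ring.jacobson R) J) (m : Ideal R)
    (hm : m.IsMaximal) : Module.length R ((R ⧸ m) →ₗ[R] J) ≤ 1 := by
  obtain ⟨-, ι, hι, hess⟩ := hJ
  have hle : Ring.jacobson R ≤ m := by
    rw [← Ideal.jacobson_bot]
    exact sInf_le ⟨bot_le, hm⟩
  have hkill : ∀ (f : (R ⧸ m) →ₗ[R] J), ∀ r ∈ m, r • f 1 = 0 := by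
    intro f r hr
    rw [← map_smul, smul_quotient_eq_zero hr, map_zero]
  let F : ((R ⧸ m) →ₗ[R] J) →ₗ[R] (R ⧸ m) :=
    (Submodule.mapQ (Ring.jacobson R) m LinearMap.id hle ∘ₗ
      (LinearEquiv.ofInjective ι hι).symm.toLinearMap) ∘ₗ
      (LinearMap.applyₗ (1 : R ⧸ m)).codRestrict (LinearMap.range ι) fun f =>
        mem_range_of_essential hess hm (hkill f)
  have hF : Function.Injective F := by
    rw [← LinearMap.ker_eq_bot, LinearMap.ker_eq_bot']
    intro f hf
    obtain ⟨y, hy⟩ := mem_range_of_essential hess hm (hkill f)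
    have h1 : F f = Submodule.mapQ (Ring.jacobson R) m LinearMap.id hle y := by
      change Submodule.mapQ (Ring.jacobson R) m LinearMap.id hle
        ((LinearEquiv.ofInjective ι hι).symm _) = _
      congr 1
      rw [LinearEquiv.symm_apply_eq]
      exact Subtype.ext hy.symm
    obtain ⟨r, rfl⟩ := Submodule.mkQ_surjective _ y
    rw [h1, Submodule.mkQ_apply, Submodule.mapQ_apply, LinearMap.id_apply,
      Submodule.Quotient.mk_eq_zero] at hf
    -- `f 1` is the class of `r`, and `r ∈ m` kills it, so `r²` lies in the Jacobson radical. That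
    -- ideal is the nilradical, so it contains `r`, and `f 1 = 0`.
    have h2 := hkill f r hf
    rw [← hy, ← map_smul, ← map_zero ι] at h2
    have h3 := hι h2
    rw [← map_smul, Submodule.mkQ_apply, Submodule.Quotient.mk_eq_zero, smul_eq_mul,
      ← Ideal.jacobson_bot, IsArtinianRing.jacobson_eq_radical] at h3
    have h4 : r ∈ Ring.jacobson R := by
      rw [← Ideal.jacobson_bot, IsArtinianRing.jacobson_eq_radical]
      obtain ⟨k, hk⟩ := h3
      exact ⟨2 * k, by rw [pow_mul, pow_two]; exact hk⟩
    have h5 : f 1 = 0 := by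
      rw [← hy, Submodule.mkQ_apply, (Submodule.Quotient.mk_eq_zero _).2 h4, map_zero]
    ext
    exact h5
  have : IsSimpleModule R (R ⧸ m) := isSimpleModule_iff_isCoatom.2 hm.out
  exact (Module.length_le_of_injective F hF).trans (Module.length_eq_one R (R ⧸ m)).le

omit [IsArtinianRing R] in
theorem length_le_add_of_exact {X Y Z : Type*} [AddCommGroup X] [Module R X] [AddCommGroup Y]
    [Module R Y] [AddCommGroup Z] [Module R Z] (f : X →ₗ[R] Y) (g : Y →ₗ[R] Z)
    (h : LinearMap.ker g ≤ LinearMap.range f) :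
    Module.length R Y ≤ Module.length R X + Module.length R Z := by
  rw [Module.length_eq_add_of_exact (LinearMap.ker g).subtype g.rangeRestrict
    (Submodule.injective_subtype _) g.surjective_rangeRestrict
    (by rw [LinearMap.exact_iff, Submodule.range_subtype, LinearMap.ker_rangeRestrict])]
  exact add_le_add ((Module.length_le_of_injective _ (Submodule.inclusion_injective h)).trans
    (Module.length_le_of_surjective _ f.surjective_rangeRestrict))
    (Module.length_le_of_injective _ (Submodule.injective_subtype _))

/-- Left exactness of Hom and the simple case suffice, since only the inequality is wanted. -/
theorem length_hom_le (hJ : IsInjEnvelope R (R ⧸ Ring.jacobson R) J) {X : Type v}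
    [AddCommGroup X] [Module R X] (hX : IsFiniteLength R X) :
    Module.length R (X →ₗ[R] J) ≤ Module.length R X := by
  induction hX with
  | of_subsingleton => exact (Module.length_eq_zero_iff.2 inferInstance).le.trans (zero_le)
  | @of_simple_quotient M _ _ N _ _ ih =>
    rw [Module.length_eq_add_of_exact N.subtype N.mkQ N.injective_subtype N.mkQ_surjective
      (by rw [LinearMap.exact_iff, Submodule.ker_mkQ, Submodule.range_subtype]),
      Module.length_eq_one R (M ⧸ N), add_comm]
    obtain ⟨m, hm, ⟨φ⟩⟩ := isSimpleModule_iff_quot_maximal.1 ‹IsSimpleModule R (M ⧸ N)›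
    have h1 : Module.length R ((M ⧸ N) →ₗ[R] J) ≤ 1 :=
      (LinearEquiv.length_eq (LinearEquiv.congrLeft J R φ)).le.trans
        (length_hom_quotient_le hJ m hm)
    refine (length_le_add_of_exact (LinearMap.lcomp R J N.mkQ) (LinearMap.lcomp R J N.subtype)
      ?_).trans (add_le_add h1 ih)
    intro f hf
    refine ⟨N.liftQ f fun x hx => LinearMap.congr_fun hf ⟨x, hx⟩, ?_⟩
    ext x
    rfl

/-- `R/rad R` is semisimple, so its quotient `R/m` is isomorphic to a submodule of it. -/
theorem exists_hom_quotient_injective (hJ : IsInjEnvelope R (R ⧸ Ring.jacobson R) J) (m : Ideal R)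
    (hm : m.IsMaximal) : ∃ f : (R ⧸ m) →ₗ[R] J, Function.Injective f := by
  obtain ⟨-, ι, hι, -⟩ := hJ
  have hle : Ring.jacobson R ≤ m := by
    rw [← Ideal.jacobson_bot]
    exact sInf_le ⟨bot_le, hm⟩
  have : IsSemisimpleModule R (R ⧸ Ring.jacobson R) :=
    (IsArtinian.isSemisimpleModule_iff_jacobson _ _).2 (Module.jacobson_quotient_jacobson R R)
  let φ := Submodule.mapQ (Ring.jacobson R) m LinearMap.id hle
  have hφ : Function.Surjective φ := by
    intro y
    obtain ⟨r, rfl⟩ := Submodule.mkQ_surjective _ y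
    exact ⟨Submodule.Quotient.mk r, rfl⟩
  obtain ⟨C, hC⟩ := exists_isCompl (LinearMap.ker φ)
  exact ⟨ι ∘ₗ C.subtype ∘ₗ ((φ.quotKerEquivOfSurjective hφ).symm.trans
    (Submodule.quotientEquivOfIsCompl _ _ hC)).toLinearMap,
    hι.comp (C.injective_subtype.comp (LinearEquiv.injective _))⟩

/-- Map the cyclic module on `x` to a simple quotient, embed that into `J`, and extend by
injectivity. -/
theorem exists_hom_ne_zero (hJ : IsInjEnvelope R (R ⧸ Ring.jacobson R) J) {X : Type u}
    [AddCommGroup X] [Module R X] {x : X} (hx : x ≠ 0) : ∃ f : X →ₗ[R] J, f x ≠ 0 := by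
  let S := Submodule.span R {x}
  let x' : S := ⟨x, Submodule.mem_span_singleton_self x⟩
  have : Nontrivial S := ⟨x', 0, fun h => hx (congrArg Subtype.val h)⟩
  have : Module.Finite R S := Module.Finite.span_singleton R x
  obtain ⟨N, hN⟩ := IsCoatomic.exists_coatom (Submodule R S)
  have : IsSimpleModule R (S ⧸ N) := isSimpleModule_iff_isCoatom.2 hN
  obtain ⟨m, hm, ⟨φ⟩⟩ := isSimpleModule_iff_quot_maximal.1 ‹IsSimpleModule R (S ⧸ N)›
  obtain ⟨f, hf⟩ := exists_hom_quotient_injective hJ m hm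
  obtain ⟨h, hh⟩ := hJ.1.out S.subtype S.injective_subtype (f ∘ₗ φ.toLinearMap ∘ₗ N.mkQ)
  refine ⟨h, fun h0 => hN.1 ?_⟩
  have h1 : N.mkQ x' = 0 := φ.injective (hf (by
    rw [map_zero, map_zero, ← h0]
    exact (hh x').symm))
  rw [Submodule.mkQ_apply, Submodule.Quotient.mk_eq_zero] at h1
  rw [eq_top_iff]
  rintro ⟨y, hy⟩ -
  obtain ⟨r, rfl⟩ := Submodule.mem_span_singleton.1 hy
  exact N.smul_mem r h1

end

end GoodFilt

namespace GoodFilt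
open CategoryTheory Abelian

noncomputable section

/-! ### The dual of the regular module and its indecomposable summands -/

section

variable {R A J : Type u} [CommRing R] [Ring A] [Algebra R A] [AddCommGroup J] [Module R J]

instance DReg.instModuleBase : Module R (DReg R A J) := inferInstanceAs (Module R (A →ₗ[R] J))

/-- The value of an element of `D(A)` at an element of `A`. -/
def DReg.app (f : DReg R A J) : A →ₗ[R] J := f

theorem DReg.ext_app {f g : DReg R A J} (h : ∀ x, f.app x = g.app x) : f = g := LinearMap.ext h

theorem DReg.app_smul (a : A) (f : DReg R A J) (x : A) : (a • f).app x = f.app (x * a) := rfl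

theorem DReg.app_add (f g : DReg R A J) (x : A) : (f + g).app x = f.app x + g.app x := rfl

theorem DReg.app_base_smul (r : R) (f : DReg R A J) (x : A) : (r • f).app x = r • f.app x := rfl

theorem DReg.app_zero (x : A) : (0 : DReg R A J).app x = 0 := rfl

instance DReg.instIsScalarTower : IsScalarTower R A (DReg R A J) :=
  ⟨fun r a f => DReg.ext_app fun x => by
    rw [DReg.app_smul, DReg.app_base_smul, DReg.app_smul, mul_smul_comm, map_smul]⟩

variable {M : Type u} [AddCommGroup M] [Module A M] [Module R M] [IsScalarTower R A M]

/-- The `A`-linear map `M → D(A)` given by a functional on `M`. -/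
def coind (l : M →ₗ[R] J) : M →ₗ[A] DReg R A J where
  toFun m :=
    { toFun := fun a => l (a • m)
      map_add' := fun a b => by rw [add_smul, map_add]
      map_smul' := fun r a => by rw [smul_assoc, map_smul]; rfl }
  map_add' x y := DReg.ext_app fun a => (congrArg l (smul_add a x y)).trans (map_add l _ _)
  map_smul' b x := DReg.ext_app fun a => congrArg l (smul_smul a b x)

theorem coind_app (l : M →ₗ[R] J) (m : M) (a : A) : (coind l m).app a = l (a • m) := rfl

omit [Module R M] [IsScalarTower R A M] in
theorem hom_app_eq (g : M →ₗ[A] DReg R A J) (m : M) (a : A) :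
    (g m).app a = (g (a • m)).app 1 := by
  rw [map_smul, DReg.app_smul, one_mul]

/-- Evaluation at `1` identifies `A`-linear maps `X → D(A)` with `R`-linear maps `X → J`, so
extension problems reduce to `J`. -/
theorem injective_DReg [Module.Injective R J] : Module.Injective A (DReg R A J) := by
  refine ⟨fun X Y _ _ _ _ f hf g => ?_⟩
  let _ : Module R X := Module.compHom X (algebraMap R A)
  have hX : ∀ (r : R) (x : X), r • x = algebraMap R A r • x := fun _ _ => rfl
  let _ : Module R Y := Module.compHom Y (algebraMap R A)
  have hY : ∀ (r : R) (x : Y), r • x = algebraMap R A r • x := fun _ _ => rfl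
  have : IsScalarTower R A X := ⟨fun r a x => by rw [Algebra.smul_def, mul_smul, hX]⟩
  have : IsScalarTower R A Y := ⟨fun r a x => by rw [Algebra.smul_def, mul_smul, hY]⟩
  let l : X →ₗ[R] J :=
    { toFun := fun x => (g x).app 1
      map_add' := fun x y => by rw [map_add, DReg.app_add]
      map_smul' := fun r x => by
        rw [hX, map_smul, DReg.app_smul, one_mul, ← mul_one (algebraMap R A r),
          ← Algebra.smul_def, map_smul]
        rfl }
  obtain ⟨l', hl'⟩ := Module.Injective.out (f.restrictScalars R) hf l
  refine ⟨coind l', fun x => DReg.ext_app fun a => ?_⟩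
  rw [coind_app, hom_app_eq g, ← map_smul]
  exact hl' (a • x)

theorem Module.Injective.of_retract {X Y : Type u} [AddCommGroup X] [Module A X] [AddCommGroup Y]
    [Module A Y] (i : X →ₗ[A] Y) (p : Y →ₗ[A] X) (hip : p ∘ₗ i = LinearMap.id)
    (hY : Module.Injective A Y) : Module.Injective A X := by
  refine ⟨fun X' Y' _ _ _ _ f hf g => ?_⟩
  obtain ⟨h, hh⟩ := hY.out f hf (i ∘ₗ g)
  refine ⟨p ∘ₗ h, fun x => ?_⟩
  rw [LinearMap.comp_apply, hh]
  exact LinearMap.congr_fun hip (g x)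

variable {n : ℕ} {e : Fin n → A}

theorem mem_I_iff {i : Fin n} {f : DReg R A J} :
    f ∈ I e R J i ↔ ∀ x, f.app (e i * x) = f.app x := Iff.rfl

/-- The projection of `D(A)` onto its summand `I(i)`. -/
def projI (he : IsBasicIdempotents e) (i : Fin n) : DReg R A J →ₗ[A] I e R J i where
  toFun f := ⟨(f.app ∘ₗ LinearMap.mulLeft R (e i) : A →ₗ[R] J), fun x => by
    change f.app (e i * (e i * x)) = f.app (e i * x)
    rw [← mul_assoc, he.idem]⟩
  map_add' _ _ := rfl
  map_smul' a f := Subtype.ext (DReg.ext_app fun x => by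
    change f.app (e i * x * a) = f.app (e i * (x * a))
    rw [mul_assoc])

theorem projI_app (he : IsBasicIdempotents e) (i : Fin n) (f : DReg R A J) (x : A) :
    (projI he i f : DReg R A J).app x = f.app (e i * x) := rfl

theorem projI_comp_subtype (he : IsBasicIdempotents e) (i : Fin n) :
    projI he i ∘ₗ (I e R J i).subtype = LinearMap.id :=
  LinearMap.ext fun f => Subtype.ext (DReg.ext_app fun x => f.2 x)

theorem injective_I [Module.Injective R J] (he : IsBasicIdempotents e) (i : Fin n) :
    Module.Injective A (I e R J i) :=
  Module.Injective.of_retract _ _ (projI_comp_subtype he i) injective_DReg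

omit [Module R M] [IsScalarTower R A M] in
-- A map into `I(i)` is determined by the functional it induces on `e_i M` through evaluation at
-- `1`.
theorem hom_I_app_eq {i : Fin n} (g : M →ₗ[A] I e R J i) (m : M) (a : A) :
    (g m : DReg R A J).app a = (g (e i • a • m) : DReg R A J).app 1 := by
  rw [← mem_I_iff.1 (g m).2 a, smul_smul]
  exact hom_app_eq ((I e R J i).subtype ∘ₗ g) m (e i * a)

omit [Module R M] [IsScalarTower R A M] in
theorem hom_I_eq_zero {i : Fin n} (g : M →ₗ[A] I e R J i) (hM : ∀ x : M, e i • x = 0) : g = 0 :=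
  LinearMap.ext fun m => Subtype.ext (DReg.ext_app fun a => by
    rw [hom_I_app_eq, hM, map_zero]
    rfl)

variable [IsArtinianRing R]

theorem exists_hom_I_ne_zero (hJ : IsInjEnvelope R (R ⧸ Ring.jacobson R) J)
    (he : IsBasicIdempotents e) {i : Fin n} {x : M} (hx : e i • x ≠ 0) :
    ∃ g : M →ₗ[A] I e R J i, g x ≠ 0 := by
  obtain ⟨l, hl⟩ := exists_hom_ne_zero hJ hx
  refine ⟨projI he i ∘ₗ coind l, fun h => hl ?_⟩
  have h1 := congrArg (fun f : I e R J i => (f : DReg R A J).app 1) h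
  change (projI he i (coind l x) : DReg R A J).app 1 = 0 at h1
  rwa [projI_app, coind_app, mul_one] at h1

theorem exists_hom_DReg_ne_zero (hJ : IsInjEnvelope R (R ⧸ Ring.jacobson R) J) {x : M}
    (hx : x ≠ 0) : ∃ g : M →ₗ[A] DReg R A J, g x ≠ 0 := by
  obtain ⟨l, hl⟩ := exists_hom_ne_zero hJ hx
  refine ⟨coind l, fun h => hl ?_⟩
  have h1 : (coind l x : DReg R A J).app 1 = 0 := by rw [h, DReg.app_zero]
  rwa [coind_app, one_smul] at h1

variable [Module.Finite R A]

theorem isFiniteLength_of_finite_base (M : Type v) [AddCommGroup M] [Module R M]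
    [Module.Finite R M] : IsFiniteLength R M :=
  isFiniteLength_iff_isNoetherian_isArtinian.2 ⟨inferInstance, inferInstance⟩

theorem finite_DReg (hJ : IsInjEnvelope R (R ⧸ Ring.jacobson R) J) :
    Module.Finite A (DReg R A J) := by
  have h1 : Module.length R (A →ₗ[R] J) ≠ ⊤ :=
    ne_top_of_le_ne_top Module.length_ne_top
      (length_hom_le hJ (isFiniteLength_of_finite_base (R := R) A))
  have h2 := isFiniteLength_iff_isNoetherian_isArtinian.1 (Module.length_ne_top_iff.1 h1)
  have h3 : IsNoetherian R (DReg R A J) := h2.1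
  exact Module.Finite.of_restrictScalars_finite R A _

/-- A finitely generated module embeds into a finite power of any module that separates its
points. -/
theorem exists_injective_pi {A : Type u} [Ring A] {X Q : Type u} [AddCommGroup X] [Module A X]
    [IsArtinian A X] [AddCommGroup Q] [Module A Q]
    (h : ∀ x : X, x ≠ 0 → ∃ f : X →ₗ[A] Q, f x ≠ 0) :
    ∃ (m : ℕ) (φ : X →ₗ[A] (Fin m → Q)), Function.Injective φ := by
  obtain ⟨K, ⟨m, φ, rfl⟩, hmin⟩ := WellFounded.has_min
    (wellFounded_lt : WellFounded ((· < ·) : Submodule A X → Submodule A X → Prop))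
    {K | ∃ (m : ℕ) (φ : X →ₗ[A] (Fin m → Q)), K = LinearMap.ker φ} ⟨_, 0, 0, rfl⟩
  refine ⟨m, φ, LinearMap.ker_eq_bot.1 ?_⟩
  by_contra hne
  obtain ⟨x, hx, hx0⟩ := Submodule.exists_mem_ne_zero_of_ne_bot hne
  obtain ⟨f, hf⟩ := h x hx0
  let ψ : X →ₗ[A] (Fin (m + 1) → Q) := LinearMap.pi (Fin.cons f fun j => LinearMap.proj j ∘ₗ φ)
  refine hmin (LinearMap.ker ψ) ⟨_, _, rfl⟩ (lt_of_le_of_ne ?_ ?_)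
  · intro y hy
    ext j
    exact congrFun (LinearMap.mem_ker.1 hy) j.succ
  · intro heq
    rw [← heq] at hx
    exact hf (congrFun (LinearMap.mem_ker.1 hx) 0)

theorem length_hom_I_le (hJ : IsInjEnvelope R (R ⧸ Ring.jacobson R) J) [Module.Finite A M]
    (i : Fin n) : Module.length R (M →ₗ[A] I e R J i) ≤ idemLength R e i M := by
  have : Module.Finite R M := Module.Finite.trans A M
  let G : (M →ₗ[A] I e R J i) →ₗ[R]
      (LinearMap.range (Algebra.lsmul R R M (e i)) →ₗ[R] J) :=
    { toFun := fun g =>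
        { toFun := fun y => (g y : DReg R A J).app 1
          map_add' := fun x y => by rw [Submodule.coe_add, map_add]; rfl
          map_smul' := fun r x => by
            rw [Submodule.coe_smul, LinearMap.map_smul_of_tower]; rfl }
      map_add' := fun _ _ => rfl
      map_smul' := fun _ _ => rfl }
  have hG : Function.Injective G := by
    rw [← LinearMap.ker_eq_bot, LinearMap.ker_eq_bot']
    intro g hg
    refine LinearMap.ext fun m => Subtype.ext (DReg.ext_app fun a => ?_)
    rw [hom_I_app_eq]
    exact LinearMap.congr_fun hg ⟨e i • a • m, a • m, rfl⟩
  exact (Module.length_le_of_injective G hG).trans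
    (length_hom_le hJ (isFiniteLength_of_finite_base _))

theorem idemLength_E_le (he : IsBasicIdempotents e) (i : Fin n) :
    idemLength R e i (E e i) ≤ Module.length R (E e i →ₗ[A] E e i) := by
  have : IsArtinianRing A := IsArtinianRing.of_finite R A
  have := he.isSimpleModule_E i
  let x₀ : E e i := Submodule.Quotient.mk (gen e i)
  have hx₀ : e i • x₀ = x₀ := by
    rw [← Submodule.Quotient.mk_smul, he.idem_smul_gen]
  let F : (E e i →ₗ[A] E e i) →ₗ[R] LinearMap.range (Algebra.lsmul R R (E e i) (e i)) :=
    { toFun := fun φ => ⟨φ x₀, φ x₀, by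
        change e i • φ x₀ = φ x₀
        rw [← map_smul, hx₀]⟩
      map_add' := fun _ _ => rfl
      map_smul' := fun _ _ => rfl }
  refine Module.length_le_of_surjective F ?_
  rintro ⟨_, y, rfl⟩
  by_cases hy : e i • y = 0
  · refine ⟨0, Subtype.ext ?_⟩
    exact hy.symm
  · refine ⟨(Module.jacobson A (P e i)).liftQ (liftP e i y) (he.ker_liftP hy).2.ge, Subtype.ext ?_⟩
    rfl

/-- Composition with `s` embeds `End(E(i))` into `Hom(E(i), I(i))`. Both lengths are finite and the
target is no longer than the source, being bounded by the length of `e_i E(i)`; so the embedding is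
onto. Hence `I(i)` contains `E(i)` in only one way. -/
theorem exists_comp_eq (hJ : IsInjEnvelope R (R ⧸ Ring.jacobson R) J)
    (he : IsBasicIdempotents e) {i : Fin n} (s : E e i →ₗ[A] I e R J i)
    (hs : Function.Injective s) (t : E e i →ₗ[A] I e R J i) :
    ∃ φ : E e i →ₗ[A] E e i, s ∘ₗ φ = t := by
  have := IsBasicIdempotents.finite (e := e) i
  let F : (E e i →ₗ[A] E e i) →ₗ[R] (E e i →ₗ[A] I e R J i) :=
    { toFun := fun φ => s ∘ₗ φ
      map_add' := fun φ ψ => LinearMap.comp_add φ ψ s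
      map_smul' := fun r φ => LinearMap.ext fun x => LinearMap.map_smul_of_tower s r (φ x) }
  have hF : Function.Injective F := fun φ ψ h => LinearMap.ext fun x =>
    hs (LinearMap.congr_fun h x)
  have h1 : Module.length R (E e i →ₗ[A] I e R J i) ≤ Module.length R (E e i →ₗ[A] E e i) :=
    (length_hom_I_le hJ i).trans (idemLength_E_le he i)
  have h2 : Module.length R (E e i →ₗ[A] E e i) ≠ ⊤ :=
    ne_top_of_le_ne_top (idemLength_ne_top R (X := E e i) i)
      ((Module.length_le_of_injective F hF).trans (length_hom_I_le hJ i))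
  have h3 := Module.length_eq_add_of_exact F (LinearMap.range F).mkQ hF
    (Submodule.mkQ_surjective _) (by rw [LinearMap.exact_iff, Submodule.ker_mkQ])
  have h4 : Module.length R ((E e i →ₗ[A] I e R J i) ⧸ LinearMap.range F) = 0 := by
    rw [h3] at h1
    have h5 : Module.length R (E e i →ₗ[A] E e i) +
        Module.length R ((E e i →ₗ[A] I e R J i) ⧸ LinearMap.range F) ≤
        Module.length R (E e i →ₗ[A] E e i) + 0 := by rwa [add_zero]
    exact nonpos_iff_eq_zero.1 ((ENat.add_le_add_iff_left h2).1 h5)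
  rw [Module.length_eq_zero_iff, Submodule.Quotient.subsingleton_iff] at h4
  exact LinearMap.range_eq_top.1 h4 t

/-- `E(i)` is the essential socle of `I(i)`. -/
theorem exists_socle_I (hJ : IsInjEnvelope R (R ⧸ Ring.jacobson R) J)
    (he : IsBasicIdempotents e) (i : Fin n) :
    ∃ s : E e i →ₗ[A] I e R J i, Function.Injective s ∧
      ∀ N : Submodule A (I e R J i), N.comap s = ⊥ → N = ⊥ := by
  have : IsArtinianRing A := IsArtinianRing.of_finite R A
  have := finite_DReg (A := A) hJ
  have := he.isSimpleModule_E i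
  obtain ⟨x, hx⟩ := he.smul_E_ne_zero i
  obtain ⟨s, hs⟩ := exists_hom_I_ne_zero (M := E e i) hJ he hx
  have hs0 : s ≠ 0 := fun h => hs (by rw [h]; rfl)
  have hinj := LinearMap.injective_of_ne_zero hs0
  refine ⟨s, hinj, fun N hN => ?_⟩
  by_contra hne
  obtain ⟨S, hS, hSN⟩ := (IsAtomic.eq_bot_or_exists_atom_le N).resolve_left hne
  have : IsSimpleModule A S := isSimpleModule_iff_isAtom.2 hS
  have hS' : ∃ y : S, e i • y ≠ 0 := by
    by_contra! h
    have h1 := hom_I_eq_zero S.subtype h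
    exact hS.1 (by rw [← Submodule.range_subtype S, h1, LinearMap.range_zero])
  obtain ⟨y, hy⟩ := hS'
  obtain ⟨ψ⟩ := he.nonempty_equiv_E (M := S) hy
  -- A minimal submodule of `N` is a copy of `E(i)`, so its inclusion factors through `s` and `N`
  -- meets the socle nontrivially.
  obtain ⟨φ, hφ⟩ := exists_comp_eq hJ he s hinj (S.subtype ∘ₗ ψ.toLinearMap)
  have h1 : φ x ∈ N.comap s := by
    have h2 : s (φ x) = ψ x := LinearMap.congr_fun hφ x
    rw [Submodule.mem_comap, h2]
    exact hSN (ψ x).2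
  rw [hN, Submodule.mem_bot] at h1
  have h2 : ((ψ x : S) : I e R J i) = 0 := by
    have h3 : s (φ x) = ψ x := LinearMap.congr_fun hφ x
    rw [← h3, h1, map_zero]
  have h3 : x = 0 := ψ.injective (by rw [map_zero]; exact Subtype.ext h2)
  exact hx (by rw [h3, smul_zero])

end

end

end GoodFilt

namespace GoodFilt
open CategoryTheory Abelian

noncomputable section

/-! ### Standard and proper standard modules -/

theorem hom_P_eq_zero {A : Type u} [Ring A] {n : ℕ} {e : Fin n → A} (he : IsBasicIdempotents e)
    (i : Fin n) {M : Type u} [AddCommGroup M] [Module A M] (hM : ∀ x : M, e i • x = 0) :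
    ExtVanish A 0 (P e i) M := by
  rw [ExtVanish.zero_iff]
  intro φ
  ext y
  rw [he.map_eq, ← he.idem_smul_gen, map_smul, hM, smul_zero]
  rfl

section

variable {A : Type u} [Ring A] [IsArtinianRing A] {n : ℕ} {e : Fin n → A}

instance (i : Fin n) : Module.Finite A (P e i) := IsBasicIdempotents.finite i

instance (i : Fin n) : Module.Finite A (Std e i) :=
  inferInstanceAs (Module.Finite A (P e i ⧸ stdKer e i))

instance (i : Fin n) : Module.Finite A (PStd e i) :=
  inferInstanceAs (Module.Finite A (Std e i ⧸ pstdKer e i))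

omit [IsArtinianRing A] in
theorem stdKer_le (R : Type u) [CommRing R] [IsArtinianRing R] [Algebra R A] [Module.Finite R A]
    (he : IsBasicIdempotents e) {i : Fin n} {U : Submodule A (P e i)}
    (hU : Below e (i + 1) (P e i ⧸ U)) : stdKer e i ≤ U :=
  sInf_le fun j hj => (multEq_zero_iff R he).2 (hU j hj)

omit [IsArtinianRing A] in
theorem below_std (R : Type u) [CommRing R] [IsArtinianRing R] [Algebra R A] [Module.Finite R A]
    (he : IsBasicIdempotents e) (i : Fin n) : Below e (i + 1) (Std e i) := by
  intro j hj x
  obtain ⟨y, rfl⟩ := Submodule.mkQ_surjective _ x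
  rw [← map_smul, Submodule.mkQ_apply, Submodule.Quotient.mk_eq_zero, stdKer, Submodule.mem_sInf]
  intro U hU
  rw [← Submodule.Quotient.mk_eq_zero U, Submodule.Quotient.mk_smul]
  exact (multEq_zero_iff R he).1 (hU j hj) _

omit [IsArtinianRing A] in
-- Dividing `P(i)` by the kernel of such a map only would again give a module without factors of
-- index above `i`, so by minimality of `stdKer` that kernel is everything.
theorem hom_stdKer (R : Type u) [CommRing R] [IsArtinianRing R] [Algebra R A] [Module.Finite R A]
    (he : IsBasicIdempotents e) (i : Fin n) {M : Type u} [AddCommGroup M] [Module A M]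
    (hM : Below e (i + 1) M) : ExtVanish A 0 (stdKer e i) M := by
  rw [ExtVanish.zero_iff]
  intro φ
  have h1 : Below e (i + 1) (stdKer e i ⧸ LinearMap.ker φ) :=
    hM.of_injective ((LinearMap.ker φ).liftQ φ le_rfl)
      (LinearMap.ker_eq_bot.1 (Submodule.ker_liftQ_eq_bot _ _ _ le_rfl))
  have h2 := stdKer_le R he (Below.of_ses he
    ((Ses.of_submodule (stdKer e i)).quotient (LinearMap.ker φ)) h1 (below_std R he i))
  ext x
  obtain ⟨y, hy, hyx⟩ := h2 x.2
  rw [← show y = x from Subtype.ext hyx]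
  exact hy

omit [IsArtinianRing A] in
theorem ext_std (R : Type u) [CommRing R] [IsArtinianRing R] [Algebra R A] [Module.Finite R A]
    (he : IsBasicIdempotents e) (i : Fin n) {M : Type u} [AddCommGroup M] [Module A M]
    (hM : Below e (i + 1) M) : ExtVanish A 1 (Std e i) M := by
  have := he.projective i
  exact .quot_left (Ses.of_submodule (stdKer e i)) (hom_stdKer R he i hM) .of_projective

omit [IsArtinianRing A] in
theorem hom_std (he : IsBasicIdempotents e) (i : Fin n) {M : Type u} [AddCommGroup M] [Module A M]
    (hM : Below e i M) : ExtVanish A 0 (Std e i) M :=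
  (hom_P_eq_zero he i (hM i le_rfl)).zero_of_surjective (g := (stdKer e i).mkQ)
    (Submodule.mkQ_surjective _)

theorem stdKer_le_jacobson (R : Type u) [CommRing R] [IsArtinianRing R] [Algebra R A]
    [Module.Finite R A] (he : IsBasicIdempotents e) (i : Fin n) :
    stdKer e i ≤ Module.jacobson A (P e i) :=
  stdKer_le R he (he.below_E (Nat.lt_succ_self i))

/-- The projection of `Δ(i)` onto its top. -/
def topStd (R : Type u) [CommRing R] [IsArtinianRing R] [Algebra R A]
    [Module.Finite R A] (he : IsBasicIdempotents e) (i : Fin n) : Std e i →ₗ[A] E e i :=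
  Submodule.mapQ _ _ LinearMap.id (stdKer_le_jacobson R he i)

theorem topStd_surjective (R : Type u) [CommRing R] [IsArtinianRing R] [Algebra R A]
    [Module.Finite R A] (he : IsBasicIdempotents e) (i : Fin n) :
    Function.Surjective (topStd R he i) := by
  intro y
  obtain ⟨x, rfl⟩ := Submodule.mkQ_surjective _ y
  exact ⟨Submodule.Quotient.mk x, rfl⟩

theorem topStd_superfluous (R : Type u) [CommRing R] [IsArtinianRing R] [Algebra R A]
    [Module.Finite R A] (he : IsBasicIdempotents e) (i : Fin n) (N : Submodule A (Std e i))
    (hN : N.map (topStd R he i) = ⊤) : N = ⊤ := by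
  have h1 : N.comap (stdKer e i).mkQ = ⊤ := by
    by_contra h
    have h2 := he.le_jacobson h
    obtain ⟨x, hx⟩ := he.smul_E_ne_zero i
    obtain ⟨z, hz, rfl⟩ : x ∈ N.map (topStd R he i) := by rw [hN]; trivial
    obtain ⟨y, rfl⟩ := Submodule.mkQ_surjective _ z
    apply hx
    have h3 : topStd R he i ((stdKer e i).mkQ y) = 0 :=
      (Submodule.Quotient.mk_eq_zero _).2 (h2 hz)
    rw [h3, smul_zero]
  rw [eq_top_iff]
  intro z _
  obtain ⟨y, rfl⟩ := Submodule.mkQ_surjective _ z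
  have : y ∈ N.comap (stdKer e i).mkQ := by rw [h1]; trivial
  exact this

/-- For `U` in the radical of `Δ(i)`, the top already accounts for one `E(i)`, so `U` is admissible
exactly when it contains `e_i rad Δ(i)`. An admissible `U` outside the radical would be all of
`Δ(i)`, leaving multiplicity zero. So the infimum is attained and has explicit generators. -/
theorem pstdKer_eq (R : Type u) [CommRing R] [IsArtinianRing R] [Algebra R A]
    [Module.Finite R A] (he : IsBasicIdempotents e) (i : Fin n) :
    pstdKer e i = Submodule.span A ((fun x => e i • x) '' (LinearMap.ker (topStd R he i))) := by
  have hsimple := he.isSimpleModule_E i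
  have hfin := idemLength_ne_top R (e := e) (X := E e i) i
  have key : ∀ U : Submodule A (Std e i), U ≤ LinearMap.ker (topStd R he i) →
      (MultEq A (Std e i ⧸ U) (E e i) 1 ↔ ∀ x ∈ LinearMap.ker (topStd R he i), e i • x ∈ U) := by
    intro U hU
    have hs := Ses.of_ker (U.liftQ (topStd R he i) hU) (by
      intro y
      obtain ⟨x, rfl⟩ := topStd_surjective R he i y
      exact ⟨Submodule.Quotient.mk x, rfl⟩)
    rw [multEq_iff R he, hs.idemLength R he i, Nat.cast_one, one_mul]
    have h1 : idemLength R e i (LinearMap.ker (U.liftQ (topStd R he i) hU)) +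
        idemLength R e i (E e i) = idemLength R e i (E e i) ↔
        idemLength R e i (LinearMap.ker (U.liftQ (topStd R he i) hU)) = 0 := by
      constructor
      · intro h
        have h2 : idemLength R e i (LinearMap.ker (U.liftQ (topStd R he i) hU)) +
          idemLength R e i (E e i) ≤ 0 + idemLength R e i (E e i) := by rw [h, zero_add]
        exact nonpos_iff_eq_zero.1 ((ENat.add_le_add_iff_right hfin).1 h2)
      · intro h
        rw [h, zero_add]
    rw [h1, idemLength_eq_zero_iff]
    constructor
    · intro h x hx
      have h2 := congrArg Subtype.val (h ⟨U.mkQ x, hx⟩)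
      exact (Submodule.Quotient.mk_eq_zero U).1 h2
    · rintro h ⟨y, hy⟩
      obtain ⟨x, rfl⟩ := U.mkQ_surjective y
      exact Subtype.ext ((Submodule.Quotient.mk_eq_zero U).2 (h x hy))
  apply le_antisymm
  · refine sInf_le ((key _ ?_).2 fun x hx => Submodule.subset_span ⟨x, hx, rfl⟩)
    rw [Submodule.span_le]
    rintro _ ⟨x, hx, rfl⟩
    exact Submodule.smul_mem _ _ hx
  · refine le_sInf fun U hU => ?_
    have hle : U ≤ LinearMap.ker (topStd R he i) := by
      rcases eq_bot_or_eq_top (U.map (topStd R he i)) with h | h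
      · intro x hx
        have : topStd R he i x ∈ U.map (topStd R he i) := ⟨x, hx, rfl⟩
        rwa [h, Submodule.mem_bot] at this
      · exfalso
        have h1 := topStd_superfluous R he i U h
        subst h1
        have h2 := (multEq_iff R he).1 hU
        rw [Nat.cast_one, one_mul,
          (idemLength_eq_zero_iff R i).2 fun x => Subsingleton.elim _ _] at h2
        obtain ⟨x, hx⟩ := he.smul_E_ne_zero i
        exact hx ((idemLength_eq_zero_iff R i).1 h2.symm x)
    rw [Submodule.span_le]
    rintro _ ⟨x, hx, rfl⟩
    exact (key U hle).1 hU x hx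

theorem pstdKer_le (R : Type u) [CommRing R] [IsArtinianRing R] [Algebra R A]
    [Module.Finite R A] (he : IsBasicIdempotents e) (i : Fin n) :
    pstdKer e i ≤ LinearMap.ker (topStd R he i) := by
  rw [pstdKer_eq R he, Submodule.span_le]
  rintro _ ⟨x, hx, rfl⟩
  exact Submodule.smul_mem _ _ hx

/-- The projection of `Δ̄(i)` onto its top. -/
def topPStd (R : Type u) [CommRing R] [IsArtinianRing R] [Algebra R A]
    [Module.Finite R A] (he : IsBasicIdempotents e) (i : Fin n) : PStd e i →ₗ[A] E e i :=
  (pstdKer e i).liftQ (topStd R he i) (pstdKer_le R he i)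

theorem topPStd_surjective (R : Type u) [CommRing R] [IsArtinianRing R] [Algebra R A]
    [Module.Finite R A] (he : IsBasicIdempotents e) (i : Fin n) :
    Function.Surjective (topPStd R he i) := by
  intro y
  obtain ⟨x, rfl⟩ := topStd_surjective R he i y
  exact ⟨Submodule.Quotient.mk x, rfl⟩

theorem topPStd_superfluous (R : Type u) [CommRing R] [IsArtinianRing R] [Algebra R A]
    [Module.Finite R A] (he : IsBasicIdempotents e) (i : Fin n) (N : Submodule A (PStd e i))
    (hN : N.map (topPStd R he i) = ⊤) : N = ⊤ := by
  have h1 : N.comap (pstdKer e i).mkQ = ⊤ := by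
    apply topStd_superfluous R he i
    rw [eq_top_iff, ← hN]
    rintro _ ⟨z, hz, rfl⟩
    obtain ⟨y, rfl⟩ := Submodule.mkQ_surjective _ z
    exact ⟨y, hz, rfl⟩
  rw [eq_top_iff]
  intro z _
  obtain ⟨y, rfl⟩ := Submodule.mkQ_surjective _ z
  have : y ∈ N.comap (pstdKer e i).mkQ := by rw [h1]; trivial
  exact this

omit [IsArtinianRing A] in
theorem below_pstd (R : Type u) [CommRing R] [IsArtinianRing R] [Algebra R A] [Module.Finite R A]
    (he : IsBasicIdempotents e) (i : Fin n) : Below e (i + 1) (PStd e i) :=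
  (below_std R he i).quotient _

theorem below_ker_topPStd (R : Type u) [CommRing R] [IsArtinianRing R] [Algebra R A]
    [Module.Finite R A] (he : IsBasicIdempotents e) (i : Fin n) :
    Below e i (LinearMap.ker (topPStd R he i)) := by
  intro j hj
  rcases hj.lt_or_eq with h | h
  · exact (below_pstd R he i).submodule _ j h
  · obtain rfl : i = j := Fin.ext h
    rintro ⟨z, hz⟩
    obtain ⟨y, rfl⟩ := Submodule.mkQ_surjective _ z
    refine Subtype.ext ((Submodule.Quotient.mk_eq_zero _).2 ?_)
    rw [pstdKer_eq R he]
    exact Submodule.subset_span ⟨y, hz, rfl⟩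

/-- The module is generated by elements fixed by `e_i`, which must die in a module killed by `e_i`.
-/
theorem hom_pstdKer (R : Type u) [CommRing R] [IsArtinianRing R] [Algebra R A] [Module.Finite R A]
    (he : IsBasicIdempotents e) (i : Fin n) {M : Type u} [AddCommGroup M] [Module A M]
    (hM : ∀ x : M, e i • x = 0) : ExtVanish A 0 (pstdKer e i) M := by
  rw [ExtVanish.zero_iff]
  intro φ
  have h1 : pstdKer e i ≤ (LinearMap.ker φ).map (pstdKer e i).subtype := by
    conv_lhs => rw [pstdKer_eq R he]
    rw [Submodule.span_le]
    rintro _ ⟨x, hx, rfl⟩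
    have h2 : e i • x ∈ pstdKer e i := by
      rw [pstdKer_eq R he]
      exact Submodule.subset_span ⟨x, hx, rfl⟩
    refine ⟨⟨e i • x, h2⟩, ?_, rfl⟩
    have h3 : (⟨e i • x, h2⟩ : pstdKer e i) = e i • ⟨e i • x, h2⟩ :=
      Subtype.ext (he.smul_smul_self i x).symm
    rw [SetLike.mem_coe, LinearMap.mem_ker, h3, map_smul, hM]
  ext x
  obtain ⟨y, hy, hyx⟩ := h1 x.2
  rw [← show y = x from Subtype.ext hyx]
  exact hy

theorem ext_pstd (R : Type u) [CommRing R] [IsArtinianRing R] [Algebra R A] [Module.Finite R A]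
    (he : IsBasicIdempotents e) (i : Fin n) {M : Type u} [AddCommGroup M] [Module A M]
    (hM : Below e i M) : ExtVanish A 1 (PStd e i) M :=
  .quot_left (Ses.of_submodule (pstdKer e i)) (hom_pstdKer R he i (hM i le_rfl))
    (ext_std R he i (hM.mono (Nat.le_succ _)))

omit [IsArtinianRing A] in
theorem hom_pstd (he : IsBasicIdempotents e) (i : Fin n) {M : Type u} [AddCommGroup M]
    [Module A M] (hM : Below e i M) : ExtVanish A 0 (PStd e i) M :=
  (hom_std he i hM).zero_of_surjective (g := (pstdKer e i).mkQ) (Submodule.mkQ_surjective _)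

end

/-! ### Costandard and proper costandard modules -/

section

variable {R A J : Type u} [CommRing R] [IsArtinianRing R] [Ring A] [Algebra R A]
  [Module.Finite R A] [IsArtinianRing A] [AddCommGroup J] [Module R J] {n : ℕ} {e : Fin n → A}

theorem finite_I (hJ : IsInjEnvelope R (R ⧸ Ring.jacobson R) J) (i : Fin n) :
    Module.Finite A (I e R J i) := by
  have := finite_DReg (A := A) hJ
  infer_instance

theorem finite_costd (hJ : IsInjEnvelope R (R ⧸ Ring.jacobson R) J) (i : Fin n) :
    Module.Finite A (Costd e R J i) := by
  have := finite_I (e := e) hJ i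
  exact inferInstanceAs (Module.Finite A (costdSub e R J i))

theorem finite_pcostd (hJ : IsInjEnvelope R (R ⧸ Ring.jacobson R) J) (i : Fin n) :
    Module.Finite A (PCostd e R J i) := by
  have := finite_costd (e := e) hJ i
  exact inferInstanceAs (Module.Finite A (pcostdSub e R J i))

theorem le_costdSub (hJ : IsInjEnvelope R (R ⧸ Ring.jacobson R) J) (he : IsBasicIdempotents e)
    {i : Fin n} {U : Submodule A (I e R J i)} (hU : Below e (i + 1) U) : U ≤ costdSub e R J i := by
  have := finite_I (e := e) hJ i
  exact le_sSup fun j hj => (multEq_zero_iff R he).2 (hU j hj)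

theorem below_costd (hJ : IsInjEnvelope R (R ⧸ Ring.jacobson R) J) (he : IsBasicIdempotents e)
    (i : Fin n) : Below e (i + 1) (Costd e R J i) := by
  have := finite_I (e := e) hJ i
  intro j hj
  -- The largest submodule killed by `e_j`. It bounds every member of the supremum, so no sums of
  -- elements have to be handled.
  let W : Submodule A (I e R J i) :=
    { carrier := {x | ∀ a : A, e j • a • x = 0}
      zero_mem' := fun a => by rw [smul_zero, smul_zero]
      add_mem' := fun hx hy a => by rw [smul_add, smul_add, hx, hy, add_zero]
      smul_mem' := fun b x hx a => by rw [smul_smul a b]; exact hx (a * b) }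
  have hW : costdSub e R J i ≤ W := by
    refine sSup_le fun U hU x hx a => ?_
    exact congrArg Subtype.val ((multEq_zero_iff R he).1 (hU j hj) ⟨a • x, U.smul_mem a hx⟩)
  rintro ⟨x, hx⟩
  have := hW hx 1
  rw [one_smul] at this
  exact Subtype.ext this

/-- The preimage of the image of such a map is an extension of modules without factors of index
above `i`, hence already contained in the maximal such submodule. -/
theorem hom_quotient_costd (hJ : IsInjEnvelope R (R ⧸ Ring.jacobson R) J)
    (he : IsBasicIdempotents e) (i : Fin n) {M : Type u} [AddCommGroup M] [Module A M]
    (hM : Below e (i + 1) M) : ExtVanish A 0 M (I e R J i ⧸ costdSub e R J i) := by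
  rw [ExtVanish.zero_iff]
  intro φ
  obtain ⟨f', g', hs, -, -⟩ := (Ses.of_submodule (costdSub e R J i)).comap_range
    (LinearMap.range φ).subtype (Submodule.injective_subtype _)
  have h1 := le_costdSub hJ he (Below.of_ses he hs (below_costd hJ he i)
    (hM.of_surjective φ.rangeRestrict φ.surjective_rangeRestrict))
  ext m
  obtain ⟨x, hx⟩ := Submodule.mkQ_surjective _ (φ m)
  rw [← hx]
  refine (Submodule.Quotient.mk_eq_zero _).2 (h1 ?_)
  rw [Submodule.mem_comap, Submodule.range_subtype, hx]
  exact ⟨m, rfl⟩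

theorem ext_costd (hJ : IsInjEnvelope R (R ⧸ Ring.jacobson R) J)
    (he : IsBasicIdempotents e) (i : Fin n) {M : Type u} [AddCommGroup M] [Module A M]
    (hM : Below e (i + 1) M) : ExtVanish A 1 M (Costd e R J i) := by
  have := hJ.1
  have := injective_I (R := R) (J := J) he i
  exact .sub_right (Ses.of_submodule (costdSub e R J i)) (hom_quotient_costd hJ he i hM)
    .of_injective

theorem eq_bot_of_map_subtype_eq_bot {A : Type u} [Ring A] {X : Type u} [AddCommGroup X] [Module A X]
    {K : Submodule A X} {N : Submodule A K} (h : N.map K.subtype = ⊥) : N = ⊥ := by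
  rw [eq_bot_iff]
  intro x hx
  have h1 : K.subtype x ∈ N.map K.subtype := ⟨x, hx, rfl⟩
  rw [h, Submodule.mem_bot] at h1
  exact Subtype.ext h1

theorem exists_socle_costd (hJ : IsInjEnvelope R (R ⧸ Ring.jacobson R) J)
    (he : IsBasicIdempotents e) (i : Fin n) :
    ∃ s : E e i →ₗ[A] Costd e R J i, Function.Injective s ∧
      ∀ N : Submodule A (Costd e R J i), N.comap s = ⊥ → N = ⊥ := by
  obtain ⟨s, hs, hess⟩ := exists_socle_I (A := A) hJ he i
  have h1 : LinearMap.range s ≤ costdSub e R J i :=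
    le_costdSub hJ he ((he.below_E (Nat.lt_succ_self i)).of_surjective s.rangeRestrict
      s.surjective_rangeRestrict)
  refine ⟨s.codRestrict _ fun x => h1 ⟨x, rfl⟩, fun x y hxy => hs (congrArg Subtype.val hxy),
    fun N hN => ?_⟩
  have h2 : N.map (costdSub e R J i).subtype = ⊥ := by
    apply hess
    rw [eq_bot_iff, ← hN]
    rintro x ⟨y, hy, hyx⟩
    rw [Submodule.mem_comap]
    have : y = s.codRestrict (costdSub e R J i) (fun x => h1 ⟨x, rfl⟩) x := Subtype.ext hyx
    exact this ▸ hy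
  exact eq_bot_of_map_subtype_eq_bot h2

/-- The inclusion of the socle of `∇(i)`. -/
def socCostd (hJ : IsInjEnvelope R (R ⧸ Ring.jacobson R) J) (he : IsBasicIdempotents e)
    (i : Fin n) : E e i →ₗ[A] Costd e R J i :=
  (exists_socle_costd hJ he i).choose

theorem socCostd_injective (hJ : IsInjEnvelope R (R ⧸ Ring.jacobson R) J)
    (he : IsBasicIdempotents e) (i : Fin n) : Function.Injective (socCostd hJ he i) :=
  (exists_socle_costd hJ he i).choose_spec.1

theorem socCostd_essential (hJ : IsInjEnvelope R (R ⧸ Ring.jacobson R) J)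
    (he : IsBasicIdempotents e) (i : Fin n) (N : Submodule A (Costd e R J i))
    (hN : N.comap (socCostd hJ he i) = ⊥) : N = ⊥ :=
  (exists_socle_costd hJ he i).choose_spec.2 N hN

/-- A submodule of multiplicity one is nonzero, so it contains the essential simple socle, and then
`e_i` sends it into the socle. The elements `x` with `e_i A x` in the socle form the largest
submodule with this property, so the supremum is itself a member. -/
theorem mem_sSup_multEq_one_iff (R : Type u) {A : Type u} [CommRing R] [IsArtinianRing R] [Ring A]
    [Algebra R A] [Module.Finite R A] [IsArtinianRing A] {n : ℕ} {e : Fin n → A}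
    (he : IsBasicIdempotents e) (i : Fin n) {X : Type u} [AddCommGroup X] [Module A X]
    [Module.Finite A X] (s : E e i →ₗ[A] X) (hs : Function.Injective s)
    (hess : ∀ N : Submodule A X, N.comap s = ⊥ → N = ⊥) (x : X) :
    x ∈ sSup {U : Submodule A X | MultEq A U (E e i) 1} ↔
      ∀ a : A, e i • a • x ∈ LinearMap.range s := by
  let _ : Module R X := Module.compHom X (algebraMap R A)
  have : IsScalarTower R A X := ⟨fun r a x => by
    rw [Algebra.smul_def, mul_smul]
    rfl⟩
  have hsimple := he.isSimpleModule_E i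
  have hfin := idemLength_ne_top R (e := e) (X := E e i) i
  let W : Submodule A X :=
    { carrier := {x | ∀ a : A, e i • a • x ∈ LinearMap.range s}
      zero_mem' := fun a => by rw [smul_zero, smul_zero]; exact zero_mem _
      add_mem' := fun hx hy a => by rw [smul_add, smul_add]; exact add_mem (hx a) (hy a)
      smul_mem' := fun b x hx a => by rw [smul_smul a b]; exact hx (a * b) }
  have key : ∀ U : Submodule A X, LinearMap.range s ≤ U →
      (MultEq A U (E e i) 1 ↔ ∀ x ∈ U, e i • x ∈ LinearMap.range s) := by
    intro U hU
    let t : E e i →ₗ[A] U := s.codRestrict U fun x => hU ⟨x, rfl⟩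
    have htinj : Function.Injective t := fun x y hxy => hs (congrArg Subtype.val hxy)
    have ht := Ses.of_range t htinj
    rw [multEq_iff R he, ht.idemLength R he i, Nat.cast_one, one_mul]
    have h1 : idemLength R e i (E e i) + idemLength R e i (U ⧸ LinearMap.range t) =
        idemLength R e i (E e i) ↔ idemLength R e i (U ⧸ LinearMap.range t) = 0 := by
      constructor
      · intro h
        have h2 : idemLength R e i (E e i) + idemLength R e i (U ⧸ LinearMap.range t) ≤
            idemLength R e i (E e i) + 0 := by rw [h, add_zero]
        exact nonpos_iff_eq_zero.1 ((ENat.add_le_add_iff_left hfin).1 h2)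
      · intro h
        rw [h, add_zero]
    rw [h1, idemLength_eq_zero_iff]
    constructor
    · intro h x hx
      obtain ⟨y, hy⟩ := (Submodule.Quotient.mk_eq_zero _).1 (h ((LinearMap.range t).mkQ ⟨x, hx⟩))
      exact ⟨y, congrArg Subtype.val hy⟩
    · intro h y
      obtain ⟨x, rfl⟩ := Submodule.mkQ_surjective _ y
      obtain ⟨z, hz⟩ := h x x.2
      exact (Submodule.Quotient.mk_eq_zero _).2 ⟨z, Subtype.ext hz⟩
  have hsocW : LinearMap.range s ≤ W := fun x hx a =>
    Submodule.smul_mem _ _ (Submodule.smul_mem _ _ hx)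
  have hW : sSup {U : Submodule A X | MultEq A U (E e i) 1} = W := by
    apply le_antisymm
    · refine sSup_le fun U hU => ?_
      have hle : LinearMap.range s ≤ U := by
        rcases eq_bot_or_eq_top (U.comap s) with h | h
        · exfalso
          have h1 := hess U h
          subst h1
          have h2 := (multEq_iff R he).1 hU
          rw [Nat.cast_one, one_mul,
            (idemLength_eq_zero_iff R i).2 fun x => Subsingleton.elim _ _] at h2
          obtain ⟨x, hx⟩ := he.smul_E_ne_zero i
          exact hx ((idemLength_eq_zero_iff R i).1 h2.symm x)
        · rintro _ ⟨x, rfl⟩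
          have : x ∈ U.comap s := by rw [h]; trivial
          exact this
      intro x hx a
      exact (key U hle).1 hU _ (U.smul_mem a hx)
    · refine le_sSup ((key W hsocW).2 fun x hx => ?_)
      have := hx 1
      rwa [one_smul] at this
  rw [hW]
  rfl

theorem mem_pcostdSub_iff (hJ : IsInjEnvelope R (R ⧸ Ring.jacobson R) J)
    (he : IsBasicIdempotents e) (i : Fin n) (x : Costd e R J i) :
    x ∈ pcostdSub e R J i ↔ ∀ a : A, e i • a • x ∈ LinearMap.range (socCostd hJ he i) := by
  have := finite_I (e := e) hJ i
  exact mem_sSup_multEq_one_iff R he i (X := costdSub e R J i) (socCostd hJ he i)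
    (socCostd_injective hJ he i) (socCostd_essential hJ he i) x

/-- The quotient of the largest submodule that has `E(i)` only in the socle. -/
theorem below_quotient_of_mem_iff {A : Type u} [Ring A] {n : ℕ} {e : Fin n → A} {i : Fin n}
    {X : Type u} [AddCommGroup X] [Module A X] (hX : Below e (i + 1) X) (s : E e i →ₗ[A] X)
    (K : Submodule A X) (hK : ∀ x, x ∈ K ↔ ∀ a : A, e i • a • x ∈ LinearMap.range s)
    (t : E e i →ₗ[A] K) (ht : ∀ x, (t x : X) = s x) : Below e i (K ⧸ LinearMap.range t) := by
  intro j hj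
  rcases hj.lt_or_eq with h | h
  · exact (hX.submodule K).quotient _ j h
  · obtain rfl : i = j := Fin.ext h
    intro z
    obtain ⟨⟨y, hy⟩, rfl⟩ := Submodule.mkQ_surjective _ z
    obtain ⟨x, hx⟩ := (hK y).1 hy 1
    rw [one_smul] at hx
    exact (Submodule.Quotient.mk_eq_zero _).2 ⟨x, Subtype.ext ((ht x).trans hx)⟩

theorem range_socCostd_le (hJ : IsInjEnvelope R (R ⧸ Ring.jacobson R) J)
    (he : IsBasicIdempotents e) (i : Fin n) :
    LinearMap.range (socCostd hJ he i) ≤ pcostdSub e R J i := by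
  intro x hx
  rw [mem_pcostdSub_iff hJ he]
  exact fun a => Submodule.smul_mem _ _ (Submodule.smul_mem _ _ hx)

/-- The inclusion of the socle of `∇̄(i)`. -/
def socPCostd (hJ : IsInjEnvelope R (R ⧸ Ring.jacobson R) J) (he : IsBasicIdempotents e)
    (i : Fin n) : E e i →ₗ[A] ↥(pcostdSub e R J i) :=
  (socCostd hJ he i).codRestrict (pcostdSub e R J i) fun x => range_socCostd_le hJ he i ⟨x, rfl⟩

theorem socPCostd_injective (hJ : IsInjEnvelope R (R ⧸ Ring.jacobson R) J)
    (he : IsBasicIdempotents e) (i : Fin n) : Function.Injective (socPCostd hJ he i) :=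
  fun _ _ hxy => socCostd_injective hJ he i (congrArg Subtype.val hxy)

theorem socPCostd_essential (hJ : IsInjEnvelope R (R ⧸ Ring.jacobson R) J)
    (he : IsBasicIdempotents e) (i : Fin n) (N : Submodule A ↥(pcostdSub e R J i))
    (hN : N.comap (socPCostd hJ he i) = ⊥) : N = ⊥ := by
  have h2 : N.map (pcostdSub e R J i).subtype = ⊥ := by
    apply socCostd_essential hJ he
    rw [eq_bot_iff, ← hN]
    rintro x ⟨y, hy, hyx⟩
    rw [Submodule.mem_comap]
    have : y = socPCostd hJ he i x := Subtype.ext hyx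
    exact this ▸ hy
  exact eq_bot_of_map_subtype_eq_bot h2

theorem below_pcostd (hJ : IsInjEnvelope R (R ⧸ Ring.jacobson R) J) (he : IsBasicIdempotents e)
    (i : Fin n) : Below e (i + 1) (PCostd e R J i) :=
  (below_costd hJ he i).submodule _

theorem hom_quotient_pcostd (hJ : IsInjEnvelope R (R ⧸ Ring.jacobson R) J)
    (he : IsBasicIdempotents e) (i : Fin n) {M : Type u} [AddCommGroup M] [Module A M]
    (hM : ∀ x : M, e i • x = 0) :
    ExtVanish A 0 M (Costd e R J i ⧸ pcostdSub e R J i) := by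
  rw [ExtVanish.zero_iff]
  intro φ
  ext m
  obtain ⟨x, hx⟩ := Submodule.mkQ_surjective _ (φ m)
  rw [← hx]
  refine (Submodule.Quotient.mk_eq_zero _).2 ((mem_pcostdSub_iff hJ he i x).2 fun a => ?_)
  -- Since `e_i` kills `M`, the element `e_i a x` lies in the submodule; applying `e_i` once more,
  -- harmless by idempotency, lands in the socle.
  have h1 : (pcostdSub e R J i).mkQ (e i • a • x) = 0 := by
    rw [map_smul, map_smul, hx, ← map_smul, ← map_smul, hM, map_zero]
  have h2 := (mem_pcostdSub_iff hJ he i _).1 ((Submodule.Quotient.mk_eq_zero _).1 h1) 1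
  rw [one_smul] at h2
  rwa [← he.smul_smul_self i (a • x)]

theorem ext_pcostd (hJ : IsInjEnvelope R (R ⧸ Ring.jacobson R) J)
    (he : IsBasicIdempotents e) (i : Fin n) {M : Type u} [AddCommGroup M] [Module A M]
    (hM : Below e i M) : ExtVanish A 1 M (PCostd e R J i) :=
  .sub_right (Ses.of_submodule (pcostdSub e R J i)) (hom_quotient_pcostd hJ he i (hM i le_rfl))
    (ext_costd hJ he i (hM.mono (Nat.le_succ _)))

end

end

end GoodFilt

namespace GoodFilt
open CategoryTheory Abelian

noncomputable section

/-! ### The two orthogonal pairs -/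

/-- A module that is filtered by a single module `D` with simple top, all of whose other
composition factors are different, has the same property for the kernel of any map onto `D`. -/
theorem filtM_ker_of_surjective {A : Type u} [Ring A] {D : ModuleCat.{u} A}
    [IsNoetherian A D] {E : Type u} [AddCommGroup E] [Module A E] [IsSimpleModule A E]
    (π : D →ₗ[A] E) (hπ : ∀ N : Submodule A D, N.map π = ⊤ → N = ⊤)
    (hD : ExtVanish A 0 D (LinearMap.ker π)) (X : Type u) [AddCommGroup X] [Module A X]
    (hX : FiltM (fun _ : Unit => D) X) (q : X →ₗ[A] D) (hq : Function.Surjective q) :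
    FiltM (fun _ : Unit => D) (LinearMap.ker q) := by
  revert q
  refine FiltM.induction (Θ := fun _ : Unit => D) (motive := fun X _ _ =>
    ∀ q : X →ₗ[A] D, Function.Surjective q → FiltM (fun _ : Unit => D) (LinearMap.ker q))
    ?_ ?_ X hX
  · intro X _ _ _ q _
    exact .zero _
  · intro X Y _ _ _ _ i f g hs hX ih q hq
    by_cases hqf : Function.Surjective (q ∘ₗ f)
    · obtain ⟨p, hp⟩ := hs.ker_comp q hqf
      exact FiltM.cons (i := ()) hp (LinearEquiv.refl _ _) (ih _ hqf)
    -- Otherwise `q` maps `X` into the radical of `D`, to which a `D`-filtered module has no nonzero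
    -- map. So `q` factors through `g` as a surjective endomorphism of a Noetherian module, an
    -- isomorphism, and its kernel is exactly `X`.
    · have h1 : LinearMap.range (q ∘ₗ f) ≤ LinearMap.ker π := by
        rcases eq_bot_or_eq_top ((LinearMap.range (q ∘ₗ f)).map π) with h | h
        · intro x hx
          have : π x ∈ (LinearMap.range (q ∘ₗ f)).map π := ⟨x, hx, rfl⟩
          rwa [h, Submodule.mem_bot] at this
        · exact absurd (LinearMap.range_eq_top.1 (hπ _ h)) hqf
      have h2 : ExtVanish A 0 X (LinearMap.ker π) := hX.extVanish_left fun _ => hD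
      have h3 := ExtVanish.zero_iff.1 h2
        ((q ∘ₗ f).codRestrict (LinearMap.ker π) fun x => h1 ⟨x, rfl⟩)
      have h4 : ∀ x, q (f x) = 0 := fun x => congrArg Subtype.val (LinearMap.congr_fun h3 x)
      have h5 : LinearMap.ker g ≤ LinearMap.ker q := by
        intro y hy
        obtain ⟨x, rfl⟩ := (hs.exact y).1 hy
        exact h4 x
      let r : D →ₗ[A] D := (LinearMap.ker g).liftQ q h5 ∘ₗ
        (g.quotKerEquivOfSurjective hs.surj).symm.toLinearMap
      have hr : ∀ y, r (g y) = q y := by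
        intro y
        have : (g.quotKerEquivOfSurjective hs.surj).symm (g y) = Submodule.Quotient.mk y := by
          rw [LinearEquiv.symm_apply_eq]
          rfl
        change (LinearMap.ker g).liftQ q h5 ((g.quotKerEquivOfSurjective hs.surj).symm (g y)) = q y
        rw [this]
        rfl
      have hrinj := IsNoetherian.injective_of_surjective_endomorphism r fun z => by
        obtain ⟨y, rfl⟩ := hq z
        exact ⟨g y, hr y⟩
      have h6 : LinearMap.ker q = LinearMap.range f := by
        rw [← LinearMap.exact_iff.1 hs.exact]
        refine le_antisymm (fun y hy => hrinj ?_) h5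
        rw [hr, map_zero]
        exact hy
      rw [h6]
      exact hX.congr (LinearEquiv.ofInjective f hs.inj)

theorem ExtVanish.ker_of_split {A : Type u} [Ring A] {X Y W : Type u} [AddCommGroup X] [Module A X]
    [AddCommGroup Y] [Module A Y] [AddCommGroup W] [Module A W] {k : ℕ} {q : X →ₗ[A] Y}
    (hq : Function.Surjective q) (h : ExtVanish A 1 Y (LinearMap.ker q))
    (hX : ExtVanish A k X W) : ExtVanish A k (LinearMap.ker q) W := by
  obtain ⟨s, hs⟩ := h.exists_lift (Ses.of_ker q hq) LinearMap.id
  have hs' : ∀ y, q (s y) = y := fun y => LinearMap.congr_fun hs y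
  refine hX.retract_left (LinearMap.ker q).subtype
    ((LinearMap.id - s ∘ₗ q).codRestrict (LinearMap.ker q) fun x => ?_) ?_
  · ext x
    have : q (x : X) = 0 := x.2
    simp [this]
  · rw [LinearMap.mem_ker]
    simp [hs']

section

variable {R A J : Type u} [CommRing R] [IsArtinianRing R] [Ring A] [Algebra R A]
  [Module.Finite R A] [IsArtinianRing A] [AddCommGroup J] [Module R J] {n : ℕ} {e : Fin n → A}

theorem ext_std_pcostd (hJ : IsInjEnvelope R (R ⧸ Ring.jacobson R) J) (he : IsBasicIdempotents e)
    (i j : Fin n) : ExtVanish A 1 (Std e i) (PCostd e R J j) := by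
  rcases lt_or_ge i j with h | h
  · exact ext_pcostd hJ he j ((below_std R he i).mono (Nat.succ_le_of_lt h))
  · exact ext_std R he i ((below_pcostd hJ he j).mono (Nat.succ_le_succ h))

theorem ext_pstd_costd (hJ : IsInjEnvelope R (R ⧸ Ring.jacobson R) J) (he : IsBasicIdempotents e)
    (i j : Fin n) : ExtVanish A 1 (PStd e i) (Costd e R J j) := by
  rcases le_or_gt i j with h | h
  · exact ext_costd hJ he j ((below_pstd R he i).mono (Nat.succ_le_succ h))
  · exact ext_pstd R he i ((below_costd hJ he j).mono (Nat.succ_le_of_lt h))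

/-- The pair `(Δ, ∇̄)`. -/
def stdPair (hJ : IsInjEnvelope R (R ⧸ Ring.jacobson R) J) (he : IsBasicIdempotents e) :
    OrthPair e (Std e) (PCostd e R J) where
  finite i := inferInstance
  finite' i := finite_pcostd hJ i
  below := below_std R he
  below' := below_pcostd hJ he
  hom i M _ _ hM := hom_std he i hM
  ext i M _ _ hM := ext_std R he i (hM.mono (Nat.le_succ _))
  ext' i M _ _ hM := ext_pcostd hJ he i hM
  ext_self i := ext_std_pcostd hJ he i i
  π := topStd R he
  π_surj := topStd_surjective R he
  π_sup := topStd_superfluous R he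
  σ := socPCostd hJ he
  σ_inj := socPCostd_injective hJ he
  σ_ess := socPCostd_essential hJ he
  compat i j x hx := by
    have h1 := below_quotient_of_mem_iff (X := costdSub e R J i) (below_costd hJ he i)
      (socCostd hJ he i) (pcostdSub e R J i) (mem_pcostdSub_iff hJ he i) (socPCostd hJ he i)
      fun _ => rfl
    have h2 : (j : ℕ) < i := by
      by_contra h
      exact hx (h1 j (not_lt.1 h) x)
    exact ((below_std R he j).mono (Nat.succ_le_of_lt h2)).submodule _
  compat' i j x hx := by
    have h2 : (j : ℕ) < i + 1 := by
      by_contra h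
      exact hx (((below_std R he i).submodule _) j (not_lt.1 h) x)
    exact (below_quotient_of_mem_iff (X := costdSub e R J j) (below_costd hJ he j)
      (socCostd hJ he j) (pcostdSub e R J j) (mem_pcostdSub_iff hJ he j) (socPCostd hJ he j)
      fun _ => rfl).mono (Nat.lt_succ_iff.1 h2)
  -- `Δ(i)` has no extensions by modules with indices at most `i`, so `q` splits and its kernel is a
  -- summand of `X`.
  layer i X _ _ q hq hX j := by
    have h1 : Below e (i + 1) X := OrthPair.below_of_filtP he (p := fun _ => True)
      (Θ := fun _ => Std e i) (fun _ _ => below_std R he i)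
      (hX.reindex fun _ => ⟨⟨i, trivial⟩, rfl⟩)
    exact ExtVanish.ker_of_split hq (ext_std R he i (h1.submodule _))
      (hX.extVanish_left fun _ => ext_std_pcostd hJ he i j)

/-- The pair `(Δ̄, ∇)`. -/
def pstdPair (hJ : IsInjEnvelope R (R ⧸ Ring.jacobson R) J) (he : IsBasicIdempotents e) :
    OrthPair e (PStd e) (Costd e R J) where
  finite i := inferInstance
  finite' i := finite_costd hJ i
  below := below_pstd R he
  below' := below_costd hJ he
  hom i M _ _ hM := hom_pstd he i hM
  ext i M _ _ hM := ext_pstd R he i hM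
  ext' i M _ _ hM := ext_costd hJ he i (hM.mono (Nat.le_succ _))
  ext_self i := ext_pstd_costd hJ he i i
  π := topPStd R he
  π_surj := topPStd_surjective R he
  π_sup := topPStd_superfluous R he
  σ := socCostd hJ he
  σ_inj := socCostd_injective hJ he
  σ_ess := socCostd_essential hJ he
  compat i j x hx := by
    have h2 : (j : ℕ) < i + 1 := by
      by_contra h
      exact hx (((below_costd hJ he i).quotient _) j (not_lt.1 h) x)
    exact (below_ker_topPStd R he j).mono (Nat.lt_succ_iff.1 h2)
  compat' i j x hx := by
    have h2 : (j : ℕ) < i := by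
      by_contra h
      exact hx (below_ker_topPStd R he i j (not_lt.1 h) x)
    exact ((below_costd hJ he j).mono (Nat.succ_le_of_lt h2)).quotient _
  -- Splitting may fail here; instead the kernel is again filtered by `Δ̄(i)`.
  layer i X _ _ q hq hX j := by
    have := he.isSimpleModule_E i
    have : IsNoetherian A (PStd e i) := isNoetherian_of_isNoetherianRing_of_finite A _
    exact (filtM_ker_of_surjective (topPStd R he i) (topPStd_superfluous R he i)
      (hom_pstd he i (below_ker_topPStd R he i)) X hX q hq).extVanish_left
      fun _ => ext_pstd_costd hJ he i j

end

end

end GoodFilt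

namespace GoodFilt
open CategoryTheory Abelian

noncomputable section

/-! ### Universal extensions -/

section

variable {A : Type u} [Ring A]
variable {X Y Z W : Type u} [AddCommGroup X] [Module A X] [AddCommGroup Y] [Module A Y]
  [AddCommGroup Z] [Module A Z] [AddCommGroup W] [Module A W]
variable {f : X →ₗ[A] Y} {g : Y →ₗ[A] Z}

/-- As `Ext¹(Y, W) = 0`, every class in `Ext¹(Z, W)` is the connecting image of a map `X → W`, and
this image is zero once the map extends. -/
theorem ExtVanish.of_exists_extend (h : Ses f g) (hY : ExtVanish A 1 Y W)
    (hW : ∀ φ : X →ₗ[A] W, ∃ ψ : Y →ₗ[A] W, ψ ∘ₗ f = φ) : ExtVanish A 1 Z W := by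
  rw [ExtVanish.iff_forall] at *
  intro x
  obtain ⟨y, rfl⟩ := Ext.contravariant_sequence_exact₃ h.shortExact _ x (hY _) (add_comm 1 0)
  obtain ⟨φ, rfl⟩ := Ext.homEquiv₀.symm.surjective y
  obtain ⟨ψ, hψ⟩ := hW φ.hom
  have h1 : φ = h.complex.f ≫ ModuleCat.ofHom ψ := by
    ext x
    exact (LinearMap.congr_fun hψ x).symm
  subst h1
  change h.shortExact.extClass.comp (Ext.mk₀ (h.complex.f ≫ ModuleCat.ofHom ψ)) _ = 0
  rw [← Ext.mk₀_comp_mk₀, ← Ext.comp_assoc_of_second_deg_zero,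
    ShortComplex.ShortExact.extClass_comp, Ext.zero_comp]

theorem ExtVanish.of_exists_lift (h : Ses f g) (hY : ExtVanish A 1 W Y)
    (hW : ∀ φ : W →ₗ[A] Z, ∃ ψ : W →ₗ[A] Y, g ∘ₗ ψ = φ) : ExtVanish A 1 W X := by
  rw [ExtVanish.iff_forall] at *
  intro x
  obtain ⟨y, rfl⟩ := Ext.covariant_sequence_exact₁ _ h.shortExact x (hY _) rfl
  obtain ⟨φ, rfl⟩ := Ext.homEquiv₀.symm.surjective y
  obtain ⟨ψ, hψ⟩ := hW φ.hom
  have h1 : φ = ModuleCat.ofHom ψ ≫ h.complex.g := by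
    ext x
    exact (LinearMap.congr_fun hψ x).symm
  subst h1
  change (Ext.mk₀ (ModuleCat.ofHom ψ ≫ h.complex.g)).comp h.shortExact.extClass _ = 0
  rw [← Ext.mk₀_comp_mk₀, Ext.comp_assoc_of_second_deg_zero,
    ShortComplex.ShortExact.comp_extClass, Ext.comp_zero]

theorem finite_hom (R : Type u) [CommRing R] [IsNoetherianRing R] [Algebra R A] [Module.Finite R A]
    [Module R Y] [IsScalarTower R A Y] [Module.Finite A X] [Module.Finite A Y] :
    Module.Finite R (X →ₗ[A] Y) := by
  have : Module.Finite R Y := Module.Finite.trans A Y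
  obtain ⟨k, s, hs⟩ := Module.Finite.exists_fin (R := A) (M := X)
  let F : (X →ₗ[A] Y) →ₗ[R] (Fin k → Y) :=
    { toFun := fun φ j => φ (s j)
      map_add' := fun _ _ => rfl
      map_smul' := fun _ _ => rfl }
  refine Module.Finite.of_injective F fun φ ψ h => ?_
  refine LinearMap.ext_on_range hs fun j => congrFun h j

/-- An exact sequence `0 → X → Y → D^m → 0` such that `Y` has no extensions by `D`, for a module
`D` without self-extensions. -/
theorem exists_universal_extension (R : Type u) [CommRing R] [IsNoetherianRing R] [Algebra R A]
    [Module.Finite R A] {P D : Type u} [AddCommGroup P] [Module A P] [Module.Projective A P]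
    [AddCommGroup D] [Module A D] (c : P →ₗ[A] D) (hc : Function.Surjective c)
    [Module.Finite A (LinearMap.ker c)] (hDD : ExtVanish A 1 D D) (X : Type u) [AddCommGroup X]
    [Module A X] [Module.Finite A X] :
    ∃ (m : ℕ) (Y : ModuleCat.{u} A) (f : X →ₗ[A] Y) (p : Y →ₗ[A] (Fin m → D)),
      Ses f p ∧ ExtVanish A 1 D Y := by
  let _ : Module R X := Module.compHom X (algebraMap R A)
  have : IsScalarTower R A X := ⟨fun r a x => by
    rw [Algebra.smul_def, mul_smul]
    rfl⟩
  let _ : Module R P := Module.compHom P (algebraMap R A)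
  have : IsScalarTower R A P := ⟨fun r a x => by
    rw [Algebra.smul_def, mul_smul]
    rfl⟩
  have := finite_hom R (A := A) (X := LinearMap.ker c) (Y := X)
  -- `Ext¹(D, X)` is a quotient of `Hom(ker c, X)`, so finitely many `R`-generators of the latter
  -- account for all extension classes at once.
  obtain ⟨m, φ, hφ⟩ := Module.Finite.exists_fin (R := R) (M := LinearMap.ker c →ₗ[A] X)
  -- The quotient by `N` is the pushout of `(ker c)^m → P^m` along the map `(ker c)^m → X` given by
  -- the `φ s`.
  let N : Submodule A (X × (Fin m → P)) :=
    { carrier := {z | ∃ k : Fin m → LinearMap.ker c, z.1 = -∑ s, φ s (k s) ∧ ∀ s, z.2 s = k s}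
      zero_mem' := ⟨0, by simp, fun s => rfl⟩
      add_mem' := by
        rintro a b ⟨k, hk, hk'⟩ ⟨l, hl, hl'⟩
        refine ⟨k + l, ?_, fun s => ?_⟩
        · simp [hk, hl, Finset.sum_add_distrib]
          abel
        · simp [hk', hl']
      smul_mem' := by
        rintro a b ⟨k, hk, hk'⟩
        refine ⟨a • k, ?_, fun s => ?_⟩
        · simp [hk, Finset.smul_sum]
        · simp [hk'] }
  have hN : ∀ z, z ∈ N ↔ ∃ k : Fin m → LinearMap.ker c,
    z.1 = -∑ s, φ s (k s) ∧ ∀ s, z.2 s = k s := fun _ => Iff.rfl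
  let f : X →ₗ[A] ((X × (Fin m → P)) ⧸ N) := N.mkQ ∘ₗ LinearMap.inl A X (Fin m → P)
  let p₀ : (X × (Fin m → P)) →ₗ[A] (Fin m → D) :=
    LinearMap.pi fun s => c ∘ₗ LinearMap.proj s ∘ₗ LinearMap.snd A X (Fin m → P)
  have hp₀ : N ≤ LinearMap.ker p₀ := by
    rintro z ⟨k, -, hk⟩
    ext s
    change c (z.2 s) = 0
    rw [hk]
    exact (k s).2
  let p := N.liftQ p₀ hp₀
  have hmove : ∀ k : Fin m → LinearMap.ker c,
      N.mkQ (0, fun s => (k s : P)) = f (∑ s, φ s (k s)) := by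
    intro k
    change N.mkQ _ = N.mkQ (_, 0)
    rw [← sub_eq_zero, ← map_sub, Submodule.mkQ_apply, Submodule.Quotient.mk_eq_zero, hN]
    exact ⟨k, by simp, fun s => by simp⟩
  have hs : Ses f p := by
    refine ⟨?_, ?_, ?_⟩
    · rw [← LinearMap.ker_eq_bot, LinearMap.ker_eq_bot']
      intro x hx
      obtain ⟨k, hk, hk'⟩ := (hN _).1 ((Submodule.Quotient.mk_eq_zero N).1 hx)
      have : k = 0 := funext fun s => Subtype.ext (hk' s).symm
      subst this
      simpa using hk
    · intro y
      constructor
      · obtain ⟨⟨x, v⟩, rfl⟩ := N.mkQ_surjective y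
        intro hy
        have hv : ∀ s, c (v s) = 0 := fun s => congrFun hy s
        refine ⟨x + ∑ s, φ s ⟨v s, hv s⟩, ?_⟩
        rw [map_add, ← hmove]
        change N.mkQ (x, 0) + N.mkQ (0, v) = N.mkQ (x, v)
        rw [← map_add, Prod.mk_add_mk, add_zero, zero_add]
      · rintro ⟨x, rfl⟩
        ext s
        exact map_zero c
    · intro d
      choose v hv using fun s => hc (d s)
      exact ⟨N.mkQ (0, v), funext hv⟩
  refine ⟨m, ModuleCat.of A _, f, p, hs, ?_⟩
  refine ExtVanish.of_exists_extend (Ses.of_ker c hc) .of_projective fun h => ?_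
  -- Absence of self-extensions of `D` extends `p ∘ h` from the kernel to `P`, and projectivity
  -- lifts it to `t`. The difference of `h` and `t` then lands in `X`, so it is a combination of the
  -- `φ s`.
  obtain ⟨t₀, ht₀⟩ := (hDD.pi_right m).exists_extend (Ses.of_ker c hc) (p ∘ₗ h)
  obtain ⟨t, ht⟩ := Module.projective_lifting_property p t₀ hs.surj
  have h1 : ∀ k, h k - t k ∈ LinearMap.range f := by
    intro k
    rw [← LinearMap.exact_iff.1 hs.exact, LinearMap.mem_ker, map_sub, sub_eq_zero]
    exact (LinearMap.congr_fun ht₀ k).symm.trans (LinearMap.congr_fun ht k).symm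
  let h' : LinearMap.ker c →ₗ[A] X := (LinearEquiv.ofInjective f hs.inj).symm.toLinearMap ∘ₗ
    (h - t ∘ₗ (LinearMap.ker c).subtype).codRestrict (LinearMap.range f) h1
  have hh' : ∀ k, f (h' k) = h k - t k := by
    intro k
    exact congrArg Subtype.val ((LinearEquiv.ofInjective f hs.inj).apply_symm_apply ⟨_, h1 k⟩)
  obtain ⟨r, hr⟩ := (Submodule.mem_span_range_iff_exists_fun R).1
    (show h' ∈ Submodule.span R (Set.range φ) by rw [hφ]; trivial)
  -- In the pushout, `φ s` extends to `P` through the `s`-th copy of `P`; the coefficients `r s`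
  -- combine these.
  let w : P →ₗ[A] ((X × (Fin m → P)) ⧸ N) := N.mkQ ∘ₗ LinearMap.inr A X (Fin m → P) ∘ₗ
    LinearMap.pi fun s => r s • LinearMap.id
  refine ⟨t + w, LinearMap.ext fun k => ?_⟩
  have h2 : w k = f (h' k) := by
    have h3 : h' k = ∑ s, φ s (r s • k) := by
      rw [← hr]
      simp [LinearMap.sum_apply, LinearMap.map_smul_of_tower]
    rw [h3, ← hmove]
    rfl
  change t k + w k = h k
  rw [h2, hh', add_sub_cancel]

/-- An exact sequence `0 → D^m → Y → X → 0` such that `Y` has no extensions by `D`, for a module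
`D` without self-extensions. -/
theorem exists_universal_coextension (R : Type u) [CommRing R] [IsNoetherianRing R] [Algebra R A]
    [Module.Finite R A] {Q D : Type u} [AddCommGroup Q] [Module A Q] [Module.Injective A Q]
    [AddCommGroup D] [Module A D] (c : D →ₗ[A] Q) (hc : Function.Injective c)
    [Module.Finite A (Q ⧸ LinearMap.range c)] (hDD : ExtVanish A 1 D D) (X : Type u)
    [AddCommGroup X] [Module A X] [Module.Finite A X] :
    ∃ (m : ℕ) (Y : ModuleCat.{u} A) (f : (Fin m → D) →ₗ[A] Y) (p : Y →ₗ[A] X),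
      Ses f p ∧ ExtVanish A 1 Y D := by
  let _ : Module R Q := Module.compHom Q (algebraMap R A)
  have : IsScalarTower R A Q := ⟨fun r a x => by
    rw [Algebra.smul_def, mul_smul]
    rfl⟩
  have := finite_hom R (A := A) (X := X) (Y := Q ⧸ LinearMap.range c)
  obtain ⟨m, φ, hφ⟩ := Module.Finite.exists_fin (R := R) (M := X →ₗ[A] (Q ⧸ LinearMap.range c))
  let q := (LinearMap.range c).mkQ
  have hq : Ses c q := Ses.of_range c hc
  -- The pullback of `Q^m → (Q/D)^m` along the family `φ`; each `φ s ∘ p` thereby lifts to `Q`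
  -- through the `s`-th coordinate.
  let Y : Submodule A (X × (Fin m → Q)) :=
    { carrier := {z | ∀ s, φ s z.1 = q (z.2 s)}
      zero_mem' := fun s => by simp
      add_mem' := fun {a b} ha hb s => by simp [ha s, hb s]
      smul_mem' := fun r {a} ha s => by simp [ha s] }
  let f : (Fin m → D) →ₗ[A] Y :=
    (LinearMap.inr A X (Fin m → Q) ∘ₗ LinearMap.pi fun s => c ∘ₗ LinearMap.proj s).codRestrict Y
      fun d s => by
        change φ s 0 = q (c (d s))
        rw [map_zero, hq.zero]
  let p : Y →ₗ[A] X := LinearMap.fst A X (Fin m → Q) ∘ₗ Y.subtype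
  have hs : Ses f p := by
    refine ⟨?_, ?_, ?_⟩
    · intro d d' h
      funext s
      exact hc (congrFun (congrArg (fun y : Y => y.1.2) h) s)
    · rintro ⟨⟨x, v⟩, hxv⟩
      constructor
      · intro hx
        have hx' : x = 0 := hx
        subst hx'
        have h1 : ∀ s, ∃ d, c d = v s := fun s => (hq.exact _).1 (by
          rw [← hxv s]
          exact map_zero _)
        choose d hd using h1
        exact ⟨d, Subtype.ext (Prod.ext rfl (funext hd))⟩
      · rintro ⟨d, hd⟩
        exact (congrArg (fun y : Y => y.1.1) hd).symm
    · intro x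
      choose v hv using fun s => hq.surj (φ s x)
      exact ⟨⟨(x, v), fun s => (hv s).symm⟩, rfl⟩
  refine ⟨m, ModuleCat.of A Y, f, p, hs, ?_⟩
  refine ExtVanish.of_exists_lift hq .of_injective fun h => ?_
  obtain ⟨t₀, ht₀⟩ := (hDD.pi_left m).exists_lift hq (h ∘ₗ f)
  obtain ⟨t, ht⟩ := Module.Injective.out f hs.inj t₀
  have h1 : LinearMap.ker p ≤ LinearMap.ker (h - q ∘ₗ t) := by
    intro y hy
    obtain ⟨d, rfl⟩ := (hs.exact y).1 hy
    rw [LinearMap.mem_ker, LinearMap.sub_apply, LinearMap.comp_apply, ht, sub_eq_zero]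
    exact (LinearMap.congr_fun ht₀ d).symm
  let h' : X →ₗ[A] (Q ⧸ LinearMap.range c) := (LinearMap.ker p).liftQ _ h1 ∘ₗ
    (p.quotKerEquivOfSurjective hs.surj).symm.toLinearMap
  have hh' : ∀ y, h' (p y) = h y - q (t y) := by
    intro y
    have h2 : (p.quotKerEquivOfSurjective hs.surj).symm (p y) = Submodule.Quotient.mk y := by
      rw [LinearEquiv.symm_apply_eq]
      rfl
    change (LinearMap.ker p).liftQ _ h1 ((p.quotKerEquivOfSurjective hs.surj).symm (p y)) = _
    rw [h2]
    rfl
  obtain ⟨r, hr⟩ := (Submodule.mem_span_range_iff_exists_fun R).1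
    (show h' ∈ Submodule.span R (Set.range φ) by rw [hφ]; trivial)
  let w : Y →ₗ[A] Q := ∑ s, r s • (LinearMap.proj s ∘ₗ LinearMap.snd A X (Fin m → Q) ∘ₗ Y.subtype)
  refine ⟨t + w, LinearMap.ext fun y => ?_⟩
  have h2 : q (w y) = h' (p y) := by
    rw [← hr]
    simp only [w, LinearMap.sum_apply, LinearMap.smul_apply, map_sum,
      LinearMap.map_smul_of_tower]
    exact Finset.sum_congr rfl fun s _ => congrArg (r s • ·) (y.2 s).symm
  change q (t y + w y) = h y
  rw [map_add, h2, hh', add_sub_cancel]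

end

end

end GoodFilt

namespace GoodFilt
open CategoryTheory Abelian

noncomputable section

/-! ### Approximations and homological dimensions -/

section

variable {A : Type u} [Ring A] {ι : Type} {p : ι → Prop} {Θ : ι → ModuleCat.{u} A}
  {X W : Type u} [AddCommGroup X] [Module A X] [AddCommGroup W] [Module A W]

theorem FiltP.extVanish_left {k : ℕ} (hΘ : ∀ i, p i → ExtVanish A k (Θ i) W) (hX : FiltP p Θ X) :
    ExtVanish A k X W :=
  FiltM.extVanish_left (fun i => hΘ i.1 i.2) hX

theorem FiltP.extVanish_right {k : ℕ} (hΘ : ∀ i, p i → ExtVanish A k W (Θ i)) (hX : FiltP p Θ X) :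
    ExtVanish A k W X :=
  FiltM.extVanish_right (fun i => hΘ i.1 i.2) hX

end

section

variable {R A J : Type u} [CommRing R] [IsArtinianRing R] [Ring A] [Algebra R A]
  [Module.Finite R A] [IsArtinianRing A] [AddCommGroup J] [Module R J] {n : ℕ} {e : Fin n → A}

/-- Descending induction on `h`: stage `h` removes `Ext¹(Δ(h), -)` by a universal extension. Stages
already done survive, because `Ext¹(Δ(l), Δ(h)) = 0` for `l ≥ h`. -/
theorem exists_embedding_of_le (R : Type u) [CommRing R] [IsArtinianRing R] [Algebra R A]
    [Module.Finite R A] (he : IsBasicIdempotents e) (X : Type u) [AddCommGroup X] [Module A X]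
    [Module.Finite A X] (k h : ℕ) (hk : n ≤ h + k) :
    ∃ (Y : ModuleCat.{u} A) (f : X →ₗ[A] Y), Function.Injective f ∧ Module.Finite A Y ∧
      FiltM (Std e) (Y ⧸ LinearMap.range f) ∧
      ∀ l : Fin n, h ≤ l → ExtVanish A 1 (Std e l) Y := by
  induction k generalizing h with
  | zero =>
    refine ⟨ModuleCat.of A X, LinearMap.id, Function.injective_id, inferInstance, ?_,
      fun l hl => absurd l.2 (by omega)⟩
    have : Subsingleton (X ⧸ LinearMap.range (LinearMap.id : X →ₗ[A] X)) := by
      rw [Submodule.Quotient.subsingleton_iff, LinearMap.range_id]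
    exact .zero _
  | succ k ih =>
    obtain ⟨Y, f, hf, hY, hq, hl⟩ := ih (h + 1) (by omega)
    by_cases hn : h < n
    · let i : Fin n := ⟨h, hn⟩
      have := he.projective i
      have hii : ExtVanish A 1 (Std e i) (Std e i) := ext_std R he i (below_std R he i)
      obtain ⟨m, Y', g, p, hs, hY'⟩ := exists_universal_extension R (stdKer e i).mkQ
        (Submodule.mkQ_surjective _) hii Y
      refine ⟨Y', g ∘ₗ f, hs.inj.comp hf, hs.finite, ?_, fun l hhl => ?_⟩
      · rw [LinearMap.range_comp]
        exact .ext (hs.quotient (LinearMap.range f)) hq ((FiltM.single (Θ := Std e) i).pi m)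
      · rcases Nat.lt_or_eq_of_le hhl with hlt | heq
        · refine .mid_right hs (hl l hlt) (.pi_right ?_ m)
          exact ext_std R he l ((below_std R he i).mono (Nat.succ_le_succ hhl))
        · have : i = l := Fin.ext heq
          subst this
          exact hY'
    · exact ⟨Y, f, hf, hY, hq, fun l hhl => absurd l.2 (by omega)⟩

theorem exists_embedding (hJ : IsInjEnvelope R (R ⧸ Ring.jacobson R) J)
    (he : IsBasicIdempotents e) (hA : FiltM (Std e) A) (X : Type u) [AddCommGroup X] [Module A X]
    [Module.Finite A X] :
    ∃ (Y : ModuleCat.{u} A) (f : X →ₗ[A] Y), Function.Injective f ∧ Module.Finite A Y ∧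
      FiltM (PCostd e R J) Y ∧ FiltM (Std e) (Y ⧸ LinearMap.range f) := by
  obtain ⟨Y, f, hf, hY, hq, hl⟩ := exists_embedding_of_le R he X n 0 (by omega)
  exact ⟨Y, f, hf, hY, (stdPair hJ he).filtM_right he ((stdPair hJ he).ext_two he hA) Y
    fun l => hl l (Nat.zero_le _), hq⟩

theorem exists_covering_of_le (hJ : IsInjEnvelope R (R ⧸ Ring.jacobson R) J)
    (he : IsBasicIdempotents e) (X : Type u) [AddCommGroup X] [Module A X]
    [Module.Finite A X] (k h : ℕ) (hk : n ≤ h + k) :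
    ∃ (Y : ModuleCat.{u} A) (f : Y →ₗ[A] X), Function.Surjective f ∧ Module.Finite A Y ∧
      FiltM (Costd e R J) (LinearMap.ker f) ∧
      ∀ l : Fin n, h ≤ l → ExtVanish A 1 Y (Costd e R J l) := by
  induction k generalizing h with
  | zero =>
    refine ⟨ModuleCat.of A X, LinearMap.id, Function.surjective_id, inferInstance, ?_,
      fun l hl => absurd l.2 (by omega)⟩
    have : Subsingleton (LinearMap.ker (LinearMap.id : X →ₗ[A] X)) := by
      rw [LinearMap.ker_id]
      infer_instance
    exact .zero _
  | succ k ih =>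
    obtain ⟨Y, f, hf, hY, hq, hl⟩ := ih (h + 1) (by omega)
    by_cases hn : h < n
    · let i : Fin n := ⟨h, hn⟩
      have := hJ.1
      have := injective_I (R := R) (J := J) he i
      have := finite_I (e := e) hJ i
      have := finite_costd (e := e) hJ i
      have hii : ExtVanish A 1 (costdSub e R J i) (costdSub e R J i) :=
        ext_costd hJ he i (below_costd hJ he i)
      obtain ⟨m, Y', g, p, hs, hY'⟩ := exists_universal_coextension R (costdSub e R J i).subtype
        (Submodule.injective_subtype _) hii Y
      have : Module.Finite A (Fin m → costdSub e R J i) := inferInstance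
      refine ⟨Y', f ∘ₗ p, hf.comp hs.surj, hs.finite, ?_, fun l hhl => ?_⟩
      · obtain ⟨f', g', hs', -, -⟩ := hs.comap_range (LinearMap.ker f).subtype
          (Submodule.injective_subtype _)
        have h1 := FiltM.ext hs' ((FiltM.single (Θ := Costd e R J) i).pi m) hq
        rwa [Submodule.range_subtype, ← LinearMap.ker_comp] at h1
      · rcases Nat.lt_or_eq_of_le hhl with hlt | heq
        · refine .mid_left hs (.pi_left ?_ m) (hl l hlt)
          exact ext_costd hJ he l ((below_costd hJ he i).mono (Nat.succ_le_succ hhl))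
        · have : i = l := Fin.ext heq
          subst this
          exact hY'
    · exact ⟨Y, f, hf, hY, hq, fun l hhl => absurd l.2 (by omega)⟩

theorem exists_covering (hJ : IsInjEnvelope R (R ⧸ Ring.jacobson R) J)
    (he : IsBasicIdempotents e) (hA : FiltM (PStd e) A) (X : Type u) [AddCommGroup X] [Module A X]
    [Module.Finite A X] :
    ∃ (Y : ModuleCat.{u} A) (f : Y →ₗ[A] X), Function.Surjective f ∧ Module.Finite A Y ∧
      FiltM (PStd e) Y ∧ FiltM (Costd e R J) (LinearMap.ker f) := by
  obtain ⟨Y, f, hf, hY, hq, hl⟩ := exists_covering_of_le hJ he X n 0 (by omega)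
  exact ⟨Y, f, hf, hY, (pstdPair hJ he).filtM_left he ((pstdPair hJ he).ext_two he hA) Y
    fun l => hl l (Nat.zero_le _), hq⟩

/-- `Ext¹` from this kernel to `∇̄` shifts to `Ext²(Δ(i), ∇̄) = 0`, so it is `Δ`-filtered; having no
maps to modules with indices at most `i` leaves only larger indices. -/
theorem filtP_stdKer (hJ : IsInjEnvelope R (R ⧸ Ring.jacobson R) J)
    (he : IsBasicIdempotents e) (hA : FiltM (Std e) A) (i : Fin n) :
    FiltP (fun j : Fin n => (i : ℕ) + 1 ≤ j) (Std e) (stdKer e i) := by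
  have := he.projective i
  have h2 := (stdPair hJ he).ext_two he hA
  exact (stdPair hJ he).filtP_left he h2 _
    (fun l => .sub_left (Ses.of_submodule (stdKer e i)) .of_projective (h2 i l)) _
    fun M _ _ hM => hom_stdKer R he i hM

theorem filtP_quotient_costdSub (hJ : IsInjEnvelope R (R ⧸ Ring.jacobson R) J)
    (he : IsBasicIdempotents e) (hA : FiltM (PStd e) A) (i : Fin n) :
    FiltP (fun j : Fin n => (i : ℕ) + 1 ≤ j) (Costd e R J)
      (I e R J i ⧸ costdSub e R J i) := by
  have := hJ.1
  have := injective_I (R := R) (J := J) he i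
  have := finite_I (e := e) hJ i
  have h2 := (pstdPair hJ he).ext_two he hA
  exact (pstdPair hJ he).filtP_right he h2 _
    (fun l => .quot_right (Ses.of_submodule (costdSub e R J i)) .of_injective (h2 l i)) _
    fun M _ _ hM => hom_quotient_costd hJ he i hM

theorem exists_forall_extVanish_std (hJ : IsInjEnvelope R (R ⧸ Ring.jacobson R) J)
    (he : IsBasicIdempotents e) (hA : FiltM (Std e) A) :
    ∃ N : ℕ, ∀ k > N, ∀ (i : Fin n) (Y : Type u) [AddCommGroup Y] [Module A Y],
      ExtVanish A k (Std e i) Y := by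
  -- `m` bounds the distance of `i` from `n`. Each syzygy has only larger indices, so the degree and
  -- this distance decrease together.
  have key : ∀ m : ℕ, ∀ k > m, ∀ i : Fin n, n ≤ i + m → ∀ (Y : Type u) [AddCommGroup Y]
      [Module A Y], ExtVanish A k (Std e i) Y := by
    intro m
    induction m with
    | zero => exact fun k _ i hi => absurd i.2 (by omega)
    | succ m ih =>
      intro k hk i hi Y _ _
      obtain ⟨k, rfl⟩ : ∃ k', k = k' + 1 := ⟨k - 1, by omega⟩
      have := he.projective i
      refine .quot_left (Ses.of_submodule (stdKer e i)) ?_ .of_projective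
      exact FiltP.extVanish_left (fun j hj => ih k (by omega) j (by omega) Y)
        (filtP_stdKer hJ he hA i)
  exact ⟨n, fun k hk i Y _ _ => key n k hk i (by omega) Y⟩

theorem exists_forall_extVanish_costd (hJ : IsInjEnvelope R (R ⧸ Ring.jacobson R) J)
    (he : IsBasicIdempotents e) (hA : FiltM (PStd e) A) :
    ∃ N : ℕ, ∀ k > N, ∀ (i : Fin n) (X : Type u) [AddCommGroup X] [Module A X],
      ExtVanish A k X (Costd e R J i) := by
  have key : ∀ m : ℕ, ∀ k > m, ∀ i : Fin n, n ≤ i + m → ∀ (X : Type u) [AddCommGroup X]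
      [Module A X], ExtVanish A k X (Costd e R J i) := by
    intro m
    induction m with
    | zero => exact fun k _ i hi => absurd i.2 (by omega)
    | succ m ih =>
      intro k hk i hi X _ _
      obtain ⟨k, rfl⟩ : ∃ k', k = k' + 1 := ⟨k - 1, by omega⟩
      have := hJ.1
      have := injective_I (R := R) (J := J) he i
      refine .sub_right (Ses.of_submodule (costdSub e R J i)) ?_ .of_injective
      exact FiltP.extVanish_right (fun j hj => ih k (by omega) j (by omega) X)
        (filtP_quotient_costdSub hJ he hA i)
  exact ⟨n, fun k hk i X _ _ => key n k hk i (by omega) X⟩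

end

end

end GoodFilt

namespace GoodFilt
open CategoryTheory Abelian

noncomputable section

/-! ### Resolutions and coresolutions -/

section

variable {A : Type u} [Ring A] {C C' : ModuleCat.{u} A → Prop}
variable {X Y Z : Type u} [AddCommGroup X] [Module A X] [AddCommGroup Y] [Module A Y]
  [AddCommGroup Z] [Module A Z]

theorem HasCores.mono (hC : ∀ M, C M → C' M) {X : ModuleCat.{u} A} {d : ℕ} (h : HasCores C X d) :
    HasCores C' X d := by
  obtain ⟨M, ε, f, h1, h2⟩ := h
  exact ⟨M, ε, f, fun i hi => hC _ (h1 i hi), h2⟩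

theorem HasRes.mono (hC : ∀ M, C M → C' M) {X : ModuleCat.{u} A} {d : ℕ} (h : HasRes C X d) :
    HasRes C' X d := by
  obtain ⟨M, ε, f, h1, h2⟩ := h
  exact ⟨M, ε, f, fun i hi => hC _ (h1 i hi), h2⟩

theorem HasCores.zero {X : ModuleCat.{u} A} (hX : C X) : HasCores C X 0 := by
  refine ⟨fun i => Nat.casesOn i X fun _ => ModuleCat.of A PUnit, LinearMap.id, fun _ => 0,
    fun i hi => ?_, fun i hi => ?_, Function.injective_id, ?_, fun i => ?_⟩
  · obtain rfl : i = 0 := by omega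
    exact hX
  · obtain ⟨i, rfl⟩ : ∃ i', i = i' + 1 := ⟨i - 1, by omega⟩
    exact inferInstanceAs (Subsingleton PUnit)
  · exact fun x => ⟨fun _ => ⟨x, rfl⟩, fun _ => rfl⟩
  · exact fun x => ⟨fun _ => ⟨0, rfl⟩, fun _ => rfl⟩

theorem HasRes.zero {X : ModuleCat.{u} A} (hX : C X) : HasRes C X 0 := by
  refine ⟨fun i => Nat.casesOn i X fun _ => ModuleCat.of A PUnit, LinearMap.id, fun _ => 0,
    fun i hi => ?_, fun i hi => ?_, Function.surjective_id, ?_, fun i => ?_⟩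
  · obtain rfl : i = 0 := by omega
    exact hX
  · obtain ⟨i, rfl⟩ : ∃ i', i = i' + 1 := ⟨i - 1, by omega⟩
    exact inferInstanceAs (Subsingleton PUnit)
  · exact fun x => ⟨fun h => ⟨0, h.symm⟩, fun h => by
      obtain ⟨y, rfl⟩ := h
      rfl⟩
  · exact fun x => ⟨fun _ => ⟨0, rfl⟩, fun _ => rfl⟩

theorem HasCores.succ {f : X →ₗ[A] Y} {g : Y →ₗ[A] Z} (hs : Ses f g) (hY : C (ModuleCat.of A Y))
    {d : ℕ} (hZ : HasCores C (ModuleCat.of A Z) d) : HasCores C (ModuleCat.of A X) (d + 1) := by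
  obtain ⟨M, ε, φ, h1, h2, h3, h4, h5⟩ := hZ
  refine ⟨fun i => Nat.casesOn i (ModuleCat.of A Y) M, f, fun i => match i with
    | 0 => ε ∘ₗ g
    | i + 1 => φ i, fun i hi => ?_, fun i hi => ?_, hs.inj, ?_, fun i => ?_⟩
  · cases i with
    | zero => exact hY
    | succ i => exact h1 i (by omega)
  · cases i with
    | zero => omega
    | succ i => exact h2 i (by omega)
  · intro y
    rw [← hs.exact y]
    exact map_eq_zero_iff ε h3
  · cases i with
    | zero =>
      intro z
      refine (h4 z).trans ⟨?_, ?_⟩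
      · rintro ⟨w, rfl⟩
        obtain ⟨y, rfl⟩ := hs.surj w
        exact ⟨y, rfl⟩
      · rintro ⟨y, rfl⟩
        exact ⟨g y, rfl⟩
    | succ i => exact h5 i

theorem HasRes.succ {f : X →ₗ[A] Y} {g : Y →ₗ[A] Z} (hs : Ses f g) (hY : C (ModuleCat.of A Y))
    {d : ℕ} (hX : HasRes C (ModuleCat.of A X) d) : HasRes C (ModuleCat.of A Z) (d + 1) := by
  obtain ⟨M, π, φ, h1, h2, h3, h4, h5⟩ := hX
  refine ⟨fun i => Nat.casesOn i (ModuleCat.of A Y) M, g, fun i => match i with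
    | 0 => f ∘ₗ π
    | i + 1 => φ i, fun i hi => ?_, fun i hi => ?_, hs.surj, ?_, fun i => ?_⟩
  · cases i with
    | zero => exact hY
    | succ i => exact h1 i (by omega)
  · cases i with
    | zero => omega
    | succ i => exact h2 i (by omega)
  · intro y
    refine (hs.exact y).trans ⟨?_, ?_⟩
    · rintro ⟨x, rfl⟩
      obtain ⟨w, rfl⟩ := h3 x
      exact ⟨w, rfl⟩
    · rintro ⟨w, rfl⟩
      exact ⟨π w, rfl⟩
  · cases i with
    | zero =>
      intro z
      refine Iff.trans ?_ (h4 z)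
      exact map_eq_zero_iff f hs.inj
    | succ i => exact h5 i

theorem HasCores.exists_ses {X : ModuleCat.{u} A} {d : ℕ} (h : HasCores C X (d + 1)) :
    ∃ (Y Z : ModuleCat.{u} A) (f : X →ₗ[A] Y) (g : Y →ₗ[A] Z), Ses f g ∧ C Y ∧
      HasCores C Z d := by
  obtain ⟨M, ε, φ, h1, h2, h3, h4, h5⟩ := h
  refine ⟨M 0, ModuleCat.of A (LinearMap.range (φ 0)), ε, (φ 0).rangeRestrict, ⟨h3, ?_,
    (φ 0).surjective_rangeRestrict⟩, h1 0 (by omega), fun i => M (i + 1),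
    (LinearMap.range (φ 0)).subtype, fun i => φ (i + 1), fun i hi => h1 _ (by omega),
    fun i hi => h2 _ (by omega), Submodule.injective_subtype _, ?_, fun i => h5 _⟩
  · rw [LinearMap.exact_iff, LinearMap.ker_rangeRestrict, LinearMap.exact_iff.1 h4]
  · rw [LinearMap.exact_iff, Submodule.range_subtype, LinearMap.exact_iff.1 (h5 0)]

theorem HasRes.exists_ses {X : ModuleCat.{u} A} {d : ℕ} (h : HasRes C X (d + 1)) :
    ∃ (Y Z : ModuleCat.{u} A) (f : Z →ₗ[A] Y) (g : Y →ₗ[A] X), Ses f g ∧ C Y ∧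
      HasRes C Z d := by
  obtain ⟨M, ε, φ, h1, h2, h3, h4, h5⟩ := h
  refine ⟨M 0, ModuleCat.of A (LinearMap.range (φ 0)), (LinearMap.range (φ 0)).subtype, ε,
    ⟨Submodule.injective_subtype _, ?_, h3⟩, h1 0 (by omega), fun i => M (i + 1),
    (φ 0).rangeRestrict, fun i => φ (i + 1), fun i hi => h1 _ (by omega),
    fun i hi => h2 _ (by omega), (φ 0).surjective_rangeRestrict, ?_, fun i => h5 _⟩
  · rw [LinearMap.exact_iff, Submodule.range_subtype, LinearMap.exact_iff.1 h4]
  · rw [LinearMap.exact_iff, LinearMap.ker_rangeRestrict, LinearMap.exact_iff.1 (h5 0)]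

theorem HasCores.nonempty_equiv {X : ModuleCat.{u} A} (h : HasCores C X 0) :
    ∃ (Y : ModuleCat.{u} A), C Y ∧ Nonempty (X ≃ₗ[A] Y) := by
  obtain ⟨M, ε, φ, h1, h2, h3, h4, h5⟩ := h
  have := h2 1 (by omega)
  exact ⟨M 0, h1 0 le_rfl, ⟨LinearEquiv.ofBijective ε
    ⟨h3, fun y => (h4 y).1 (Subsingleton.elim _ _)⟩⟩⟩

theorem HasRes.nonempty_equiv {X : ModuleCat.{u} A} (h : HasRes C X 0) :
    ∃ (Y : ModuleCat.{u} A), C Y ∧ Nonempty (X ≃ₗ[A] Y) := by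
  obtain ⟨M, π, φ, h1, h2, h3, h4, h5⟩ := h
  have := h2 1 (by omega)
  refine ⟨M 0, h1 0 le_rfl, ⟨(LinearEquiv.ofBijective π ⟨?_, h3⟩).symm⟩⟩
  rw [← LinearMap.ker_eq_bot, LinearMap.exact_iff.1 h4, LinearMap.range_eq_bot]
  exact LinearMap.ext fun x => by
    rw [Subsingleton.elim x 0, map_zero, map_zero]

/-- Dimension shifting along a coresolution by modules acyclic for `Ext(Q, -)`. -/
theorem HasCores.extVanish {Q : Type u} [AddCommGroup Q] [Module A Q]
    (hC : ∀ M : ModuleCat.{u} A, C M → ∀ k, ExtVanish A (k + 1) Q M) {X : ModuleCat.{u} A} {d : ℕ}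
    (h : HasCores C X d) : ∀ k > d, ExtVanish A k Q X := by
  induction d generalizing X with
  | zero =>
    intro k hk
    obtain ⟨k, rfl⟩ : ∃ k', k = k' + 1 := ⟨k - 1, by omega⟩
    obtain ⟨Y, hY, ⟨e⟩⟩ := h.nonempty_equiv
    exact .congr_right e (hC Y hY k)
  | succ d ih =>
    intro k hk
    obtain ⟨k, rfl⟩ : ∃ k', k = k' + 1 := ⟨k - 1, by omega⟩
    obtain ⟨Y, Z, f, g, hs, hY, hZ⟩ := h.exists_ses
    exact .sub_right hs (ih hZ k (by omega)) (hC Y hY k)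

theorem HasRes.extVanish {Q : Type u} [AddCommGroup Q] [Module A Q]
    (hC : ∀ M : ModuleCat.{u} A, C M → ∀ k, ExtVanish A (k + 1) M Q) {X : ModuleCat.{u} A} {d : ℕ}
    (h : HasRes C X d) : ∀ k > d, ExtVanish A k X Q := by
  induction d generalizing X with
  | zero =>
    intro k hk
    obtain ⟨k, rfl⟩ : ∃ k', k = k' + 1 := ⟨k - 1, by omega⟩
    obtain ⟨Y, hY, ⟨e⟩⟩ := h.nonempty_equiv
    exact .congr_left e (hC Y hY k)
  | succ d ih =>
    intro k hk
    obtain ⟨k, rfl⟩ : ∃ k', k = k' + 1 := ⟨k - 1, by omega⟩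
    obtain ⟨Y, Z, f, g, hs, hY, hZ⟩ := h.exists_ses
    exact .quot_left hs (ih hZ k (by omega)) (hC Y hY k)

theorem InAdd.extVanish_left {T X : ModuleCat.{u} A} (h : InAdd T X) {k : ℕ}
    (hT : ExtVanish A k T Y) : ExtVanish A k X Y := by
  obtain ⟨m, i, p, hip⟩ := h
  exact (hT.pi_left m).retract_left i p hip

theorem InAdd.extVanish_right {T X : ModuleCat.{u} A} (h : InAdd T X) {k : ℕ}
    (hT : ExtVanish A k Y T) : ExtVanish A k Y X := by
  obtain ⟨m, i, p, hip⟩ := h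
  exact (hT.pi_right m).retract_right i p hip

theorem InAdd.self (T : ModuleCat.{u} A) : InAdd T T :=
  ⟨1, LinearMap.single A (fun _ => T) 0, LinearMap.proj 0, by
    ext x
    simp⟩

theorem InAdd.subsingleton {T X : ModuleCat.{u} A} (h : InAdd T X) [Subsingleton T] :
    Subsingleton X := by
  obtain ⟨m, i, p, hip⟩ := h
  have hi : Function.Injective i := Function.LeftInverse.injective (g := p) fun x =>
    LinearMap.congr_fun hip x
  exact hi.subsingleton

end

/-! ### Testing homological dimensions on finitely generated modules -/

section

variable {A : Type u} [Ring A] [IsArtinianRing A]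

/-- In degree one, a finite free cover has finitely generated kernel, so it splits and `Q` is
projective. Higher degrees reduce to this by passing to a syzygy. -/
theorem ExtVanish.of_forall_finite_right {d : ℕ} (Q : Type u) [AddCommGroup Q] [Module A Q]
    [Module.Finite A Q]
    (h : ∀ (Y : Type u) [AddCommGroup Y] [Module A Y] [Module.Finite A Y],
      ExtVanish A (d + 1) Q Y) (Y : Type u) [AddCommGroup Y] [Module A Y] :
    ExtVanish A (d + 1) Q Y := by
  induction d generalizing Q with
  | zero =>
    obtain ⟨m, f, hf⟩ := Module.Finite.exists_fin' A Q
    obtain ⟨s, hs⟩ := (h (LinearMap.ker f)).exists_lift (Ses.of_ker f hf) LinearMap.id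
    exact .retract_left s f hs .of_projective
  | succ d ih =>
    obtain ⟨m, f, hf⟩ := Module.Finite.exists_fin' A Q
    refine .quot_left (Ses.of_ker f hf) (ih _ fun Y _ _ _ => ?_) .of_projective
    exact .sub_left (Ses.of_ker f hf) .of_projective (h Y)

omit [IsArtinianRing A] in
/-- Extensions by arbitrary finitely generated modules, in the top degree, are controlled by
extensions by the regular module. -/
theorem ExtVanish.of_regular {k : ℕ} {Q : Type u} [AddCommGroup Q] [Module A Q]
    (hA : ExtVanish A k Q A)
    (h : ∀ (Y : Type u) [AddCommGroup Y] [Module A Y], ExtVanish A (k + 1) Q Y)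
    (X : Type u) [AddCommGroup X] [Module A X] [Module.Finite A X] : ExtVanish A k Q X := by
  obtain ⟨m, f, hf⟩ := Module.Finite.exists_fin' A X
  exact .quot_right (Ses.of_ker f hf) (hA.pi_right m) (h _)

variable {W : Type u} [AddCommGroup W] [Module A W]

omit [IsArtinianRing A] in
theorem ExtVanish.of_forall_finite_left [Module.Finite A W] [Module.Injective A W]
    (hW : ∀ (X : Type u) [AddCommGroup X] [Module A X] [Module.Finite A X],
      ∃ (m : ℕ) (f : X →ₗ[A] (Fin m → W)), Function.Injective f)
    {d : ℕ} (Q : Type u) [AddCommGroup Q] [Module A Q] [Module.Finite A Q]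
    (h : ∀ (Y : Type u) [AddCommGroup Y] [Module A Y] [Module.Finite A Y],
      ExtVanish A (d + 1) Y Q) (Y : Type u) [AddCommGroup Y] [Module A Y] :
    ExtVanish A (d + 1) Y Q := by
  induction d generalizing Q with
  | zero =>
    obtain ⟨m, f, hf⟩ := hW Q
    obtain ⟨s, hs⟩ := (h (_ ⧸ LinearMap.range f)).exists_extend (Ses.of_range f hf) LinearMap.id
    exact .retract_right f s hs (.pi_right .of_injective m)
  | succ d ih =>
    obtain ⟨m, f, hf⟩ := hW Q
    refine .sub_right (Ses.of_range f hf) (ih _ fun Y _ _ _ => ?_) (.pi_right .of_injective m)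
    exact .quot_right (Ses.of_range f hf) (.pi_right .of_injective m) (h Y)

omit [IsArtinianRing A] in
-- Embed `X` into a power of `W`; in the top degree restriction to `X` is onto, since the next Ext
-- group vanishes.
theorem ExtVanish.of_cogenerator
    (hW : ∀ (X : Type u) [AddCommGroup X] [Module A X] [Module.Finite A X],
      ∃ (m : ℕ) (f : X →ₗ[A] (Fin m → W)), Function.Injective f) {k : ℕ} {Q : Type u}
    [AddCommGroup Q] [Module A Q] (hWQ : ExtVanish A k W Q)
    (h : ∀ (Y : Type u) [AddCommGroup Y] [Module A Y], ExtVanish A (k + 1) Y Q)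
    (X : Type u) [AddCommGroup X] [Module A X] [Module.Finite A X] : ExtVanish A k X Q := by
  obtain ⟨m, f, hf⟩ := hW X
  exact .sub_left (Ses.of_range f hf) (hWQ.pi_left m) (h _)

end

end

end GoodFilt

namespace GoodFilt
open CategoryTheory Abelian

noncomputable section

/-! ### Dimensions of tilting and cotilting modules -/

section

variable {A : Type u} [Ring A] {C : ModuleCat.{u} A → Prop} {X : ModuleCat.{u} A}

theorem coresDim_le {d : ℕ} (h : HasCores C X d) : coresDim C X ≤ d := iInf₂_le d h

theorem resDim_le {d : ℕ} (h : HasRes C X d) : resDim C X ≤ d := iInf₂_le d h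

theorem le_coresDim {d : ℕ} (h : ∀ m, HasCores C X m → d ≤ m) : (d : ℕ∞) ≤ coresDim C X :=
  le_iInf₂ fun m hm => Nat.cast_le.2 (h m hm)

theorem le_resDim {d : ℕ} (h : ∀ m, HasRes C X m → d ≤ m) : (d : ℕ∞) ≤ resDim C X :=
  le_iInf₂ fun m hm => Nat.cast_le.2 (h m hm)

theorem hasProjectiveDimensionLT_iff_extVanish {d : ℕ} : HasProjectiveDimensionLT X d ↔
    ∀ k ≥ d, ∀ (Y : Type u) [AddCommGroup Y] [Module A Y], ExtVanish A k X Y := by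
  rw [hasProjectiveDimensionLT_iff]
  exact ⟨fun h k hk Y _ _ => ExtVanish.iff_forall.2 fun x => h k hk x,
    fun h k hk Y x => ExtVanish.iff_forall.1 (h k hk Y) x⟩

theorem hasInjectiveDimensionLT_iff_extVanish {d : ℕ} : HasInjectiveDimensionLT X d ↔
    ∀ k ≥ d, ∀ (Y : Type u) [AddCommGroup Y] [Module A Y], ExtVanish A k Y X := by
  rw [hasInjectiveDimensionLT_iff]
  exact ⟨fun h k hk Y _ _ => ExtVanish.iff_forall.2 fun x => h k hk x,
    fun h k hk Y x => ExtVanish.iff_forall.1 (h k hk Y) x⟩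

end

section

variable {A : Type u} [Ring A] [IsArtinianRing A] [Nontrivial A] {ι : Type}
  {Θ Θ' : ι → ModuleCat.{u} A}

/-- All four numbers are compared with the largest projective dimension `d` of a `Θ i`, and `A` is
the module that detects `d`. -/
theorem exists_dim_of_tilting (hΘ : ∀ i, Module.Finite A (Θ i)) (hA : FiltM Θ A)
    (hext : ∀ k i j, ExtVanish A (k + 1) (Θ i) (Θ' j))
    (hright : ∀ (Y : Type u) [AddCommGroup Y] [Module A Y] [Module.Finite A Y],
      (∀ i, ExtVanish A 1 (Θ i) Y) → FiltM Θ' Y)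
    (happ : ∀ (X : Type u) [AddCommGroup X] [Module A X] [Module.Finite A X],
      ∃ (Y : ModuleCat.{u} A) (f : X →ₗ[A] Y), Function.Injective f ∧ Module.Finite A Y ∧
        FiltM Θ' Y ∧ FiltM Θ (Y ⧸ LinearMap.range f))
    (hpd : ∃ N : ℕ, ∀ k > N, ∀ (i : ι) (Y : Type u) [AddCommGroup Y] [Module A Y],
      ExtVanish A k (Θ i) Y)
    (T : ModuleCat.{u} A) (hT : ∀ X : ModuleCat.{u} A, InAdd T X ↔ Filt Θ X ∧ Filt Θ' X) :
    ∃ d : ℕ, (⨆ (X : ModuleCat.{u} A) (_ : Module.Finite A X), coresDim (Filt Θ') X) = d ∧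
      projectiveDimension T = d ∧ addCodim T (ModuleCat.of A A) = d ∧
      coresDim (Filt Θ') (ModuleCat.of A A) = d := by
  classical
  obtain ⟨d, hd, hmin⟩ : ∃ d : ℕ, (∀ k > d, ∀ (i : ι) (Y : Type u) [AddCommGroup Y] [Module A Y],
      ExtVanish A k (Θ i) Y) ∧ ∀ m, (∀ k > m, ∀ (i : ι) (Y : Type u) [AddCommGroup Y] [Module A Y],
      ExtVanish A k (Θ i) Y) → d ≤ m :=
    ⟨Nat.find hpd, Nat.find_spec hpd, fun m hm => Nat.find_min' hpd hm⟩
  have hQ : ∀ k > d, ∀ (Q : Type u) [AddCommGroup Q] [Module A Q] (Y : Type u) [AddCommGroup Y]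
      [Module A Y], FiltM Θ Q → ExtVanish A k Q Y :=
    fun k hk Q _ _ Y _ _ hQ => hQ.extVanish_left fun i => hd k hk i Y
  have hdual : ∀ Y : ModuleCat.{u} A, FiltM Θ' Y → ∀ k i, ExtVanish A (k + 1) (Θ i) Y :=
    fun Y hY k i => hY.extVanish_right (hext k i)
  -- If every `Ext^d(Θ i, A)` vanished, right exactness in the top degree would give vanishing on
  -- all finitely generated modules, then on all modules, against the minimality of `d`.
  have hex : d ≠ 0 → ∃ i, (∃ Y : ModuleCat.{u} A, ¬ ExtVanish A d (Θ i) Y) ∧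
      ¬ ExtVanish A d (Θ i) A := by
    intro h0
    obtain ⟨m, rfl⟩ := Nat.exists_eq_succ_of_ne_zero h0
    by_contra hcon
    have h1 : ∀ (i : ι) (Y : Type u) [AddCommGroup Y] [Module A Y],
        ExtVanish A (m + 1) (Θ i) Y := by
      intro i Y _ _
      by_contra hY
      refine hcon ⟨i, ⟨ModuleCat.of A Y, hY⟩, fun hreg => hY ?_⟩
      have := hΘ i
      exact .of_forall_finite_right _ (fun Y _ _ _ => .of_regular hreg
        (fun Z _ _ => hd (m + 2) (by omega) i Z) Y) Y
    have h2 := hmin m fun k hk i Y _ _ => by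
      rcases Nat.lt_or_eq_of_le (Nat.succ_le_of_lt hk) with h | h
      · exact hd k h i Y
      · subst h
        exact h1 i Y
    omega
  have hlow : ∀ m, HasCores (Filt Θ') (ModuleCat.of A A) m → d ≤ m := by
    intro m hm
    by_contra hlt
    obtain ⟨i, -, hi⟩ := hex (by omega)
    exact hi (hm.extVanish (fun M hM k => hdual M hM k i) d (by omega))
  -- Replacing `X` by the cokernel of its approximation lowers the degree of vanishing by one; at
  -- degree one the module itself is in `F(Θ')`.
  have hup : ∀ m, ∀ X : ModuleCat.{u} A, Module.Finite A X →
      (∀ i, ExtVanish A (m + 1) (Θ i) X) → HasCores (Filt Θ') X m := by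
    intro m
    induction m with
    | zero => exact fun X _ hX => .zero (hright X hX)
    | succ m ih =>
      intro X _ hX
      obtain ⟨Y, f, hf, hY, hY', -⟩ := happ X
      exact .succ (Ses.of_range f hf) hY' (ih (ModuleCat.of A (Y ⧸ LinearMap.range f))
        inferInstance fun i => .quot_right (Ses.of_range f hf) (hdual Y hY' m i) (hX i))
  -- For `X ∈ F(Θ)` the approximation is an extension of `Θ`-filtered modules, so it lies in `add
  -- T`, and the cokernel is again in `F(Θ)`.
  have hupT : ∀ m, ∀ X : ModuleCat.{u} A, Module.Finite A X → FiltM Θ X →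
      (∀ i, ExtVanish A (m + 1) (Θ i) X) → HasCores (InAdd T) X m := by
    intro m
    induction m with
    | zero => exact fun X _ hXQ hX => .zero ((hT X).2 ⟨hXQ, hright X hX⟩)
    | succ m ih =>
      intro X _ hXQ hX
      obtain ⟨Y, f, hf, hY, hY', hq⟩ := happ X
      exact .succ (Ses.of_range f hf) ((hT Y).2 ⟨FiltM.ext (Ses.of_range f hf) hXQ hq, hY'⟩)
        (ih (ModuleCat.of A (Y ⧸ LinearMap.range f)) inferInstance hq
          fun i => .quot_right (Ses.of_range f hf) (hdual Y hY' m i) (hX i))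
  have h1 : HasCores (InAdd T) (ModuleCat.of A A) d :=
    hupT d _ (inferInstanceAs (Module.Finite A A)) hA fun i => hd _ (by omega) i _
  have hlowT : ∀ m, HasCores (InAdd T) (ModuleCat.of A A) m → d ≤ m :=
    fun m hm => hlow m (hm.mono fun M hM => ((hT M).1 hM).2)
  have h2 : HasCores (Filt Θ') (ModuleCat.of A A) d := h1.mono fun M hM => ((hT M).1 hM).2
  refine ⟨d, le_antisymm (iSup₂_le fun X hX => coresDim_le (hup d X hX fun i => hd _ (by omega) i _))
    ((le_coresDim hlow).trans (le_iSup₂_of_le (ModuleCat.of A A)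
      (inferInstanceAs (Module.Finite A A)) le_rfl)), le_antisymm ?_ ?_,
    le_antisymm (coresDim_le h1) (le_coresDim hlowT), le_antisymm (coresDim_le h2)
      (le_coresDim hlow)⟩
  · refine (projectiveDimension_le_iff T d).2 (hasProjectiveDimensionLT_iff_extVanish.2 ?_)
    exact fun k hk Y _ _ => hQ k hk T Y ((hT T).1 (.self T)).1
  · rw [projectiveDimension_ge_iff]
    intro hlt
    -- The zero module has projective dimension `⊥`, so `d = 0` requires `T ≠ 0`: otherwise the
    -- approximation of `A` would be zero and so would `A`.
    by_cases h0 : d = 0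
    · subst h0
      have := ModuleCat.subsingleton_of_isZero ((hasProjectiveDimensionLT_zero_iff_isZero T).1 hlt)
      obtain ⟨Y, f, hf, hY, hY', hq⟩ := happ A
      have := ((hT Y).2 ⟨FiltM.ext (Ses.of_range f hf) hA hq, hY'⟩).subsingleton
      exact not_subsingleton A hf.subsingleton
    · obtain ⟨i, ⟨Z, hZ⟩, -⟩ := hex h0
      rw [hasProjectiveDimensionLT_iff_extVanish] at hlt
      have := hΘ i
      obtain ⟨Y, f, hf, hY, hY', hq⟩ := happ (Θ i)
      -- `Ext^d(Y, Z)` maps onto `Ext^d(Θ i, Z)`, the cokernel of the embedding having no Ext in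
      -- degree `d + 1`. A nonzero class thus forces one on `Y ∈ add T`, hence on `T`.
      have hYT := (hT Y).2 ⟨FiltM.ext (Ses.of_range f hf) (FiltM.single i) hq, hY'⟩
      exact hZ (.sub_left (Ses.of_range f hf) (hYT.extVanish_left (hlt d le_rfl Z))
        (hQ _ (by omega) _ _ hq))

/-- The mirror image, with `d` the largest injective dimension of a `Θ' i` and an injective
cogenerator `W` in the role of the regular module. -/
theorem exists_dim_of_cotilting (hΘ' : ∀ i, Module.Finite A (Θ' i)) (W : ModuleCat.{u} A)
    [Module.Finite A W] [Module.Injective A W]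
    (hWX : ∀ (X : Type u) [AddCommGroup X] [Module A X] [Module.Finite A X],
      ∃ (m : ℕ) (f : X →ₗ[A] (Fin m → W)), Function.Injective f) (hW : FiltM Θ' W)
    (hext : ∀ k i j, ExtVanish A (k + 1) (Θ i) (Θ' j))
    (hleft : ∀ (X : Type u) [AddCommGroup X] [Module A X] [Module.Finite A X],
      (∀ i, ExtVanish A 1 X (Θ' i)) → FiltM Θ X)
    (happ : ∀ (X : Type u) [AddCommGroup X] [Module A X] [Module.Finite A X],
      ∃ (Y : ModuleCat.{u} A) (f : Y →ₗ[A] X), Function.Surjective f ∧ Module.Finite A Y ∧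
        FiltM Θ Y ∧ FiltM Θ' (LinearMap.ker f))
    (hid : ∃ N : ℕ, ∀ k > N, ∀ (i : ι) (Y : Type u) [AddCommGroup Y] [Module A Y],
      ExtVanish A k Y (Θ' i))
    (S : ModuleCat.{u} A) (hS : ∀ X : ModuleCat.{u} A, InAdd S X ↔ Filt Θ' X ∧ Filt Θ X) :
    ∃ d : ℕ, (⨆ (X : ModuleCat.{u} A) (_ : Module.Finite A X), resDim (Filt Θ) X) = d ∧
      injectiveDimension S = d ∧ addDim S W = d ∧ resDim (Filt Θ) W = d := by
  classical
  obtain ⟨d, hd, hmin⟩ : ∃ d : ℕ, (∀ k > d, ∀ (i : ι) (Y : Type u) [AddCommGroup Y] [Module A Y],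
      ExtVanish A k Y (Θ' i)) ∧ ∀ m, (∀ k > m, ∀ (i : ι) (Y : Type u) [AddCommGroup Y] [Module A Y],
      ExtVanish A k Y (Θ' i)) → d ≤ m :=
    ⟨Nat.find hid, Nat.find_spec hid, fun m hm => Nat.find_min' hid hm⟩
  have hQ : ∀ k > d, ∀ (Q : Type u) [AddCommGroup Q] [Module A Q] (Y : Type u) [AddCommGroup Y]
      [Module A Y], FiltM Θ' Q → ExtVanish A k Y Q :=
    fun k hk Q _ _ Y _ _ hQ => hQ.extVanish_right fun i => hd k hk i Y
  have hdual : ∀ Y : ModuleCat.{u} A, FiltM Θ Y → ∀ k i, ExtVanish A (k + 1) Y (Θ' i) :=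
    fun Y hY k i => hY.extVanish_left fun j => hext k j i
  have hex : d ≠ 0 → ∃ i, (∃ Y : ModuleCat.{u} A, ¬ ExtVanish A d Y (Θ' i)) ∧
      ¬ ExtVanish A d W (Θ' i) := by
    intro h0
    obtain ⟨m, rfl⟩ := Nat.exists_eq_succ_of_ne_zero h0
    by_contra hcon
    have h1 : ∀ (i : ι) (Y : Type u) [AddCommGroup Y] [Module A Y],
        ExtVanish A (m + 1) Y (Θ' i) := by
      intro i Y _ _
      by_contra hY
      refine hcon ⟨i, ⟨ModuleCat.of A Y, hY⟩, fun hreg => hY ?_⟩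
      have := hΘ' i
      exact .of_forall_finite_left hWX _ (fun Y _ _ _ => .of_cogenerator hWX hreg
        (fun Z _ _ => hd (m + 2) (by omega) i Z) Y) Y
    have h2 := hmin m fun k hk i Y _ _ => by
      rcases Nat.lt_or_eq_of_le (Nat.succ_le_of_lt hk) with h | h
      · exact hd k h i Y
      · subst h
        exact h1 i Y
    omega
  have hlow : ∀ m, HasRes (Filt Θ) W m → d ≤ m := by
    intro m hm
    by_contra hlt
    obtain ⟨i, -, hi⟩ := hex (by omega)
    exact hi (hm.extVanish (fun M hM k => hdual M hM k i) d (by omega))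
  have hup : ∀ m, ∀ X : ModuleCat.{u} A, Module.Finite A X →
      (∀ i, ExtVanish A (m + 1) X (Θ' i)) → HasRes (Filt Θ) X m := by
    intro m
    induction m with
    | zero => exact fun X _ hX => .zero (hleft X hX)
    | succ m ih =>
      intro X _ hX
      obtain ⟨Y, f, hf, hY, hY', -⟩ := happ X
      exact .succ (Ses.of_ker f hf) hY' (ih (ModuleCat.of A (LinearMap.ker f))
        (inferInstanceAs (Module.Finite A (LinearMap.ker f)))
        fun i => .sub_left (Ses.of_ker f hf) (hdual Y hY' m i) (hX i))
  have hupS : ∀ m, ∀ X : ModuleCat.{u} A, Module.Finite A X → FiltM Θ' X →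
      (∀ i, ExtVanish A (m + 1) X (Θ' i)) → HasRes (InAdd S) X m := by
    intro m
    induction m with
    | zero => exact fun X _ hXQ hX => .zero ((hS X).2 ⟨hXQ, hleft X hX⟩)
    | succ m ih =>
      intro X _ hXQ hX
      obtain ⟨Y, f, hf, hY, hY', hq⟩ := happ X
      exact .succ (Ses.of_ker f hf) ((hS Y).2 ⟨FiltM.ext (Ses.of_ker f hf) hq hXQ, hY'⟩)
        (ih (ModuleCat.of A (LinearMap.ker f))
          (inferInstanceAs (Module.Finite A (LinearMap.ker f))) hq
          fun i => .sub_left (Ses.of_ker f hf) (hdual Y hY' m i) (hX i))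
  have h1 : HasRes (InAdd S) W d := hupS d W inferInstance hW fun i => hd _ (by omega) i _
  have hlowS : ∀ m, HasRes (InAdd S) W m → d ≤ m :=
    fun m hm => hlow m (hm.mono fun M hM => ((hS M).1 hM).2)
  have h2 : HasRes (Filt Θ) W d := h1.mono fun M hM => ((hS M).1 hM).2
  refine ⟨d, le_antisymm (iSup₂_le fun X hX => resDim_le (hup d X hX fun i => hd _ (by omega) i _))
    ((le_resDim hlow).trans (le_iSup₂_of_le W inferInstance le_rfl)), le_antisymm ?_ ?_,
    le_antisymm (resDim_le h1) (le_resDim hlowS), le_antisymm (resDim_le h2) (le_resDim hlow)⟩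
  · refine (injectiveDimension_le_iff S d).2 (hasInjectiveDimensionLT_iff_extVanish.2 ?_)
    exact fun k hk Y _ _ => hQ k hk S Y ((hS S).1 (.self S)).1
  · rw [injectiveDimension_ge_iff]
    intro hlt
    by_cases h0 : d = 0
    · subst h0
      have := ModuleCat.subsingleton_of_isZero ((hasInjectiveDimensionLT_zero_iff_isZero S).1 hlt)
      obtain ⟨Y, f, hf, hY, hY', hq⟩ := happ W
      have := ((hS Y).2 ⟨FiltM.ext (Ses.of_ker f hf) hq hW, hY'⟩).subsingleton
      have := hf.subsingleton
      obtain ⟨m, g, hg⟩ := hWX A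
      exact not_subsingleton A hg.subsingleton
    · obtain ⟨i, ⟨Z, hZ⟩, -⟩ := hex h0
      rw [hasInjectiveDimensionLT_iff_extVanish] at hlt
      have := hΘ' i
      obtain ⟨Y, f, hf, hY, hY', hq⟩ := happ (Θ' i)
      have hYS := (hS Y).2 ⟨FiltM.ext (Ses.of_ker f hf) hq (FiltM.single i), hY'⟩
      exact hZ (.quot_right (Ses.of_ker f hf) (hYS.extVanish_right (hlt d le_rfl Z))
        (hQ _ (by omega) _ _ hq))

end

theorem exists_injective_DReg {R A J : Type u} [CommRing R] [IsArtinianRing R] [Ring A]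
    [IsArtinianRing A] [Algebra R A] [AddCommGroup J] [Module R J]
    (hJ : IsInjEnvelope R (R ⧸ Ring.jacobson R) J) (X : Type u) [AddCommGroup X] [Module A X]
    [Module.Finite A X] :
    ∃ (m : ℕ) (f : X →ₗ[A] (Fin m → DReg R A J)), Function.Injective f := by
  let _ : Module R X := Module.compHom X (algebraMap R A)
  have : IsScalarTower R A X := ⟨fun r a x => by
    rw [Algebra.smul_def, mul_smul]
    rfl⟩
  exact exists_injective_pi fun x hx => exists_hom_DReg_ne_zero hJ hx

end

end GoodFilt

/-! ### Application to `(Δ, ∇̄)` and `(Δ̄, ∇)` -/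

theorem corollary2p7 {R A J : Type u} [CommRing R] [IsArtinianRing R]
    [Ring A] [Nontrivial A] [Algebra R A] [Module.Finite R A]
    [AddCommGroup J] [Module R J] (hJ : GoodFilt.IsInjEnvelope R (R ⧸ Ring.jacobson R) J)
    {n : ℕ} (e : Fin n → A) (he : GoodFilt.IsBasicIdempotents e)
    (hA : GoodFilt.IsProperlyStratified e)
    (T S : ModuleCat.{u} A) [Module.Finite A T] [Module.Finite A S]
    (hT : ∀ X : ModuleCat.{u} A, GoodFilt.InAdd T X ↔
      GoodFilt.Filt (GoodFilt.Std e) X ∧ GoodFilt.Filt (GoodFilt.PCostd e R J) X)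
    (hS : ∀ X : ModuleCat.{u} A, GoodFilt.InAdd S X ↔
      GoodFilt.Filt (GoodFilt.Costd e R J) X ∧ GoodFilt.Filt (GoodFilt.PStd e) X) :
    (∃ d : ℕ, GoodFilt.nablaGfdAlg e R J = d ∧
      CategoryTheory.projectiveDimension T = d ∧
      GoodFilt.addCodim T (ModuleCat.of A A) = d ∧
      GoodFilt.nablaGfd e R J (ModuleCat.of A A) = d) ∧
    (∃ s : ℕ, GoodFilt.deltaGfdAlg e = s ∧
      CategoryTheory.injectiveDimension S = s ∧
      GoodFilt.addDim S (ModuleCat.of A (GoodFilt.DReg R A J)) = s ∧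
      GoodFilt.deltaGfd e (ModuleCat.of A (GoodFilt.DReg R A J)) = s) := by
  have : IsArtinianRing A := IsArtinianRing.of_finite R A
  have h2 := (GoodFilt.stdPair hJ he).ext_two he hA.1
  have h2' := (GoodFilt.pstdPair hJ he).ext_two he hA.2
  refine ⟨GoodFilt.exists_dim_of_tilting (fun _ => inferInstance) hA.1
    ((GoodFilt.stdPair hJ he).ext_all he hA.1)
    (fun Y _ _ _ hY => (GoodFilt.stdPair hJ he).filtM_right he h2 Y hY)
    (fun X _ _ _ => GoodFilt.exists_embedding hJ he hA.1 X)
    (GoodFilt.exists_forall_extVanish_std hJ he hA.1) T hT, ?_⟩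
  have := hJ.1
  have : Module.Injective A (GoodFilt.DReg R A J) := GoodFilt.injective_DReg
  have : Module.Finite A (ModuleCat.of A (GoodFilt.DReg R A J)) := GoodFilt.finite_DReg hJ
  exact GoodFilt.exists_dim_of_cotilting (fun i => GoodFilt.finite_costd hJ i)
    (ModuleCat.of A (GoodFilt.DReg R A J))
    (fun X _ _ _ => GoodFilt.exists_injective_DReg hJ X)
    -- `D(A)` lies in `F(∇)` because, being injective, it is orthogonal to every `Δ̄(i)`.
    ((GoodFilt.pstdPair hJ he).filtM_right he h2' _ fun _ => .of_injective)
    ((GoodFilt.pstdPair hJ he).ext_all he hA.2)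
    (fun X _ _ _ hX => (GoodFilt.pstdPair hJ he).filtM_left he h2' X hX)
    (fun X _ _ _ => GoodFilt.exists_covering hJ he hA.2 X)
    (GoodFilt.exists_forall_extVanish_costd hJ he hA.2) S hS
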